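/- Let $n\ge 2$ and let $M^n$ be a smooth compact $n$-manifold without boundary. Let $\Phi:(0,\infty)\to\mathbb{R}$ be smooth with $\Phi>0$, $\Phi'>0$, $\Phi''>0$ and $\Phi'(x)\ge \Phi(x)/x$ for all $x>0$. Let $X:M^n\times[0,T)\to\mathbb{R}^{n+1}$ be a smooth solution of the $\Phi(H)$-flow: each $X_t=X(\cdot,t)$ is an immersion and $$\frac{\partial X}{\partial t}(p,t)=-\Phi\big(H(p,t)\big)\,\nu(p,t),\qquad (p,t)\in M^n\times[0,T),$$ where $\nu$ is a smooth unit normal field along the flow and $H$ is the mean curvature, i.e. the trace of the Weingarten map $\mathscr W=(g^{ik}h_{kj})$ with $g_{ij}=\langle\partial_iX,\partial_jX\rangle$ and $h_{ij}=\langle\partial_i\nu,\partial_jX\rangle$ (so that a round sphere with outer normal $\nu$ has positive curvature). Suppose that $M_0=X_0(M^n)$ is weakly convex, i.e. all eigenvalues of $\mathscr W$ at $t=0$ are nonnegative, and that $H(p,0)>0$ for all $p\in M^n$ (i.e. $H_{\min}(0)>0$); thus $\nu$ is the outer normal. Then $M_t=X_t(M^n)$ is strictly convex for every $t\in(0,T)$,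 i.e. all eigenvalues of $\mathscr W$ at every point are positive. -/

import Mathlib

open Set Function
open scoped Manifold ContDiff

noncomputable section

namespace PhiFlow

/-- The ambient Euclidean space of dimension `n + 1`. -/
abbrev Ambient (n : ℕ) : Type := EuclideanSpace ℝ (Fin (n + 1))

section Geometry

variable {n : ℕ} {M : Type*} [TopologicalSpace M] [ChartedSpace (EuclideanSpace ℝ (Fin n)) M]

/-- The differential of a map `F : M → ℝⁿ⁺¹` at `p`. -/
def differential (F : M → Ambient n) (p : M) : TangentSpace (𝓡 n) p →L[ℝ] Ambient n :=
  mfderiv (𝓡 n) 𝓘(ℝ, Ambient n) F p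

/-- The `i`-th coordinate vector `∂ᵢ` at `p`, in the preferred chart around `p`. -/
def coordVector (p : M) (i : Fin n) : TangentSpace (𝓡 n) p :=
  (EuclideanSpace.single i (1 : ℝ) : EuclideanSpace ℝ (Fin n))

/-- The induced metric `g_{ij} = ⟨∂ᵢ X, ∂ⱼ X⟩`. -/
def metricMatrix (X : M → Ambient n) (p : M) : Matrix (Fin n) (Fin n) ℝ :=
  Matrix.of fun i j =>
    inner ℝ (differential X p (coordVector p i)) (differential X p (coordVector p j))

/-- The second fundamental form `h_{ij} = ⟨∂ᵢ ν, ∂ⱼ X⟩` with respect to the unit normal `ν`.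
With this sign it is positive on a round sphere with outer normal `ν`. -/
def secondFundamentalMatrix (X ν : M → Ambient n) (p : M) : Matrix (Fin n) (Fin n) ℝ :=
  Matrix.of fun i j =>
    inner ℝ (differential ν p (coordVector p i)) (differential X p (coordVector p j))

/-- The Weingarten map `g^{ik} h_{kj}`. -/
def weingarten (X ν : M → Ambient n) (p : M) : Matrix (Fin n) (Fin n) ℝ :=
  (metricMatrix X p)⁻¹ * secondFundamentalMatrix X ν p

/-- The mean curvature: the trace of the Weingarten map. -/
def meanCurvature (X ν : M → Ambient n) (p : M) : ℝ :=
  (weingarten X ν p).trace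

/-- `κ` is a principal curvature at `p`: an eigenvalue of the Weingarten map. -/
def IsPrincipalCurvature (X ν : M → Ambient n) (p : M) (κ : ℝ) : Prop :=
  Module.End.HasEigenvalue (Matrix.toLin' (weingarten X ν p)) κ

/-- All principal curvatures are nonnegative. -/
def WeaklyConvex (X ν : M → Ambient n) : Prop :=
  ∀ (p : M) (κ : ℝ), IsPrincipalCurvature X ν p κ → 0 ≤ κ

/-- All principal curvatures are positive. -/
def StrictlyConvex (X ν : M → Ambient n) : Prop :=
  ∀ (p : M) (κ : ℝ), IsPrincipalCurvature X ν p κ → 0 < κ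

/-- `X : M × [0, T) → ℝⁿ⁺¹` is a smooth solution, with smooth unit normal field `ν`, of
`∂X/∂t = -Φ(H) ν`. Values of `X` and `ν` at times outside `[0, T)` play no role, and the time
derivative is one-sided at `t = 0`. -/
structure IsSolution (Φ : ℝ → ℝ) (T : ℝ) (X ν : ℝ → M → Ambient n) : Prop where
  smooth : ContMDiffOn (𝓘(ℝ, ℝ).prod (𝓡 n)) 𝓘(ℝ, Ambient n) ∞ (uncurry X) (Ico 0 T ×ˢ univ)
  immersion : ∀ t ∈ Ico 0 T, ∀ p : M, Injective (differential (X t) p)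
  smooth_normal :
    ContMDiffOn (𝓘(ℝ, ℝ).prod (𝓡 n)) 𝓘(ℝ, Ambient n) ∞ (uncurry ν) (Ico 0 T ×ˢ univ)
  norm_normal : ∀ t ∈ Ico 0 T, ∀ p : M, ‖ν t p‖ = 1
  normal_orthogonal : ∀ t ∈ Ico 0 T, ∀ (p : M) (v : TangentSpace (𝓡 n) p),
    inner ℝ (ν t p) (differential (X t) p v) = 0
  evolution : ∀ t ∈ Ico 0 T, ∀ p : M,
    HasDerivWithinAt (fun s => X s p) (-(Φ (meanCurvature (X t) (ν t) p)) • ν t p) (Ico 0 T) t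

end Geometry

end PhiFlow

end

/-! The smallest principal curvature need not be smooth, so it is controlled through smooth
functions touching it from below. Suppose that `φ` lies below all principal curvatures near a point
up to its time, and equals the smallest one there, with unit direction `v`. In coordinates normal at
that point and with `v` frozen, `h(v,v) - φ g(v,v)` has a minimum. The conditions `∂ₜ ≤ 0` and `∂ₖ²
≥ 0`, the evolution equations `∂ₜg = -2Φh` and `∂ₜh = ∇²Φ(H) - Φh²`, and Simons' identity give `∂ₜφ
≥ Φ'(H)(Δφ + |A|²φ - Hφ²) + Φ(H)φ²`. The one gradient term, `Φ''(H)(∇ᵥH)²`, has a favourable sign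
because `Φ'' > 0`. This is `LocalFlow.touching`; Simons' identity enters only as the symmetry of
fourth partial derivatives of the immersion.

Three comparison arguments at a first bad time follow. The equation `∂ₜH = ΔΦ(H) + Φ(H)|A|²` forbids
an interior minimum of `H`, so `H` stays positive (`meanCurvature_pos`). Negative functions of time
alone, growing exponentially in size, are excluded as touching functions, so weak convexity persists
(`atLeast_zero`). Finally, a positive barrier supported in a ball expanding from radius `δ` to `R`
is excluded as well, so strict convexity at one point spreads at once over a whole coordinate ball
(`LocalFlow.propagation`). This replaces the strong maximum principle.

By propagation, the set of points that are strictly convex at all positive times is open and closed.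
If its complement were nonempty, `‖X₀‖` would have a maximum on it, which is a local maximum on `M`.
There the hypersurface touches a sphere from inside and is strictly convex at time zero, hence at
small positive times by continuity and at all later ones by propagation: a contradiction
(`above_zero`). Connectedness of `M` is not needed. -/

noncomputable section

namespace PhiFlow

/-- The coordinate space of dimension `n`. -/
abbrev Coord (n : ℕ) : Type := EuclideanSpace ℝ (Fin n)

/-! ### Linear algebra of the shape operator -/

section LinearAlgebra

variable {n : ℕ}

/-- The `i`-th standard basis vector. -/
def basisVec (i : Fin n) : Coord n := EuclideanSpace.single i (1 : ℝ)

lemma sum_basisVec (v : Coord n) : v = ∑ i, v i • basisVec i := by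
  ext j
  simp [basisVec, Pi.single_apply]

lemma map_sum_basisVec {V : Type*} [NormedAddCommGroup V] [NormedSpace ℝ V]
    (A : Coord n →L[ℝ] V) (v : Coord n) : A v = ∑ i, v i • A (basisVec i) := by
  conv_lhs => rw [sum_basisVec v]
  simp

/-- The matrix `⟨A eᵢ, B eⱼ⟩`. -/
def gram (A B : Coord n →L[ℝ] Ambient n) : Matrix (Fin n) (Fin n) ℝ :=
  Matrix.of fun i j => inner ℝ (A (basisVec i)) (B (basisVec j))

/-- The matrix of the shape operator of a hypersurface with differential `A` whose normal
has differential `N`. -/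
def shape (A N : Coord n →L[ℝ] Ambient n) : Matrix (Fin n) (Fin n) ℝ :=
  (gram A A)⁻¹ * gram N A

lemma inner_eq_gram (A B : Coord n →L[ℝ] Ambient n) (v w : Coord n) :
    inner ℝ (A v) (B w) = ∑ i, ∑ j, v i * w j * gram A B i j := by
  rw [map_sum_basisVec A v, map_sum_basisVec B w]
  simp only [sum_inner]
  refine Finset.sum_congr rfl fun i _ => ?_
  rw [inner_sum]
  refine Finset.sum_congr rfl fun j _ => ?_
  simp only [inner_smul_left, inner_smul_right, gram, Matrix.of_apply, conj_trivial]
  ring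

lemma gram_mulVec (A B : Coord n →L[ℝ] Ambient n) (w : Coord n) (i : Fin n) :
    (gram A B).mulVec w i = inner ℝ (A (basisVec i)) (B w) := by
  rw [map_sum_basisVec B w]
  simp only [inner_sum, inner_smul_right, Matrix.mulVec, dotProduct, gram, Matrix.of_apply]
  exact Finset.sum_congr rfl fun j _ => mul_comm _ _

lemma inner_eq_sum_left (A B : Coord n →L[ℝ] Ambient n) (v w : Coord n) :
    inner ℝ (A v) (B w) = ∑ i, v i * inner ℝ (A (basisVec i)) (B w) := by
  rw [map_sum_basisVec A v]
  simp [sum_inner, inner_smul_left]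

lemma gram_det_ne_zero {A : Coord n →L[ℝ] Ambient n} (hA : Injective A) :
    (gram A A).det ≠ 0 := by
  intro h
  obtain ⟨v, hv, h0⟩ := Matrix.exists_mulVec_eq_zero_iff.mpr h
  apply hv
  have h1 : inner ℝ (A (WithLp.toLp 2 v)) (A (WithLp.toLp 2 v)) = (0 : ℝ) := by
    rw [inner_eq_sum_left]
    refine Finset.sum_eq_zero fun i _ => ?_
    rw [← gram_mulVec]
    simp [h0]
  have h2 : A (WithLp.toLp 2 v) = A 0 := by simpa using h1
  have h3 := hA h2
  simpa using congrArg (fun x : Coord n => x.ofLp) h3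

lemma gram_mul_shape {A : Coord n →L[ℝ] Ambient n} (hA : Injective A)
    (N : Coord n →L[ℝ] Ambient n) : gram A A * shape A N = gram N A := by
  rw [shape, Matrix.mul_nonsing_inv_cancel_left _ _ (isUnit_iff_ne_zero.mpr (gram_det_ne_zero hA))]

/-- The matrix of a linear endomorphism in the standard basis. -/
def coordMatrix (J : Coord n →L[ℝ] Coord n) : Matrix (Fin n) (Fin n) ℝ :=
  Matrix.of fun i j => J (basisVec j) i

lemma gram_comp (A B : Coord n →L[ℝ] Ambient n) (J : Coord n →L[ℝ] Coord n) :
    gram (A ∘L J) (B ∘L J) = (coordMatrix J).transpose * gram A B * coordMatrix J := by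
  ext i j
  simp only [gram, Matrix.of_apply, ContinuousLinearMap.comp_apply]
  rw [inner_eq_gram A B]
  simp only [Matrix.mul_apply, Matrix.transpose_apply, coordMatrix, Matrix.of_apply,
    Finset.sum_mul, gram]
  rw [Finset.sum_comm]
  refine Finset.sum_congr rfl fun k _ => Finset.sum_congr rfl fun l _ => ?_
  ring

lemma coordMatrix_det_ne_zero {J : Coord n →L[ℝ] Coord n} (hJ : Injective J) :
    (coordMatrix J).det ≠ 0 := by
  intro h
  obtain ⟨v, hv, h0⟩ := Matrix.exists_mulVec_eq_zero_iff.mpr h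
  apply hv
  have h2 : J (WithLp.toLp 2 v) = J 0 := by
    rw [map_sum_basisVec J, map_zero]
    ext i
    have := congrFun h0 i
    simp only [Matrix.mulVec, dotProduct, coordMatrix, Matrix.of_apply] at this
    simpa [mul_comm] using this
  simpa using congrArg (fun x : Coord n => x.ofLp) (hJ h2)

/-- A change of parameters conjugates the shape operator, so `H = tr W` and `|A|² = tr W²` may be
computed in any coordinates. -/
lemma shape_comp (A N : Coord n →L[ℝ] Ambient n) {J : Coord n →L[ℝ] Coord n}
    (hJ : Injective J) :
    shape (A ∘L J) (N ∘L J) = (coordMatrix J)⁻¹ * shape A N * coordMatrix J := by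
  have hd : IsUnit (coordMatrix J).transpose.det := by
    rw [Matrix.det_transpose]
    exact isUnit_iff_ne_zero.mpr (coordMatrix_det_ne_zero hJ)
  rw [shape, gram_comp, gram_comp, Matrix.mul_inv_rev, Matrix.mul_inv_rev, shape]
  simp only [Matrix.mul_assoc]
  rw [Matrix.nonsing_inv_mul_cancel_left _ _ hd]

lemma trace_shape_comp (A N : Coord n →L[ℝ] Ambient n) {J : Coord n →L[ℝ] Coord n}
    (hJ : Injective J) : (shape (A ∘L J) (N ∘L J)).trace = (shape A N).trace := by
  have hd : IsUnit (coordMatrix J).det := isUnit_iff_ne_zero.mpr (coordMatrix_det_ne_zero hJ)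
  rw [shape_comp A N hJ, Matrix.trace_mul_cycle, Matrix.mul_nonsing_inv _ hd, Matrix.one_mul]

lemma trace_shape_sq_comp (A N : Coord n →L[ℝ] Ambient n) {J : Coord n →L[ℝ] Coord n}
    (hJ : Injective J) :
    (shape (A ∘L J) (N ∘L J) * shape (A ∘L J) (N ∘L J)).trace
      = (shape A N * shape A N).trace := by
  have hd : IsUnit (coordMatrix J).det := isUnit_iff_ne_zero.mpr (coordMatrix_det_ne_zero hJ)
  have : shape (A ∘L J) (N ∘L J) * shape (A ∘L J) (N ∘L J)
      = (coordMatrix J)⁻¹ * (shape A N * shape A N) * coordMatrix J := by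
    rw [shape_comp A N hJ]
    simp only [Matrix.mul_assoc]
    rw [Matrix.mul_nonsing_inv_cancel_left _ _ hd]
  rw [this, Matrix.trace_mul_cycle, Matrix.mul_nonsing_inv _ hd, Matrix.one_mul]

lemma exists_of_hasEigenvalue {A N : Coord n →L[ℝ] Ambient n} (hA : Injective A) {κ : ℝ}
    (h : Module.End.HasEigenvalue (Matrix.toLin' (shape A N)) κ) :
    ∃ v : Coord n, v ≠ 0 ∧ inner ℝ (N v) (A v) = κ * inner ℝ (A v) (A v) := by
  obtain ⟨v, hv⟩ := h.exists_hasEigenvector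
  have h1 : (shape A N).mulVec v = κ • v := by
    simpa [Matrix.toLin'_apply] using hv.apply_eq_smul
  have h2 : (gram N A).mulVec v = κ • (gram A A).mulVec v := by
    rw [← gram_mul_shape hA, ← Matrix.mulVec_mulVec, h1, Matrix.mulVec_smul]
  refine ⟨WithLp.toLp 2 v, fun h0 => hv.2 ?_, ?_⟩
  · simpa using congrArg (fun x : Coord n => x.ofLp) h0
  · rw [inner_eq_sum_left N A, inner_eq_sum_left A A, Finset.mul_sum]
    refine Finset.sum_congr rfl fun i _ => ?_
    rw [← gram_mulVec, ← gram_mulVec]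
    have := congrFun h2 i
    simp only [Pi.smul_apply, smul_eq_mul] at this
    change _ * (gram N A).mulVec v i = κ * (_ * (gram A A).mulVec v i)
    rw [this]; ring

lemma inner_self_map_pos {A : Coord n →L[ℝ] Ambient n} (hA : Injective A) {v : Coord n}
    (hv : v ≠ 0) : 0 < (inner ℝ (A v) (A v) : ℝ) := by
  rw [real_inner_self_eq_norm_sq]
  have : A v ≠ 0 := fun h => hv (hA (by simpa using h))
  positivity

lemma eigenvalue_pos {A N : Coord n →L[ℝ] Ambient n} (hA : Injective A)
    (hpos : ∀ v, v ≠ 0 → 0 < (inner ℝ (N v) (A v) : ℝ)) {κ : ℝ}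
    (h : Module.End.HasEigenvalue (Matrix.toLin' (shape A N)) κ) : 0 < κ := by
  obtain ⟨v, hv, h1⟩ := exists_of_hasEigenvalue hA h
  have h2 := hpos v hv
  have h3 := inner_self_map_pos hA hv
  rw [h1] at h2
  exact pos_of_mul_pos_left h2 h3.le

/-- A null direction of a nonnegative symmetric form `⟨N v, A w⟩ - m ⟨A v, A w⟩` lies in
its kernel. -/
lemma null_of_nonneg {A N : Coord n →L[ℝ] Ambient n}
    (hsymm : ∀ v w, (inner ℝ (N v) (A w) : ℝ) = inner ℝ (N w) (A v)) {m : ℝ}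
    (hnonneg : ∀ v, m * inner ℝ (A v) (A v) ≤ (inner ℝ (N v) (A v) : ℝ)) {v : Coord n}
    (hv : (inner ℝ (N v) (A v) : ℝ) = m * inner ℝ (A v) (A v)) (w : Coord n) :
    (inner ℝ (N v) (A w) : ℝ) = m * inner ℝ (A v) (A w) := by
  set b := (inner ℝ (N v) (A w) : ℝ) - m * inner ℝ (A v) (A w) with hb
  set c := (inner ℝ (N w) (A w) : ℝ) - m * inner ℝ (A w) (A w) with hc
  have hc0 : 0 ≤ c := sub_nonneg.mpr (hnonneg w)
  have key : ∀ s : ℝ, 0 ≤ 2 * s * b + s ^ 2 * c := by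
    intro s
    have h := hnonneg (v + s • w)
    simp only [map_add, map_smul, inner_add_left, inner_add_right, inner_smul_left,
      inner_smul_right, conj_trivial] at h
    rw [hsymm w v, real_inner_comm (A v) (A w)] at h
    rw [hb, hc]
    linarith
  have hb0 : b = 0 := by
    -- The optimal `s` is `-b / c`; the denominator `c + 1` avoids the case `c = 0` and still makes
    -- the expression negative unless `b = 0`.
    have h1 := key (-b / (c + 1))
    have h2 : 0 < c + 1 := by linarith
    have h3 : 2 * (-b / (c + 1)) * b + (-b / (c + 1)) ^ 2 * c
        = - (b ^ 2 * (c + 2)) / (c + 1) ^ 2 := by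
      field_simp; ring
    rw [h3, le_div_iff₀ (by positivity)] at h1
    have : b ^ 2 * (c + 2) ≤ 0 := by linarith
    nlinarith [sq_nonneg b]
  linarith

/-- The Rayleigh quotient attains its minimum on the compact unit sphere; `u` serves only to make
that sphere nonempty. -/
lemma exists_lower_bound {A : Coord n →L[ℝ] Ambient n} (hA : Injective A)
    (N : Coord n →L[ℝ] Ambient n) {u : Coord n} (hu : u ≠ 0) :
    ∃ (m : ℝ) (v : Coord n), v ≠ 0 ∧ (inner ℝ (N v) (A v) : ℝ) = m * inner ℝ (A v) (A v) ∧
      ∀ w, m * inner ℝ (A w) (A w) ≤ (inner ℝ (N w) (A w) : ℝ) := by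
  have hcomp : IsCompact (Metric.sphere (0 : Coord n) 1) := isCompact_sphere _ _
  have hne : (Metric.sphere (0 : Coord n) 1).Nonempty :=
    ⟨‖u‖⁻¹ • u, by simp [norm_smul, hu]⟩
  have hv0 : ∀ v ∈ Metric.sphere (0 : Coord n) 1, v ≠ 0 := by
    rintro v hv rfl; simp at hv
  have hcont : ContinuousOn
      (fun v : Coord n => (inner ℝ (N v) (A v) : ℝ) / inner ℝ (A v) (A v))
      (Metric.sphere (0 : Coord n) 1) := by
    refine ContinuousOn.div (by fun_prop) (by fun_prop) fun v hv => ?_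
    exact (inner_self_map_pos hA (hv0 v hv)).ne'
  obtain ⟨v, hv, hmin⟩ := hcomp.exists_isMinOn hne hcont
  refine ⟨_, v, hv0 v hv, (div_mul_cancel₀ _ (inner_self_map_pos hA (hv0 v hv)).ne').symm, ?_⟩
  intro w
  by_cases hw : w = 0
  · simp [hw]
  · have hmem : ‖w‖⁻¹ • w ∈ Metric.sphere (0 : Coord n) 1 := by simp [norm_smul, hw]
    have h1 : (inner ℝ (N v) (A v) : ℝ) / inner ℝ (A v) (A v) ≤
      (inner ℝ (N (‖w‖⁻¹ • w)) (A (‖w‖⁻¹ • w)) : ℝ) / inner ℝ (A (‖w‖⁻¹ • w)) (A (‖w‖⁻¹ • w)) :=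
        hmin hmem
    rw [le_div_iff₀ (inner_self_map_pos hA (hv0 _ hmem))] at h1
    simp only [map_smul, inner_smul_left, inner_smul_right, conj_trivial] at h1
    have hw' : 0 < ‖w‖⁻¹ := by positivity
    have h2 : ‖w‖⁻¹ * (‖w‖⁻¹ * ((inner ℝ (N v) (A v) : ℝ) / inner ℝ (A v) (A v)
        * inner ℝ (A w) (A w))) ≤ ‖w‖⁻¹ * (‖w‖⁻¹ * (inner ℝ (N w) (A w) : ℝ)) := by
      linarith
    exact le_of_mul_le_mul_left (le_of_mul_le_mul_left h2 hw') hw'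

/-- The minimum of the Rayleigh quotient is an eigenvalue: by `null_of_nonneg` the minimizer lies in
the kernel of `h - m g`. This turns the hypothesis on eigenvalues into one on quadratic forms. -/
lemma nonneg_of_eigenvalues {A N : Coord n →L[ℝ] Ambient n} (hA : Injective A)
    (hsymm : ∀ v w, (inner ℝ (N v) (A w) : ℝ) = inner ℝ (N w) (A v))
    (h : ∀ κ, Module.End.HasEigenvalue (Matrix.toLin' (shape A N)) κ → 0 ≤ κ) (u : Coord n) :
    0 ≤ (inner ℝ (N u) (A u) : ℝ) := by
  by_cases hu : u = 0
  · simp [hu]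
  obtain ⟨m, v, hv, h1, h2⟩ := exists_lower_bound hA N hu
  have h3 := null_of_nonneg hsymm h2 h1
  have h4 : (gram N A).mulVec v = m • (gram A A).mulVec v := by
    ext i
    simp only [Pi.smul_apply, smul_eq_mul]
    rw [gram_mulVec, gram_mulVec, hsymm, h3, real_inner_comm]
  have h5 : (shape A N).mulVec v = m • (v : Fin n → ℝ) := by
    have hd : IsUnit (gram A A).det := isUnit_iff_ne_zero.mpr (gram_det_ne_zero hA)
    rw [shape, ← Matrix.mulVec_mulVec, h4, Matrix.mulVec_smul, Matrix.mulVec_mulVec,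
      Matrix.nonsing_inv_mul _ hd, Matrix.one_mulVec]
  have hm : 0 ≤ m := by
    refine h m (Module.End.hasEigenvalue_of_hasEigenvector (x := v.ofLp) ⟨?_, ?_⟩)
    · rw [Module.End.mem_eigenspace_iff, Matrix.toLin'_apply, h5]
    · intro h0
      exact hv (by ext i; exact congrFun h0 i)
  exact le_trans (mul_nonneg hm real_inner_self_nonneg) (h2 u)

end LinearAlgebra

open Filter Topology

/-! ### Calculus of directional derivatives on open sets -/

section DirectionalDerivative

variable {V V₁ V₂ V₃ : Type*} [NormedAddCommGroup V] [NormedSpace ℝ V]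
  [NormedAddCommGroup V₁] [NormedSpace ℝ V₁] [NormedAddCommGroup V₂] [NormedSpace ℝ V₂]
  [NormedAddCommGroup V₃] [NormedSpace ℝ V₃]

/-- The derivative of `u` in the direction `a`. -/
def pd (a : V) (u : V → V₁) (z : V) : V₁ := fderiv ℝ u z a

variable {Ω : Set V} (hΩ : IsOpen Ω)
include hΩ

lemma ContDiffOn.pd {u : V → V₁} (hu : ContDiffOn ℝ ∞ u Ω) (a : V) :
    ContDiffOn ℝ ∞ (pd a u) Ω :=
  (hu.fderiv_of_isOpen hΩ (by simp)).clm_apply contDiffOn_const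

lemma differentiableAt_of_contDiffOn {u : V → V₁} (hu : ContDiffOn ℝ ∞ u Ω) {z : V}
    (hz : z ∈ Ω) : DifferentiableAt ℝ u z :=
  (hu.differentiableOn (by simp)).differentiableAt (hΩ.mem_nhds hz)

lemma pd_congr {u v : V → V₁} (h : EqOn u v Ω) (a : V) : EqOn (pd a u) (pd a v) Ω := by
  intro z hz
  have : u =ᶠ[𝓝 z] v := eventually_of_mem (hΩ.mem_nhds hz) h
  simp only [pd, this.fderiv_eq]

lemma pd_comm {u : V → V₁} (hu : ContDiffOn ℝ ∞ u Ω) (a b : V) :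
    EqOn (pd a (pd b u)) (pd b (pd a u)) Ω := by
  intro z hz
  have hd : DifferentiableAt ℝ (fderiv ℝ u) z :=
    ((hu.fderiv_of_isOpen (m := ∞) hΩ (by simp)).differentiableOn (by simp)).differentiableAt
      (hΩ.mem_nhds hz)
  have h : ∀ a b : V, pd a (pd b u) z = fderiv ℝ (fderiv ℝ u) z a b := by
    intro a b
    have : pd b u = fun z => fderiv ℝ u z b := rfl
    rw [this, pd, fderiv_clm_apply hd (differentiableAt_const _)]
    simp
  rw [h, h]
  exact (((hu.contDiffAt (hΩ.mem_nhds hz)).isSymmSndFDerivAt (by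
    rw [minSmoothness_of_isRCLikeNormedField]; exact WithTop.coe_le_coe.mpr le_top)) a b)

lemma pd_bilin (B : V₁ →L[ℝ] V₂ →L[ℝ] V₃) {u : V → V₁} {v : V → V₂}
    (hu : ContDiffOn ℝ ∞ u Ω) (hv : ContDiffOn ℝ ∞ v Ω) (a : V) :
    EqOn (pd a fun z => B (u z) (v z)) (fun z => B (pd a u z) (v z) + B (u z) (pd a v z)) Ω := by
  intro z hz
  have h := B.fderiv_of_bilinear (differentiableAt_of_contDiffOn hΩ hu hz)
    (differentiableAt_of_contDiffOn hΩ hv hz)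
  simp only [pd, h]
  simp [add_comm]

omit hΩ in
lemma contDiffOn_bilin (B : V₁ →L[ℝ] V₂ →L[ℝ] V₃) {u : V → V₁} {v : V → V₂}
    (hu : ContDiffOn ℝ ∞ u Ω) (hv : ContDiffOn ℝ ∞ v Ω) :
    ContDiffOn ℝ ∞ (fun z => B (u z) (v z)) Ω :=
  (B.contDiff.comp_contDiffOn hu).clm_apply hv

lemma pd_add {u v : V → V₁} (hu : ContDiffOn ℝ ∞ u Ω) (hv : ContDiffOn ℝ ∞ v Ω) (a : V) :
    EqOn (pd a fun z => u z + v z) (fun z => pd a u z + pd a v z) Ω := by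
  intro z hz
  simp only [pd]
  rw [fderiv_fun_add (differentiableAt_of_contDiffOn hΩ hu hz)
    (differentiableAt_of_contDiffOn hΩ hv hz)]
  rfl

lemma pd_sub {u v : V → V₁} (hu : ContDiffOn ℝ ∞ u Ω) (hv : ContDiffOn ℝ ∞ v Ω) (a : V) :
    EqOn (pd a fun z => u z - v z) (fun z => pd a u z - pd a v z) Ω := by
  intro z hz
  simp only [pd]
  rw [fderiv_fun_sub (differentiableAt_of_contDiffOn hΩ hu hz)
    (differentiableAt_of_contDiffOn hΩ hv hz)]
  rfl

lemma pd_pd_sub {u v : V → V₁} (hu : ContDiffOn ℝ ∞ u Ω) (hv : ContDiffOn ℝ ∞ v Ω) (a b : V) :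
    EqOn (pd b (pd a fun z => u z - v z)) (fun z => pd b (pd a u) z - pd b (pd a v) z) Ω :=
  (pd_congr hΩ (pd_sub hΩ hu hv a) b).trans
    (pd_sub hΩ (ContDiffOn.pd hΩ hu a) (ContDiffOn.pd hΩ hv a) b)

lemma pd_sum {ι : Type*} {s : Finset ι} {u : ι → V → V₁} (hu : ∀ i, ContDiffOn ℝ ∞ (u i) Ω)
    (a : V) : EqOn (pd a fun z => ∑ i ∈ s, u i z) (fun z => ∑ i ∈ s, pd a (u i) z) Ω := by
  intro z hz
  simp only [pd]
  rw [fderiv_fun_sum fun i _ => differentiableAt_of_contDiffOn hΩ (hu i) hz]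
  simp

lemma pd_pd_sum {ι : Type*} {s : Finset ι} {u : ι → V → V₁}
    (hu : ∀ i, ContDiffOn ℝ ∞ (u i) Ω) (a b : V) :
    EqOn (pd b (pd a fun z => ∑ i ∈ s, u i z)) (fun z => ∑ i ∈ s, pd b (pd a (u i)) z) Ω :=
  (pd_congr hΩ (pd_sum hΩ hu a) b).trans (pd_sum hΩ (fun i => ContDiffOn.pd hΩ (hu i) a) b)

omit hΩ in
lemma pd_neg (u : V → V₁) (a : V) : (pd a fun z => -u z) = fun z => -pd a u z := by
  ext z
  simp only [pd]
  rw [fderiv_fun_neg]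
  rfl

omit hΩ in
lemma pd_const (c : V₁) (a : V) : (pd a fun _ : V => c) = fun _ => 0 := by
  ext z
  simp [pd]

lemma pd_pd_bilin (B : V₁ →L[ℝ] V₂ →L[ℝ] V₃) {u : V → V₁} {v : V → V₂}
    (hu : ContDiffOn ℝ ∞ u Ω) (hv : ContDiffOn ℝ ∞ v Ω) (a b : V) :
    EqOn (pd b (pd a fun z => B (u z) (v z)))
      (fun z => (B (pd b (pd a u) z) (v z) + B (pd a u z) (pd b v z))
        + (B (pd b u z) (pd a v z) + B (u z) (pd b (pd a v) z))) Ω := by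
  intro z hz
  have hu' := ContDiffOn.pd hΩ hu a
  have hv' := ContDiffOn.pd hΩ hv a
  rw [pd_congr hΩ (pd_bilin hΩ B hu hv a) b hz,
    pd_add hΩ (contDiffOn_bilin B hu' hv) (contDiffOn_bilin B hu hv') b hz]
  simp only
  rw [pd_bilin hΩ B hu' hv b hz, pd_bilin hΩ B hu hv' b hz]

lemma pd_mul {u v : V → ℝ} (hu : ContDiffOn ℝ ∞ u Ω) (hv : ContDiffOn ℝ ∞ v Ω) (a : V) :
    EqOn (pd a fun z => u z * v z) (fun z => pd a u z * v z + u z * pd a v z) Ω :=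
  pd_bilin hΩ (ContinuousLinearMap.mul ℝ ℝ) hu hv a

lemma pd_pd_mul {u v : V → ℝ} (hu : ContDiffOn ℝ ∞ u Ω) (hv : ContDiffOn ℝ ∞ v Ω) (a b : V) :
    EqOn (pd b (pd a fun z => u z * v z))
      (fun z => (pd b (pd a u) z * v z + pd a u z * pd b v z)
        + (pd b u z * pd a v z + u z * pd b (pd a v) z)) Ω :=
  pd_pd_bilin hΩ (ContinuousLinearMap.mul ℝ ℝ) hu hv a b

lemma pd_smul {u : V → ℝ} {v : V → V₁} (hu : ContDiffOn ℝ ∞ u Ω) (hv : ContDiffOn ℝ ∞ v Ω)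
    (a : V) : EqOn (pd a fun z => u z • v z) (fun z => pd a u z • v z + u z • pd a v z) Ω :=
  pd_bilin hΩ (ContinuousLinearMap.lsmul ℝ ℝ) hu hv a

lemma pd_pd_smul {u : V → ℝ} {v : V → V₁} (hu : ContDiffOn ℝ ∞ u Ω)
    (hv : ContDiffOn ℝ ∞ v Ω) (a b : V) :
    EqOn (pd b (pd a fun z => u z • v z))
      (fun z => (pd b (pd a u) z • v z + pd a u z • pd b v z)
        + (pd b u z • pd a v z + u z • pd b (pd a v) z)) Ω :=
  pd_pd_bilin hΩ (ContinuousLinearMap.lsmul ℝ ℝ) hu hv a b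

lemma pd_comp {Φ : ℝ → ℝ} (hΦ : ContDiffOn ℝ ∞ Φ (Ioi 0)) {u : V → ℝ}
    (hu : ContDiffOn ℝ ∞ u Ω) (hpos : ∀ z ∈ Ω, 0 < u z) (a : V) :
    EqOn (pd a fun z => Φ (u z)) (fun z => deriv Φ (u z) * pd a u z) Ω := by
  intro z hz
  have h1 : DifferentiableAt ℝ Φ (u z) :=
    (hΦ.differentiableOn (by simp)).differentiableAt (isOpen_Ioi.mem_nhds (hpos z hz))
  have h2 := differentiableAt_of_contDiffOn hΩ hu hz
  have h3 : HasFDerivAt (fun z => Φ (u z)) (deriv Φ (u z) • fderiv ℝ u z) z :=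
    h1.hasDerivAt.comp_hasFDerivAt z h2.hasFDerivAt
  simp [pd, h3.fderiv]

omit hΩ in
lemma contDiffOn_comp_pos {Φ : ℝ → ℝ} (hΦ : ContDiffOn ℝ ∞ Φ (Ioi 0)) {u : V → ℝ}
    (hu : ContDiffOn ℝ ∞ u Ω) (hpos : ∀ z ∈ Ω, 0 < u z) :
    ContDiffOn ℝ ∞ (fun z => Φ (u z)) Ω :=
  hΦ.comp hu hpos

omit hΩ in
lemma contDiffOn_deriv_pos {Φ : ℝ → ℝ} (hΦ : ContDiffOn ℝ ∞ Φ (Ioi 0)) :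
    ContDiffOn ℝ ∞ (deriv Φ) (Ioi 0) :=
  hΦ.deriv_of_isOpen isOpen_Ioi (by simp)

lemma pd_pd_comp {Φ : ℝ → ℝ} (hΦ : ContDiffOn ℝ ∞ Φ (Ioi 0)) {u : V → ℝ}
    (hu : ContDiffOn ℝ ∞ u Ω) (hpos : ∀ z ∈ Ω, 0 < u z) (a : V) :
    EqOn (pd a (pd a fun z => Φ (u z)))
      (fun z => deriv (deriv Φ) (u z) * pd a u z ^ 2 + deriv Φ (u z) * pd a (pd a u) z) Ω := by
  intro z hz
  have hΦ' := contDiffOn_deriv_pos hΦ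
  rw [pd_congr hΩ (pd_comp hΩ hΦ hu hpos a) a hz,
    pd_mul hΩ (contDiffOn_comp_pos hΦ' hu hpos) (ContDiffOn.pd hΩ hu a) a hz]
  simp only
  rw [pd_comp hΩ hΦ' hu hpos a hz]
  ring

end DirectionalDerivative

section InnerDerivative

variable {V W : Type*} [NormedAddCommGroup V] [NormedSpace ℝ V]
  [NormedAddCommGroup W] [InnerProductSpace ℝ W] {Ω : Set V} (hΩ : IsOpen Ω)
include hΩ

lemma pd_inner {u v : V → W} (hu : ContDiffOn ℝ ∞ u Ω) (hv : ContDiffOn ℝ ∞ v Ω) (a : V) :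
    EqOn (pd a fun z => (inner ℝ (u z) (v z) : ℝ))
      (fun z => inner ℝ (pd a u z) (v z) + inner ℝ (u z) (pd a v z)) Ω :=
  pd_bilin hΩ (innerSL ℝ) hu hv a

lemma pd_pd_inner {u v : V → W} (hu : ContDiffOn ℝ ∞ u Ω) (hv : ContDiffOn ℝ ∞ v Ω) (a b : V) :
    EqOn (pd b (pd a fun z => (inner ℝ (u z) (v z) : ℝ)))
      (fun z => (inner ℝ (pd b (pd a u) z) (v z) + inner ℝ (pd a u z) (pd b v z))
        + (inner ℝ (pd b u z) (pd a v z) + inner ℝ (u z) (pd b (pd a v) z))) Ω :=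
  pd_pd_bilin hΩ (innerSL ℝ) hu hv a b

end InnerDerivative

/-! ### First and second order conditions at a minimum -/

section Extrema

/-- A negative second derivative would make the point a local maximum too; the function would be
locally constant, with second derivative zero. -/
lemma deriv_deriv_nonneg_of_isLocalMin {f : ℝ → ℝ} {x : ℝ} (hmin : IsLocalMin f x)
    (hc : ContinuousAt f x) : 0 ≤ deriv (deriv f) x := by
  by_contra! hneg
  have hmax := isLocalMax_of_deriv_deriv_neg hneg hmin.deriv_eq_zero hc
  have heq : f =ᶠ[𝓝 x] fun _ => f x := by
    filter_upwards [hmin, hmax] with y h1 h2 using le_antisymm h2 h1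
  have h1 : deriv f =ᶠ[𝓝 x] fun _ => 0 := by
    filter_upwards [heq.deriv] with y hy
    simpa using hy
  rw [h1.deriv_eq] at hneg
  simp at hneg

variable {E : Type*} [NormedAddCommGroup E] [NormedSpace ℝ E]

lemma pd_pd_line {u : E → ℝ} {Ω : Set E} (hΩ : IsOpen Ω) (hu : ContDiffOn ℝ ∞ u Ω)
    {z : E} (hz : z ∈ Ω) (a : E) :
    deriv (deriv fun s : ℝ => u (z + s • a)) 0 = pd a (pd a u) z := by
  have hline : ∀ s : ℝ, HasDerivAt (fun s : ℝ => z + s • a) a s := fun s => by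
    simpa using ((hasDerivAt_id s).smul_const a).const_add z
  have hcomp : ∀ {w : E → ℝ} (_ : ContDiffOn ℝ ∞ w Ω) (s : ℝ), z + s • a ∈ Ω →
      deriv (fun s : ℝ => w (z + s • a)) s = pd a w (z + s • a) := by
    intro w hw s hs
    exact ((differentiableAt_of_contDiffOn hΩ hw hs).hasFDerivAt.comp_hasDerivAt s
      (hline s)).deriv
  have hev : ∀ᶠ s : ℝ in 𝓝 0, z + s • a ∈ Ω := by
    have : ContinuousAt (fun s : ℝ => z + s • a) 0 := (hline 0).continuousAt
    exact this.eventually_mem (by simpa using hΩ.mem_nhds hz)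
  have h1 : (deriv fun s : ℝ => u (z + s • a)) =ᶠ[𝓝 0] fun s => pd a u (z + s • a) := by
    filter_upwards [hev] with s hs using hcomp hu s hs
  rw [h1.deriv_eq, hcomp (ContDiffOn.pd hΩ hu a) 0 (by simpa using hz)]
  simp

lemma hasDerivAt_line {u : E → ℝ} {z : E} (hu : DifferentiableAt ℝ u z) (a : E) :
    HasDerivAt (fun s : ℝ => u (z + s • a)) (pd a u z) 0 := by
  have hline : HasDerivAt (fun s : ℝ => z + s • a) a 0 := by
    simpa using ((hasDerivAt_id (0 : ℝ)).smul_const a).const_add z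
  have h : HasFDerivAt u (fderiv ℝ u z) (z + (0 : ℝ) • a) := by simpa using hu.hasFDerivAt
  exact h.comp_hasDerivAt (0 : ℝ) hline

lemma pd_pd_nonneg_of_isLocalMin {u : E → ℝ} {Ω : Set E} (hΩ : IsOpen Ω)
    (hu : ContDiffOn ℝ ∞ u Ω) {z : E} (hz : z ∈ Ω) (a : E)
    (hmin : IsLocalMin (fun s : ℝ => u (z + s • a)) 0) :
    pd a u z = 0 ∧ 0 ≤ pd a (pd a u) z := by
  have hd := hasDerivAt_line (differentiableAt_of_contDiffOn hΩ hu hz) a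
  refine ⟨hmin.hasDerivAt_eq_zero hd, ?_⟩
  rw [← pd_pd_line hΩ hu hz a]
  exact deriv_deriv_nonneg_of_isLocalMin hmin hd.continuousAt

lemma pd_spatial_of_min {u : ℝ × E → ℝ} {Ω : Set (ℝ × E)} (hΩ : IsOpen Ω)
    (hu : ContDiffOn ℝ ∞ u Ω) {z : ℝ × E} (hz : z ∈ Ω)
    (hmin : ∀ᶠ w in 𝓝 z, w.1 ≤ z.1 → u z ≤ u w) (a : E) :
    pd (0, a) u z = 0 ∧ 0 ≤ pd (0, a) (pd (0, a) u) z := by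
  refine pd_pd_nonneg_of_isLocalMin hΩ hu hz _ ?_
  have hc : ContinuousAt (fun s : ℝ => z + s • ((0, a) : ℝ × E)) 0 := by fun_prop
  have h := hc.eventually (by simpa using hmin)
  filter_upwards [h] with s hs
  simpa using hs (by simp)

/-- Only earlier times are compared, so just the slopes from the left are available; this yields an
inequality rather than a vanishing derivative. -/
lemma pd_time_of_min {u : ℝ × E → ℝ} {Ω : Set (ℝ × E)} (hΩ : IsOpen Ω)
    (hu : ContDiffOn ℝ ∞ u Ω) {z : ℝ × E} (hz : z ∈ Ω)
    (hmin : ∀ᶠ w in 𝓝 z, w.1 ≤ z.1 → u z ≤ u w) : pd (1, 0) u z ≤ 0 := by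
  have hd := hasDerivAt_line (differentiableAt_of_contDiffOn hΩ hu hz) ((1, 0) : ℝ × E)
  have hc : ContinuousAt (fun s : ℝ => z + s • ((1, 0) : ℝ × E)) 0 := by fun_prop
  have h := hc.eventually (by simpa using hmin)
  have hs := (hasDerivAt_iff_tendsto_slope.mp hd).mono_left
    (nhdsWithin_mono 0 (show Iio (0 : ℝ) ⊆ {0}ᶜ from fun x hx => ne_of_lt hx))
  refine le_of_tendsto hs ?_
  filter_upwards [h.filter_mono nhdsWithin_le_nhds, self_mem_nhdsWithin] with s h1 (h2 : s < 0)
  have h3 : u z ≤ u (z + s • ((1, 0) : ℝ × E)) := h1 (by simp [h2.le])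
  simp only [slope_def_field, zero_smul, add_zero, sub_zero]
  exact div_nonpos_of_nonneg_of_nonpos (by linarith) h2.le

end Extrema

/-! ### Smooth dependence of the shape operator -/

section MatrixSmoothness

variable {V : Type*} [NormedAddCommGroup V] [NormedSpace ℝ V] {n : ℕ} {m : WithTop ℕ∞}

lemma contDiffOn_det {A : V → Matrix (Fin n) (Fin n) ℝ} {S : Set V}
    (hA : ∀ i j, ContDiffOn ℝ m (fun z => A z i j) S) :
    ContDiffOn ℝ m (fun z => (A z).det) S := by
  simp only [Matrix.det_apply]
  exact ContDiffOn.sum fun σ _ => (contDiffOn_prod fun i _ => hA _ _).const_smul _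

lemma contDiffOn_inv {A : V → Matrix (Fin n) (Fin n) ℝ} {S : Set V}
    (hA : ∀ i j, ContDiffOn ℝ m (fun z => A z i j) S) (hdet : ∀ z ∈ S, (A z).det ≠ 0)
    (i j : Fin n) : ContDiffOn ℝ m (fun z => (A z)⁻¹ i j) S := by
  have h : ∀ z, (A z)⁻¹ i j = (A z).det⁻¹ * ((A z).updateRow j (Pi.single i 1)).det := by
    intro z
    rw [Matrix.inv_def, Ring.inverse_eq_inv', Matrix.smul_apply, Matrix.adjugate_apply,
      smul_eq_mul]
  simp only [h]
  refine ((contDiffOn_det hA).inv hdet).mul (contDiffOn_det fun k l => ?_)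
  by_cases hk : k = j
  · subst hk
    simp only [Matrix.updateRow_self]
    exact contDiffOn_const
  · simp only [Matrix.updateRow_ne hk]
    exact hA k l

lemma contDiffOn_shape {A N : V → Coord n →L[ℝ] Ambient n} {S : Set V}
    (hA : ContDiffOn ℝ m A S) (hN : ContDiffOn ℝ m N S) (hinj : ∀ z ∈ S, Injective (A z))
    (i j : Fin n) : ContDiffOn ℝ m (fun z => shape (A z) (N z) i j) S := by
  simp only [shape, Matrix.mul_apply]
  have hg : ∀ {B : V → Coord n →L[ℝ] Ambient n}, ContDiffOn ℝ m B S → ∀ i j,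
      ContDiffOn ℝ m (fun z => gram (B z) (A z) i j) S := fun hB i j =>
    (hB.clm_apply contDiffOn_const).inner ℝ (hA.clm_apply contDiffOn_const)
  refine ContDiffOn.sum fun k _ => ?_
  exact (contDiffOn_inv (hg hA) (fun z hz => gram_det_ne_zero (hinj z hz)) i k).mul (hg hN k j)

end MatrixSmoothness

/-! ### The tangent hyperplane as orthogonal complement of the normal -/

section TangentSpace

variable {n : ℕ}

/-- The range of `A` lies in the hyperplane orthogonal to `ν`, and both have dimension `n`. -/
lemma exists_preimage_of_orthogonal {A : Coord n →L[ℝ] Ambient n} (hA : Injective A)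
    {ν : Ambient n} (hν : ‖ν‖ = 1) (horth : ∀ v, (inner ℝ ν (A v) : ℝ) = 0) {x : Ambient n}
    (hx : (inner ℝ ν x : ℝ) = 0) : ∃ v, A v = x := by
  have hle : LinearMap.range (A : Coord n →ₗ[ℝ] Ambient n) ≤ (ℝ ∙ ν)ᗮ := by
    rintro _ ⟨v, rfl⟩
    exact Submodule.mem_orthogonal_singleton_iff_inner_right.mpr (horth v)
  have hν0 : ν ≠ 0 := by rintro rfl; simp at hν
  have h1 : Module.finrank ℝ (ℝ ∙ ν)ᗮ = n := by
    have : Fact (Module.finrank ℝ (Ambient n) = n + 1) := ⟨by simp⟩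
    exact Submodule.finrank_orthogonal_span_singleton hν0
  have h2 : Module.finrank ℝ (LinearMap.range (A : Coord n →ₗ[ℝ] Ambient n)) = n := by
    rw [LinearMap.finrank_range_of_inj hA]; simp
  have heq := Submodule.eq_of_le_of_finrank_eq hle (h2.trans h1.symm)
  have : x ∈ LinearMap.range (A : Coord n →ₗ[ℝ] Ambient n) := by
    rw [heq]; exact Submodule.mem_orthogonal_singleton_iff_inner_right.mpr hx
  obtain ⟨v, hv⟩ := this
  exact ⟨v, hv⟩

lemma eq_smul_of_orthogonal {A : Coord n →L[ℝ] Ambient n} (hA : Injective A)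
    {ν : Ambient n} (hν : ‖ν‖ = 1) (horth : ∀ v, (inner ℝ ν (A v) : ℝ) = 0) {x : Ambient n}
    (hx : ∀ v, (inner ℝ x (A v) : ℝ) = 0) : x = (inner ℝ ν x : ℝ) • ν := by
  have h0 : (inner ℝ ν (x - (inner ℝ ν x : ℝ) • ν) : ℝ) = 0 := by
    rw [inner_sub_right, inner_smul_right, real_inner_self_eq_norm_sq, hν]; ring
  obtain ⟨v, hv⟩ := exists_preimage_of_orthogonal hA hν horth h0
  have h1 : (inner ℝ (x - (inner ℝ ν x : ℝ) • ν) (x - (inner ℝ ν x : ℝ) • ν) : ℝ) = 0 := by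
    nth_rewrite 2 [← hv]
    rw [inner_sub_left, inner_smul_left, horth, hx]; simp
  exact sub_eq_zero.mp (inner_self_eq_zero.mp h1)

end TangentSpace

/-! ### Evolution equations in coordinates -/

section LocalFlow

variable {n : ℕ}

/-- The spatial differential of a map on space-time. -/
def spatial (F : ℝ × Coord n → Ambient n) (z : ℝ × Coord n) : Coord n →L[ℝ] Ambient n :=
  fderiv ℝ (fun y => F (z.1, y)) z.2

/-- The mean curvature of a moving hypersurface `F` with normal `N`. -/
def curv (F N : ℝ × Coord n → Ambient n) (z : ℝ × Coord n) : ℝ :=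
  (shape (spatial F z) (spatial N z)).trace

lemma curv_eq_sum (F N : ℝ × Coord n → Ambient n) :
    curv F N = fun z => ∑ i, shape (spatial F z) (spatial N z) i i := by
  ext z; simp [curv, Matrix.trace]

lemma inner_basisVec (v : Coord n) (k : Fin n) : (inner ℝ v (basisVec k) : ℝ) = v k := by
  simp [basisVec, EuclideanSpace.inner_single_right]

lemma hasFDerivAt_spatial {F : ℝ × Coord n → Ambient n} {z : ℝ × Coord n}
    (h : DifferentiableAt ℝ F z) :
    HasFDerivAt (fun y => F (z.1, y)) (fderiv ℝ F z ∘L ContinuousLinearMap.inr ℝ ℝ (Coord n))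
      z.2 := by
  have h1 : HasFDerivAt (fun y : Coord n => (z.1, y))
      (ContinuousLinearMap.inr ℝ ℝ (Coord n)) z.2 := hasFDerivAt_prodMk_right _ _
  exact HasFDerivAt.comp z.2 (f := fun y : Coord n => (z.1, y)) h.hasFDerivAt h1

lemma spatial_apply {F : ℝ × Coord n → Ambient n} {z : ℝ × Coord n}
    (h : DifferentiableAt ℝ F z) (a : Coord n) : spatial F z a = pd (0, a) F z := by
  rw [spatial, (hasFDerivAt_spatial h).fderiv]
  simp [pd]

/-- A smooth solution of `∂F/∂t = -Φ(H) N` with positive mean curvature, parametrized over an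
open subset of space-time. -/
structure LocalFlow (Φ : ℝ → ℝ) (Ω : Set (ℝ × Coord n)) (F N : ℝ × Coord n → Ambient n) :
    Prop where
  isOpen : IsOpen Ω
  smooth : ContDiffOn ℝ ∞ F Ω
  smooth_normal : ContDiffOn ℝ ∞ N Ω
  immersion : ∀ z ∈ Ω, Injective (spatial F z)
  norm_normal : ∀ z ∈ Ω, ‖N z‖ = 1
  orthogonal : ∀ z ∈ Ω, ∀ a, (inner ℝ (N z) (spatial F z a) : ℝ) = 0
  curv_pos : ∀ z ∈ Ω, 0 < curv F N z
  evolution : ∀ z ∈ Ω, pd (1, 0) F z = -(Φ (curv F N z)) • N z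

namespace LocalFlow

variable {Φ : ℝ → ℝ} {Ω : Set (ℝ × Coord n)} {F N : ℝ × Coord n → Ambient n}
  (hf : LocalFlow Φ Ω F N)
include hf

lemma spatial_eq {z : ℝ × Coord n} (hz : z ∈ Ω) (a : Coord n) :
    spatial F z a = pd (0, a) F z :=
  spatial_apply (differentiableAt_of_contDiffOn hf.isOpen hf.smooth hz) a

lemma spatial_normal_eq {z : ℝ × Coord n} (hz : z ∈ Ω) (a : Coord n) :
    spatial N z a = pd (0, a) N z :=
  spatial_apply (differentiableAt_of_contDiffOn hf.isOpen hf.smooth_normal hz) a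

lemma contDiffOn_spatial {G : ℝ × Coord n → Ambient n} (hG : ContDiffOn ℝ ∞ G Ω) :
    ContDiffOn ℝ ∞ (spatial G) Ω := by
  have h : ContDiffOn ℝ ∞ (fun z => (fderiv ℝ G z).comp (ContinuousLinearMap.inr ℝ ℝ (Coord n)))
      Ω := (hG.fderiv_of_isOpen hf.isOpen (by simp)).clm_comp contDiffOn_const
  refine h.congr fun z hz => ?_
  exact (hasFDerivAt_spatial (differentiableAt_of_contDiffOn hf.isOpen hG hz)).fderiv

lemma contDiffOn_shape (i j : Fin n) :
    ContDiffOn ℝ ∞ (fun z => shape (spatial F z) (spatial N z) i j) Ω :=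
  PhiFlow.contDiffOn_shape (hf.contDiffOn_spatial hf.smooth)
    (hf.contDiffOn_spatial hf.smooth_normal) hf.immersion i j

lemma contDiffOn_curv : ContDiffOn ℝ ∞ (curv F N) Ω := by
  rw [curv_eq_sum]
  exact ContDiffOn.sum fun i _ => hf.contDiffOn_shape i i

lemma contDiffOn_pd (a : ℝ × Coord n) : ContDiffOn ℝ ∞ (pd a F) Ω :=
  ContDiffOn.pd hf.isOpen hf.smooth a

lemma contDiffOn_pd_normal (a : ℝ × Coord n) : ContDiffOn ℝ ∞ (pd a N) Ω :=
  ContDiffOn.pd hf.isOpen hf.smooth_normal a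

lemma inner_normal_pd {z : ℝ × Coord n} (hz : z ∈ Ω) (a : Coord n) :
    (inner ℝ (N z) (pd (0, a) F z) : ℝ) = 0 := by
  rw [← hf.spatial_eq hz]; exact hf.orthogonal z hz a

lemma inner_normal_self {z : ℝ × Coord n} (hz : z ∈ Ω) : (inner ℝ (N z) (N z) : ℝ) = 1 := by
  rw [real_inner_self_eq_norm_sq, hf.norm_normal z hz]; norm_num

lemma inner_pd_normal {z : ℝ × Coord n} (hz : z ∈ Ω) (a : ℝ × Coord n) :
    (inner ℝ (N z) (pd a N z) : ℝ) = 0 := by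
  have h : EqOn (fun z => (inner ℝ (N z) (N z) : ℝ)) (fun _ => 1) Ω :=
    fun w hw => hf.inner_normal_self hw
  have h1 := pd_congr hf.isOpen h a hz
  rw [pd_inner hf.isOpen hf.smooth_normal hf.smooth_normal a hz, pd_const] at h1
  simp only at h1
  rw [real_inner_comm] at h1
  linarith

lemma inner_pd_pd_normal {z : ℝ × Coord n} (hz : z ∈ Ω) (a b : ℝ × Coord n) :
    (inner ℝ (N z) (pd a (pd b N) z) : ℝ) = - inner ℝ (pd a N z) (pd b N z) := by
  have h : EqOn (fun z => (inner ℝ (N z) (pd b N z) : ℝ)) (fun _ => 0) Ω :=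
    fun w hw => hf.inner_pd_normal hw b
  have h1 := pd_congr hf.isOpen h a hz
  rw [pd_inner hf.isOpen hf.smooth_normal (hf.contDiffOn_pd_normal b) a hz, pd_const] at h1
  simp only at h1
  linarith

/-- Differentiating `⟨N, ∂_b F⟩ = 0` moves the derivative from the normal to the immersion, where
partial derivatives commute. -/
lemma second_form_eq (a : ℝ × Coord n) (b : Coord n) :
    EqOn (fun z => (inner ℝ (pd a N z) (pd (0, b) F z) : ℝ))
      (fun z => -inner ℝ (N z) (pd a (pd (0, b) F) z)) Ω := by
  intro z hz
  have h : EqOn (fun z => (inner ℝ (N z) (pd (0, b) F z) : ℝ)) (fun _ => 0) Ω :=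
    fun w hw => hf.inner_normal_pd hw b
  have h1 := pd_congr hf.isOpen h a hz
  rw [pd_inner hf.isOpen hf.smooth_normal (hf.contDiffOn_pd _) a hz, pd_const] at h1
  simp only at h1 ⊢
  linarith

lemma second_form_symm {z : ℝ × Coord n} (hz : z ∈ Ω) (a b : Coord n) :
    (inner ℝ (pd (0, a) N z) (pd (0, b) F z) : ℝ) = inner ℝ (pd (0, b) N z) (pd (0, a) F z) := by
  have h1 := hf.second_form_eq (0, a) b hz
  have h2 := hf.second_form_eq (0, b) a hz
  simp only at h1 h2
  rw [h1, h2, pd_comm hf.isOpen hf.smooth _ _ hz]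

lemma evolution_eqOn : EqOn (pd (1, 0) F) (fun z => -(Φ (curv F N z) • N z)) Ω := by
  intro z hz
  rw [hf.evolution z hz]
  simp

/-- Evolution of the metric. -/
lemma pd_time_metric (hΦ : ContDiffOn ℝ ∞ Φ (Ioi 0)) {z : ℝ × Coord n} (hz : z ∈ Ω)
    (a b : Coord n) :
    pd (1, 0) (fun z => (inner ℝ (pd (0, a) F z) (pd (0, b) F z) : ℝ)) z
      = -2 * Φ (curv F N z) * inner ℝ (pd (0, a) N z) (pd (0, b) F z) := by
  have hP := contDiffOn_comp_pos hΦ hf.contDiffOn_curv hf.curv_pos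
  -- Of the two terms in `∂ₐ(Φ N)`, the one along `N` disappears when paired with a tangent vector.
  have h : ∀ a, pd (1, 0) (pd (0, a) F) z
      = -(pd (0, a) (fun z => Φ (curv F N z)) z • N z + Φ (curv F N z) • pd (0, a) N z) := by
    intro a
    rw [pd_comm hf.isOpen hf.smooth _ _ hz, pd_congr hf.isOpen hf.evolution_eqOn _ hz, pd_neg]
    simp only
    rw [pd_smul hf.isOpen hP hf.smooth_normal _ hz]
  rw [pd_inner hf.isOpen (hf.contDiffOn_pd _) (hf.contDiffOn_pd _) _ hz]
  simp only [h, inner_neg_left, inner_neg_right, inner_add_left, inner_add_right,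
    inner_smul_left, inner_smul_right, conj_trivial]
  rw [hf.inner_normal_pd hz b, real_inner_comm (N z) (pd (0, a) F z), hf.inner_normal_pd hz a,
    real_inner_comm (pd (0, b) N z) (pd (0, a) F z), hf.second_form_symm hz b a]
  ring

end LocalFlow

/-- At `z` the coordinates are orthonormal and the Christoffel symbols vanish. -/
structure NormalAt (F : ℝ × Coord n → Ambient n) (z : ℝ × Coord n) : Prop where
  orthonormal : ∀ a b : Coord n, (inner ℝ (pd (0, a) F z) (pd (0, b) F z) : ℝ) = inner ℝ a b
  normal : ∀ a b c : Coord n,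
    (inner ℝ (pd (0, a) (pd (0, b) F) z) (pd (0, c) F z) : ℝ) = 0

namespace LocalFlow

variable {Φ : ℝ → ℝ} {Ω : Set (ℝ × Coord n)} {F N : ℝ × Coord n → Ambient n}
  (hf : LocalFlow Φ Ω F N) {z : ℝ × Coord n} (hz : z ∈ Ω) (hn : NormalAt F z)
include hf hz hn

lemma tangent_expand {x : Ambient n} (hx : (inner ℝ (N z) x : ℝ) = 0) :
    x = ∑ k, (inner ℝ x (pd (0, basisVec k) F z) : ℝ) • pd (0, basisVec k) F z := by
  obtain ⟨v, rfl⟩ := exists_preimage_of_orthogonal (hf.immersion z hz) (hf.norm_normal z hz)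
    (hf.orthogonal z hz) hx
  conv_lhs => rw [map_sum_basisVec]
  refine Finset.sum_congr rfl fun k _ => ?_
  rw [hf.spatial_eq hz, hf.spatial_eq hz, hn.orthonormal, inner_basisVec]

lemma pd_normal_expand (a : Coord n) :
    pd (0, a) N z = ∑ k, (inner ℝ (pd (0, a) N z) (pd (0, basisVec k) F z) : ℝ) •
      pd (0, basisVec k) F z :=
  hf.tangent_expand hz hn (hf.inner_pd_normal hz _)

/-- The Gauss formula at a point where the Christoffel symbols vanish. -/
lemma second_deriv_eq (a b : Coord n) :
    pd (0, a) (pd (0, b) F) z = -(inner ℝ (pd (0, a) N z) (pd (0, b) F z) : ℝ) • N z := by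
  have h := eq_smul_of_orthogonal (hf.immersion z hz) (hf.norm_normal z hz)
    (hf.orthogonal z hz) (x := pd (0, a) (pd (0, b) F) z)
    (fun v => by rw [hf.spatial_eq hz]; exact hn.normal a b v)
  have h2 := hf.second_form_eq (0, a) b hz
  simp only at h2
  rw [h2, neg_neg]
  exact h

/-- Evolution of the second fundamental form in normal coordinates. -/
lemma pd_time_second_form (hΦ : ContDiffOn ℝ ∞ Φ (Ioi 0)) (a : Coord n) :
    pd (1, 0) (fun z => (inner ℝ (pd (0, a) N z) (pd (0, a) F z) : ℝ)) z
      = pd (0, a) (pd (0, a) fun z => Φ (curv F N z)) z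
        - Φ (curv F N z) * inner ℝ (pd (0, a) N z) (pd (0, a) N z) := by
  have hP := contDiffOn_comp_pos hΦ hf.contDiffOn_curv hf.curv_pos
  have h3 : pd (1, 0) (pd (0, a) (pd (0, a) F)) z
      = pd (0, a) (pd (0, a) (pd (1, 0) F)) z := by
    rw [pd_comm hf.isOpen (hf.contDiffOn_pd _) _ _ hz,
      pd_congr hf.isOpen (pd_comm hf.isOpen hf.smooth (1, 0) (0, a)) (0, a) hz]
  have h4 : pd (0, a) (pd (0, a) (pd (1, 0) F)) z
      = -pd (0, a) (pd (0, a) fun z => Φ (curv F N z) • N z) z := by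
    rw [pd_congr hf.isOpen (pd_congr hf.isOpen hf.evolution_eqOn _) _ hz, pd_neg, pd_neg]
  rw [pd_congr hf.isOpen (hf.second_form_eq (0, a) a) _ hz, pd_neg]
  simp only
  rw [pd_inner hf.isOpen hf.smooth_normal
    (ContDiffOn.pd hf.isOpen (hf.contDiffOn_pd _) _) _ hz]
  simp only
  rw [h3, h4, hf.second_deriv_eq hz hn, pd_pd_smul hf.isOpen hP hf.smooth_normal _ _ hz]
  simp only [inner_neg_right, inner_add_right, inner_smul_right]
  rw [real_inner_comm (N z) (pd (1, 0) N z), hf.inner_pd_normal hz, hf.inner_pd_normal hz,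
    hf.inner_normal_self hz, hf.inner_pd_pd_normal hz]
  ring

/-- The fourth derivatives of `F` are left unreduced. They also occur in the second derivatives of
`H`, so that the two expressions can be compared without covariant derivatives or curvature tensors.
-/
lemma pd_pd_second_form (a b : Coord n) :
    pd (0, b) (pd (0, b) fun z => (inner ℝ (pd (0, a) N z) (pd (0, a) F z) : ℝ)) z
      = -(inner ℝ (pd (0, a) N z) (pd (0, a) F z) * inner ℝ (pd (0, b) N z) (pd (0, b) N z))
        - 2 * inner ℝ (pd (0, b) N z) (pd (0, b) (pd (0, a) (pd (0, a) F)) z)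
        - inner ℝ (N z) (pd (0, b) (pd (0, b) (pd (0, a) (pd (0, a) F))) z) := by
  have h1 := hf.inner_pd_pd_normal hz (0, b) (0, b)
  rw [pd_congr hf.isOpen (pd_congr hf.isOpen (hf.second_form_eq (0, a) a) _) _ hz, pd_neg,
    pd_neg]
  simp only
  rw [pd_pd_inner hf.isOpen hf.smooth_normal
    (ContDiffOn.pd hf.isOpen (hf.contDiffOn_pd _) _) _ _ hz]
  simp only
  rw [hf.second_deriv_eq hz hn, inner_smul_right, real_inner_comm (N z), h1]
  ring

lemma pd_metric (a b c : Coord n) :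
    pd (0, b) (fun z => (inner ℝ (pd (0, a) F z) (pd (0, c) F z) : ℝ)) z = 0 := by
  rw [pd_inner hf.isOpen (hf.contDiffOn_pd _) (hf.contDiffOn_pd _) _ hz]
  simp only
  rw [hn.normal, real_inner_comm, hn.normal, add_zero]

lemma pd_pd_metric (a b c : Coord n) :
    pd (0, b) (pd (0, b) fun z => (inner ℝ (pd (0, a) F z) (pd (0, c) F z) : ℝ)) z
      = inner ℝ (pd (0, b) (pd (0, b) (pd (0, a) F)) z) (pd (0, c) F z)
        + 2 * (inner ℝ (pd (0, b) N z) (pd (0, a) F z) * inner ℝ (pd (0, b) N z) (pd (0, c) F z))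
        + inner ℝ (pd (0, a) F z) (pd (0, b) (pd (0, b) (pd (0, c) F)) z) := by
  rw [pd_pd_inner hf.isOpen (hf.contDiffOn_pd _) (hf.contDiffOn_pd _) _ _ hz]
  simp only
  rw [hf.second_deriv_eq hz hn, hf.second_deriv_eq hz hn, inner_smul_left, inner_smul_right,
    hf.inner_normal_self hz]
  simp only [conj_trivial]
  ring

omit hf hz hn in
lemma gram_spatial (G G' : ℝ × Coord n → Ambient n) (hG : DifferentiableAt ℝ G z)
    (hG' : DifferentiableAt ℝ G' z) (i j : Fin n) :
    gram (spatial G z) (spatial G' z) i j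
      = inner ℝ (pd (0, basisVec i) G z) (pd (0, basisVec j) G' z) := by
  simp only [gram, Matrix.of_apply]
  rw [spatial_apply hG, spatial_apply hG']

omit hz hn in
-- Evolution and second derivatives of `W` are found by differentiating `h = g W` rather than `W =
-- g⁻¹ h`; no derivative of an inverse matrix is then needed.
lemma second_form_eq_sum (i j : Fin n) :
    EqOn (fun z => (inner ℝ (pd (0, basisVec i) N z) (pd (0, basisVec j) F z) : ℝ))
      (fun z => ∑ k, inner ℝ (pd (0, basisVec i) F z) (pd (0, basisVec k) F z)
        * shape (spatial F z) (spatial N z) k j) Ω := by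
  intro w hw
  have h := congrFun (congrFun (gram_mul_shape (hf.immersion w hw) (spatial N w)) i) j
  have h1 := differentiableAt_of_contDiffOn hf.isOpen hf.smooth hw
  have h2 := differentiableAt_of_contDiffOn hf.isOpen hf.smooth_normal hw
  simp only [Matrix.mul_apply, gram_spatial F F h1 h1, gram_spatial N F h2 h1] at h
  exact h.symm

omit hf hz in
lemma inner_basis_pd (i k : Fin n) :
    (inner ℝ (pd (0, basisVec i) F z) (pd (0, basisVec k) F z) : ℝ) = if i = k then 1 else 0 := by
  rw [hn.orthonormal, inner_basisVec]
  simp [basisVec, eq_comm]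

lemma shape_eq (i j : Fin n) : shape (spatial F z) (spatial N z) i j
    = inner ℝ (pd (0, basisVec i) N z) (pd (0, basisVec j) F z) := by
  have h := hf.second_form_eq_sum i j hz
  simp only [inner_basis_pd hn] at h
  simpa using h.symm

lemma curv_eq : curv F N z
    = ∑ i, inner ℝ (pd (0, basisVec i) N z) (pd (0, basisVec i) F z) := by
  rw [curv_eq_sum]
  exact Finset.sum_congr rfl fun i _ => hf.shape_eq hz hn i i

lemma inner_pd_normal_pd_normal (a b : Coord n) :
    (inner ℝ (pd (0, a) N z) (pd (0, b) N z) : ℝ)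
      = ∑ k, inner ℝ (pd (0, a) N z) (pd (0, basisVec k) F z)
        * inner ℝ (pd (0, b) N z) (pd (0, basisVec k) F z) := by
  conv_lhs => rw [hf.pd_normal_expand hz hn b]
  rw [inner_sum]
  refine Finset.sum_congr rfl fun k _ => ?_
  rw [inner_smul_right]; ring

lemma trace_shape_sq :
    (shape (spatial F z) (spatial N z) * shape (spatial F z) (spatial N z)).trace
      = ∑ i, inner ℝ (pd (0, basisVec i) N z) (pd (0, basisVec i) N z) := by
  simp only [Matrix.trace, Matrix.diag_apply, Matrix.mul_apply, hf.shape_eq hz hn]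
  refine Finset.sum_congr rfl fun i _ => ?_
  rw [hf.inner_pd_normal_pd_normal hz hn]
  refine Finset.sum_congr rfl fun k _ => ?_
  rw [hf.second_form_symm hz (basisVec k)]

/-- Second derivative of the mean curvature in normal coordinates. -/
lemma pd_pd_curv (v : Coord n) :
    pd (0, v) (pd (0, v) (curv F N)) z
      = -(curv F N z * inner ℝ (pd (0, v) N z) (pd (0, v) N z))
        - 2 * ∑ i, inner ℝ (pd (0, v) N z)
            (pd (0, basisVec i) (pd (0, basisVec i) (pd (0, v) F)) z)
        - ∑ i, inner ℝ (N z) (pd (0, v) (pd (0, v)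
            (pd (0, basisVec i) (pd (0, basisVec i) F))) z)
        - 2 * ∑ i, inner ℝ (pd (0, basisVec i) N z)
            (pd (0, v) (pd (0, v) (pd (0, basisVec i) F)) z)
        - 2 * ∑ i, inner ℝ (pd (0, v) N z) (pd (0, basisVec i) F z)
            * inner ℝ (pd (0, basisVec i) N z) (pd (0, v) N z) := by
  have hg : ∀ i k, ContDiffOn ℝ ∞ (fun z => (inner ℝ (pd (0, basisVec i) F z)
      (pd (0, basisVec k) F z) : ℝ)) Ω := fun i k =>
    (hf.contDiffOn_pd _).inner ℝ (hf.contDiffOn_pd _)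
  have hW : ∀ i : Fin n,
      pd (0, v) (pd (0, v) fun z => shape (spatial F z) (spatial N z) i i) z
      = -(inner ℝ (pd (0, basisVec i) N z) (pd (0, basisVec i) F z)
          * inner ℝ (pd (0, v) N z) (pd (0, v) N z))
        - 2 * inner ℝ (pd (0, v) N z) (pd (0, basisVec i) (pd (0, basisVec i) (pd (0, v) F)) z)
        - inner ℝ (N z) (pd (0, v) (pd (0, v) (pd (0, basisVec i) (pd (0, basisVec i) F))) z)
        - (inner ℝ (pd (0, basisVec i) N z) (pd (0, v) (pd (0, v) (pd (0, basisVec i) F)) z)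
          + 2 * (inner ℝ (pd (0, v) N z) (pd (0, basisVec i) F z)
            * inner ℝ (pd (0, basisVec i) N z) (pd (0, v) N z))
          + ∑ k, inner ℝ (pd (0, basisVec i) F z)
              (pd (0, v) (pd (0, v) (pd (0, basisVec k) F)) z)
            * inner ℝ (pd (0, basisVec k) N z) (pd (0, basisVec i) F z)) := by
    intro i
    have h1 := hf.pd_pd_second_form hz hn (basisVec i) v
    have hc : pd (0, v) (pd (0, basisVec i) (pd (0, basisVec i) F)) z
        = pd (0, basisVec i) (pd (0, basisVec i) (pd (0, v) F)) z := by
      rw [pd_comm hf.isOpen (hf.contDiffOn_pd _) _ _ hz,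
        pd_congr hf.isOpen (pd_comm hf.isOpen hf.smooth (0, v) (0, basisVec i)) _ hz]
    rw [hc, pd_congr hf.isOpen (pd_congr hf.isOpen (hf.second_form_eq_sum i i) _) _ hz,
      pd_pd_sum hf.isOpen (fun k => (hg i k).mul (hf.contDiffOn_shape k i)) _ _ hz] at h1
    have hk : ∀ k, pd (0, v) (pd (0, v) fun z => (inner ℝ (pd (0, basisVec i) F z)
          (pd (0, basisVec k) F z) : ℝ) * shape (spatial F z) (spatial N z) k i) z
        = (inner ℝ (pd (0, v) (pd (0, v) (pd (0, basisVec i) F)) z) (pd (0, basisVec k) F z)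
          + 2 * (inner ℝ (pd (0, v) N z) (pd (0, basisVec i) F z)
            * inner ℝ (pd (0, v) N z) (pd (0, basisVec k) F z))
          + inner ℝ (pd (0, basisVec i) F z) (pd (0, v) (pd (0, v) (pd (0, basisVec k) F)) z))
            * inner ℝ (pd (0, basisVec k) N z) (pd (0, basisVec i) F z)
          + (if i = k then 1 else 0)
            * pd (0, v) (pd (0, v) fun z => shape (spatial F z) (spatial N z) k i) z := by
      intro k
      rw [pd_pd_mul hf.isOpen (hg i k) (hf.contDiffOn_shape k i) _ _ hz]
      simp only
      rw [hf.pd_metric hz hn, hf.pd_pd_metric hz hn, inner_basis_pd hn,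
        hf.shape_eq hz hn]
      ring
    simp only [hk] at h1
    have e1 : (inner ℝ (pd (0, basisVec i) N z)
        (pd (0, v) (pd (0, v) (pd (0, basisVec i) F)) z) : ℝ)
        = ∑ k, inner ℝ (pd (0, v) (pd (0, v) (pd (0, basisVec i) F)) z) (pd (0, basisVec k) F z)
          * inner ℝ (pd (0, basisVec k) N z) (pd (0, basisVec i) F z) := by
      conv_lhs => rw [hf.pd_normal_expand hz hn]
      rw [sum_inner]
      refine Finset.sum_congr rfl fun k _ => ?_
      rw [inner_smul_left, hf.second_form_symm hz (basisVec i) (basisVec k),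
        real_inner_comm (pd (0, v) (pd (0, v) (pd (0, basisVec i) F)) z)]
      simp only [conj_trivial]; ring
    have e2 : (inner ℝ (pd (0, basisVec i) N z) (pd (0, v) N z) : ℝ)
        = ∑ k, inner ℝ (pd (0, v) N z) (pd (0, basisVec k) F z)
          * inner ℝ (pd (0, basisVec k) N z) (pd (0, basisVec i) F z) := by
      rw [real_inner_comm, hf.inner_pd_normal_pd_normal hz hn]
      refine Finset.sum_congr rfl fun k _ => ?_
      rw [hf.second_form_symm hz (basisVec k)]
    have e3 : ∑ k, (if i = k then (1 : ℝ) else 0)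
        * pd (0, v) (pd (0, v) fun z => shape (spatial F z) (spatial N z) k i) z
        = pd (0, v) (pd (0, v) fun z => shape (spatial F z) (spatial N z) i i) z := by
      simp
    rw [Finset.sum_add_distrib, e3] at h1
    simp only [add_mul, Finset.sum_add_distrib] at h1
    rw [← e1] at h1
    have e4 : ∑ k, 2 * ((inner ℝ (pd (0, v) N z) (pd (0, basisVec i) F z) : ℝ)
            * inner ℝ (pd (0, v) N z) (pd (0, basisVec k) F z))
            * inner ℝ (pd (0, basisVec k) N z) (pd (0, basisVec i) F z)
        = 2 * (inner ℝ (pd (0, v) N z) (pd (0, basisVec i) F z)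
            * inner ℝ (pd (0, basisVec i) N z) (pd (0, v) N z)) := by
      rw [e2, Finset.mul_sum, Finset.mul_sum]
      exact Finset.sum_congr rfl fun k _ => by ring
    rw [e4] at h1
    linarith
  have hcurv : pd (0, v) (pd (0, v) (curv F N)) z
      = ∑ i, pd (0, v) (pd (0, v) fun z => shape (spatial F z) (spatial N z) i i) z := by
    rw [curv_eq_sum]
    exact pd_pd_sum hf.isOpen (fun i => hf.contDiffOn_shape i i) _ _ hz
  -- After summation over `i`, the two contributions of third derivatives coming from `∂ᵥ²g` agree,
  -- whence the factor 2 in the result.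
  have e5 : ∑ i, ∑ k, (inner ℝ (pd (0, basisVec i) F z)
        (pd (0, v) (pd (0, v) (pd (0, basisVec k) F)) z) : ℝ)
        * inner ℝ (pd (0, basisVec k) N z) (pd (0, basisVec i) F z)
      = ∑ k, inner ℝ (pd (0, basisVec k) N z)
        (pd (0, v) (pd (0, v) (pd (0, basisVec k) F)) z) := by
    rw [Finset.sum_comm]
    refine Finset.sum_congr rfl fun k _ => ?_
    conv_rhs => rw [hf.pd_normal_expand hz hn]
    rw [sum_inner]
    refine Finset.sum_congr rfl fun i _ => ?_
    rw [inner_smul_left]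
    simp only [conj_trivial]; ring
  rw [hcurv]
  simp only [hW, Finset.sum_sub_distrib, Finset.sum_add_distrib, Finset.sum_neg_distrib]
  rw [e5, hf.curv_eq hz hn]
  simp only [← Finset.mul_sum, ← Finset.sum_mul]
  ring

/-- Evolution of the mean curvature in normal coordinates. -/
lemma pd_time_curv (hΦ : ContDiffOn ℝ ∞ Φ (Ioi 0)) :
    pd (1, 0) (curv F N) z
      = ∑ i, pd (0, basisVec i) (pd (0, basisVec i) fun z => Φ (curv F N z)) z
        + Φ (curv F N z) * ∑ i, inner ℝ (pd (0, basisVec i) N z) (pd (0, basisVec i) N z) := by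
  have hg : ∀ i k, ContDiffOn ℝ ∞ (fun z => (inner ℝ (pd (0, basisVec i) F z)
      (pd (0, basisVec k) F z) : ℝ)) Ω := fun i k =>
    (hf.contDiffOn_pd _).inner ℝ (hf.contDiffOn_pd _)
  have hcurv : pd (1, 0) (curv F N) z
      = ∑ i, pd (1, 0) (fun z => shape (spatial F z) (spatial N z) i i) z := by
    rw [curv_eq_sum]
    exact pd_sum hf.isOpen (fun i => hf.contDiffOn_shape i i) _ hz
  rw [hcurv, Finset.mul_sum, ← Finset.sum_add_distrib]
  refine Finset.sum_congr rfl fun i _ => ?_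
  have h1 := hf.pd_time_second_form hz hn hΦ (basisVec i)
  rw [pd_congr hf.isOpen (hf.second_form_eq_sum i i) _ hz,
    pd_sum hf.isOpen (fun k => (hg i k).mul (hf.contDiffOn_shape k i)) _ hz] at h1
  have hk : ∀ k, pd (1, 0) (fun z => (inner ℝ (pd (0, basisVec i) F z)
        (pd (0, basisVec k) F z) : ℝ) * shape (spatial F z) (spatial N z) k i) z
      = -2 * Φ (curv F N z) * (inner ℝ (pd (0, basisVec i) N z) (pd (0, basisVec k) F z)
          * inner ℝ (pd (0, basisVec i) N z) (pd (0, basisVec k) F z))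
        + (if i = k then 1 else 0)
          * pd (1, 0) (fun z => shape (spatial F z) (spatial N z) k i) z := by
    intro k
    rw [pd_mul hf.isOpen (hg i k) (hf.contDiffOn_shape k i) _ hz]
    simp only
    rw [hf.pd_time_metric hΦ hz, inner_basis_pd hn, hf.shape_eq hz hn,
      hf.second_form_symm hz (basisVec k)]
    ring
  simp only [hk] at h1
  rw [Finset.sum_add_distrib, ← Finset.mul_sum, ← hf.inner_pd_normal_pd_normal hz hn] at h1
  simp only [ite_mul, one_mul, zero_mul, Finset.sum_ite_eq, Finset.mem_univ, if_true] at h1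
  linarith

end LocalFlow

end LocalFlow

/-! ### Minimum principles at the centre of normal coordinates -/

section NormalCoordinates

variable {n : ℕ}

namespace LocalFlow

variable {Φ : ℝ → ℝ} {Ω : Set (ℝ × Coord n)} {F N : ℝ × Coord n → Ambient n}
  (hf : LocalFlow Φ Ω F N) {z : ℝ × Coord n} (hz : z ∈ Ω)
include hf hz

/-- The mean curvature has no interior space-time minimum. -/
lemma not_min_curv_of_normalAt (hn : NormalAt F z) (hΦ : ContDiffOn ℝ ∞ Φ (Ioi 0))
    (hΦ_pos : ∀ x, 0 < x → 0 < Φ x) (hΦ_deriv_pos : ∀ x, 0 < x → 0 < deriv Φ x)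
    (hmin : ∀ᶠ w in 𝓝 z, w.1 ≤ z.1 → curv F N z ≤ curv F N w) : False := by
  have hH := hf.curv_pos z hz
  have ht := pd_time_of_min hf.isOpen hf.contDiffOn_curv hz hmin
  have hs := pd_spatial_of_min hf.isOpen hf.contDiffOn_curv hz hmin
  rw [hf.pd_time_curv hz hn hΦ] at ht
  have h1 : 0 ≤ ∑ i, pd (0, basisVec i) (pd (0, basisVec i) fun z => Φ (curv F N z)) z := by
    refine Finset.sum_nonneg fun i _ => ?_
    rw [pd_pd_comp hf.isOpen hΦ hf.contDiffOn_curv hf.curv_pos _ hz]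
    simp only [(hs (basisVec i)).1]
    have := mul_nonneg (hΦ_deriv_pos _ hH).le (hs (basisVec i)).2
    linarith
  -- If `|A|²` vanished, so would all derivatives of the normal, and with them the trace `H`.
  have h2 : 0 < ∑ i, (inner ℝ (pd (0, basisVec i) N z) (pd (0, basisVec i) N z) : ℝ) := by
    refine lt_of_le_of_ne (Finset.sum_nonneg fun i _ => real_inner_self_nonneg) fun h => ?_
    have h0 := (Finset.sum_eq_zero_iff_of_nonneg
      (fun i _ => real_inner_self_nonneg (x := pd (0, basisVec i) N z))).mp h.symm
    rw [hf.curv_eq hz hn] at hH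
    have : ∑ i, (inner ℝ (pd (0, basisVec i) N z) (pd (0, basisVec i) F z) : ℝ) = 0 := by
      refine Finset.sum_eq_zero fun i hi => ?_
      rw [inner_self_eq_zero.mp (h0 i hi), inner_zero_left]
    linarith
  have h3 := mul_pos (hΦ_pos _ hH) h2
  linarith

/-- The differential inequality satisfied by a function touching the smallest principal
curvature from below, in normal coordinates. -/
lemma touching_of_normalAt (hn : NormalAt F z) (hΦ : ContDiffOn ℝ ∞ Φ (Ioi 0))
    (hΦ_deriv_pos : ∀ x, 0 < x → 0 < deriv Φ x)
    (hΦ_deriv2_pos : ∀ x, 0 < x → 0 < deriv (deriv Φ) x)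
    {φ : ℝ × Coord n → ℝ} (hφ : ContDiffOn ℝ ∞ φ Ω)
    (hmin : ∀ᶠ w in 𝓝 z, w.1 ≤ z.1 → ∀ a,
      φ w * inner ℝ (spatial F w a) (spatial F w a) ≤ (inner ℝ (spatial N w a) (spatial F w a) : ℝ))
    {u : Coord n} (hu : u ≠ 0) (heq : (inner ℝ (spatial N z u) (spatial F z u) : ℝ)
      = φ z * inner ℝ (spatial F z u) (spatial F z u)) :
    deriv Φ (curv F N z) * (∑ k, pd (0, basisVec k) (pd (0, basisVec k) φ) z
        + (shape (spatial F z) (spatial N z) * shape (spatial F z) (spatial N z)).trace * φ z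
        - curv F N z * φ z ^ 2) + Φ (curv F N z) * φ z ^ 2 ≤ pd (1, 0) φ z ∧
      (0 ≤ φ z → curv F N z * φ z ≤
        (shape (spatial F z) (spatial N z) * shape (spatial F z) (spatial N z)).trace) := by
  have hH := hf.curv_pos z hz
  have hnonneg := hmin.self_of_nhds le_rfl
  have hsymm : ∀ v w, (inner ℝ (spatial N z v) (spatial F z w) : ℝ)
      = inner ℝ (spatial N z w) (spatial F z v) := by
    intro v w
    simp only [hf.spatial_eq hz, hf.spatial_normal_eq hz]
    exact hf.second_form_symm hz v w
  set v : Coord n := ‖u‖⁻¹ • u with hv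
  have hv1 : (inner ℝ v v : ℝ) = 1 := by
    rw [real_inner_self_eq_norm_sq, hv, norm_smul, norm_inv, norm_norm,
      inv_mul_cancel₀ (norm_ne_zero_iff.mpr hu)]; norm_num
  have heqv : (inner ℝ (spatial N z v) (spatial F z v) : ℝ)
      = φ z * inner ℝ (spatial F z v) (spatial F z v) := by
    simp only [hv, map_smul, inner_smul_left, inner_smul_right, heq]; ring
  have hnull : ∀ w, (inner ℝ (pd (0, v) N z) (pd (0, w) F z) : ℝ) = φ z * inner ℝ v w := by
    intro w
    have := null_of_nonneg hsymm hnonneg heqv w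
    simpa only [hf.spatial_eq hz, hf.spatial_normal_eq hz, hn.orthonormal] using this
  -- The null direction of `h - φ g` is an eigenvector of the shape operator.
  have hNv : pd (0, v) N z = φ z • pd (0, v) F z := by
    rw [hf.pd_normal_expand hz hn,
      hf.tangent_expand hz hn (hf.inner_normal_pd hz v), Finset.smul_sum]
    refine Finset.sum_congr rfl fun k _ => ?_
    rw [hnull, hn.orthonormal, smul_smul]
  set Q := ∑ i, (inner ℝ (pd (0, basisVec i) N z) (pd (0, basisVec i) N z) : ℝ) with hQ
  rw [hf.trace_shape_sq hz hn]
  constructor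
  swap
  · intro hφ0
    rw [hf.curv_eq hz hn, Finset.sum_mul]
    refine Finset.sum_le_sum fun i _ => ?_
    have h1 := hnonneg (basisVec i)
    simp only [hf.spatial_eq hz, hf.spatial_normal_eq hz, hn.orthonormal, inner_basisVec] at h1
    have h1' : φ z ≤ (inner ℝ (pd (0, basisVec i) N z) (pd (0, basisVec i) F z) : ℝ) := by
      simpa [basisVec] using h1
    -- Termwise, `φ ≤ hᵢᵢ ≤ ‖∂ᵢN‖` with `φ ≥ 0` gives `hᵢᵢ φ ≤ ‖∂ᵢN‖²`.
    have h2 := real_inner_le_norm (pd (0, basisVec i) N z) (pd (0, basisVec i) F z)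
    have h3 : ‖pd (0, basisVec i) F z‖ = 1 := by
      have h4 := inner_basis_pd hn i i
      rw [real_inner_self_eq_norm_sq, if_pos rfl] at h4
      nlinarith [norm_nonneg (pd (0, basisVec i) F z)]
    rw [h3, mul_one] at h2
    rw [real_inner_self_eq_norm_sq]
    nlinarith
  have hA : ContDiffOn ℝ ∞ (fun w => (inner ℝ (pd (0, v) N w) (pd (0, v) F w) : ℝ)) Ω :=
    (hf.contDiffOn_pd_normal _).inner ℝ (hf.contDiffOn_pd _)
  have hG : ContDiffOn ℝ ∞ (fun w => (inner ℝ (pd (0, v) F w) (pd (0, v) F w) : ℝ)) Ω :=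
    (hf.contDiffOn_pd _).inner ℝ (hf.contDiffOn_pd _)
  -- The direction `v` is kept constant in the coordinates. Thus `f` is smooth, nonnegative up to
  -- the time of `z`, and zero at `z`.
  set f : ℝ × Coord n → ℝ := fun w => inner ℝ (pd (0, v) N w) (pd (0, v) F w)
    - φ w * inner ℝ (pd (0, v) F w) (pd (0, v) F w) with hfdef
  have hfs : ContDiffOn ℝ ∞ f Ω := hA.sub (hφ.mul hG)
  have hfmin : ∀ᶠ w in 𝓝 z, w.1 ≤ z.1 → f z ≤ f w := by
    filter_upwards [hmin, hf.isOpen.mem_nhds hz] with w hw hwΩ hwt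
    have h1 := hw hwt v
    rw [hf.spatial_eq hwΩ, hf.spatial_normal_eq hwΩ] at h1
    have h2 : f z = 0 := by
      simp only [hfdef, hnull, hn.orthonormal]; ring
    rw [h2]
    simp only [hfdef]
    linarith
  have ht := pd_time_of_min hf.isOpen hfs hz hfmin
  have hs := pd_spatial_of_min hf.isOpen hfs hz hfmin
  have hG1 : (inner ℝ (pd (0, v) F z) (pd (0, v) F z) : ℝ) = 1 := by rw [hn.orthonormal, hv1]
  have hNN : (inner ℝ (pd (0, v) N z) (pd (0, v) N z) : ℝ) = φ z ^ 2 := by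
    rw [hNv, inner_smul_left, inner_smul_right, hG1]; simp; ring
  have hbv : ∀ k, (inner ℝ (pd (0, basisVec k) N z) (pd (0, v) F z) : ℝ) = φ z * v k := by
    intro k
    rw [hf.second_form_symm hz, hnull, inner_basisVec]
  have hvv : ∑ k, v k * v k = 1 := by
    rw [← hv1, EuclideanSpace.inner_eq_star_dotProduct]
    simp [dotProduct]
  -- The second fundamental form contributes `-Φφ²` and the metric `+2Φφ²`.
  have htime : pd (0, v) (pd (0, v) fun z => Φ (curv F N z)) z + Φ (curv F N z) * φ z ^ 2
      ≤ pd (1, 0) φ z := by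
    rw [hfdef, pd_sub hf.isOpen hA (hφ.mul hG) _ hz] at ht
    simp only at ht
    rw [pd_mul hf.isOpen hφ hG _ hz] at ht
    simp only at ht
    rw [hf.pd_time_second_form hz hn hΦ, hf.pd_time_metric hΦ hz, hG1, hNN, hnull, hv1] at ht
    linarith
  have hspace : ∀ k : Fin n, 0 ≤
      (-(φ z * inner ℝ (pd (0, basisVec k) N z) (pd (0, basisVec k) N z))
        - 2 * inner ℝ (pd (0, basisVec k) N z) (pd (0, v) (pd (0, v) (pd (0, basisVec k) F)) z)
        - inner ℝ (N z) (pd (0, v) (pd (0, v) (pd (0, basisVec k) (pd (0, basisVec k) F))) z))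
        - pd (0, basisVec k) (pd (0, basisVec k) φ) z
        - 2 * φ z * inner ℝ (pd (0, v) F z)
          (pd (0, basisVec k) (pd (0, basisVec k) (pd (0, v) F)) z)
        - 2 * φ z ^ 3 * (v k * v k) := by
    intro k
    have h := (hs (basisVec k)).2
    have hc : pd (0, basisVec k) (pd (0, v) (pd (0, v) F)) z
        = pd (0, v) (pd (0, v) (pd (0, basisVec k) F)) z := by
      rw [pd_comm hf.isOpen (hf.contDiffOn_pd _) _ _ hz,
        pd_congr hf.isOpen (pd_comm hf.isOpen hf.smooth (0, basisVec k) (0, v)) _ hz]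
    have hc2 : EqOn (pd (0, basisVec k) (pd (0, v) (pd (0, v) F)))
        (pd (0, v) (pd (0, v) (pd (0, basisVec k) F))) Ω := by
      intro w hw
      rw [pd_comm hf.isOpen (hf.contDiffOn_pd _) _ _ hw,
        pd_congr hf.isOpen (pd_comm hf.isOpen hf.smooth (0, basisVec k) (0, v)) _ hw]
    -- The exchange of the pairs `kk` and `vv` in the fourth derivative is what remains of Simons'
    -- identity.
    have hc3 : pd (0, basisVec k) (pd (0, basisVec k) (pd (0, v) (pd (0, v) F))) z
        = pd (0, v) (pd (0, v) (pd (0, basisVec k) (pd (0, basisVec k) F))) z := by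
      rw [pd_congr hf.isOpen hc2 _ hz, pd_comm hf.isOpen
        (ContDiffOn.pd hf.isOpen (hf.contDiffOn_pd _) _) _ _ hz,
        pd_congr hf.isOpen (pd_comm hf.isOpen (hf.contDiffOn_pd _) (0, basisVec k) (0, v)) _ hz]
    rw [hfdef, pd_pd_sub hf.isOpen hA (hφ.mul hG) _ _ hz] at h
    simp only at h
    rw [pd_pd_mul hf.isOpen hφ hG _ _ hz] at h
    simp only at h
    rw [hf.pd_pd_second_form hz hn, hf.pd_pd_metric hz hn, hf.pd_metric hz hn, hc, hc3,
      hnull v, hv1, hG1, hbv,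
      real_inner_comm (pd (0, v) F z)
        (pd (0, basisVec k) (pd (0, basisVec k) (pd (0, v) F)) z)] at h
    linarith
  have hsum := Finset.sum_nonneg fun k (_ : k ∈ Finset.univ) => hspace k
  simp only [Finset.sum_sub_distrib, Finset.sum_neg_distrib, ← Finset.mul_sum, ← hQ, hvv] at hsum
  have hHvv := hf.pd_pd_curv hz hn v
  have e1 : ∑ i, (inner ℝ (pd (0, v) N z)
      (pd (0, basisVec i) (pd (0, basisVec i) (pd (0, v) F)) z) : ℝ)
      = φ z * ∑ i, inner ℝ (pd (0, v) F z)
        (pd (0, basisVec i) (pd (0, basisVec i) (pd (0, v) F)) z) := by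
    rw [Finset.mul_sum]
    refine Finset.sum_congr rfl fun i _ => ?_
    rw [hNv, inner_smul_left]; simp
  have e2 : ∑ i, (inner ℝ (pd (0, v) N z) (pd (0, basisVec i) F z) : ℝ)
            * inner ℝ (pd (0, basisVec i) N z) (pd (0, v) N z) = φ z ^ 3 := by
    have : ∀ i : Fin n, (inner ℝ (pd (0, v) N z) (pd (0, basisVec i) F z) : ℝ)
            * inner ℝ (pd (0, basisVec i) N z) (pd (0, v) N z) = φ z ^ 3 * (v i * v i) := by
      intro i
      rw [hnull, hNv, inner_smul_right, hbv, inner_basisVec]; ring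
    simp only [this]
    rw [← Finset.mul_sum, hvv, mul_one]
  rw [e1, e2, hNN] at hHvv
  -- The third and fourth derivatives of `F` and the terms `2φ³` cancel between `hHvv` and `hsum`.
  have hkey : ∑ k, pd (0, basisVec k) (pd (0, basisVec k) φ) z + Q * φ z
      - curv F N z * φ z ^ 2 ≤ pd (0, v) (pd (0, v) (curv F N)) z := by
    rw [hHvv]
    linarith
  have h1 := mul_le_mul_of_nonneg_left hkey (hΦ_deriv_pos _ hH).le
  rw [pd_pd_comp hf.isOpen hΦ hf.contDiffOn_curv hf.curv_pos _ hz] at htime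
  -- Convexity of `Φ` allows the gradient term `Φ''(H)(∂ᵥH)²` to be discarded.
  have h2 := mul_nonneg (hΦ_deriv2_pos _ hH).le (sq_nonneg (pd (0, v) (curv F N) z))
  linarith

end LocalFlow

end NormalCoordinates

/-! ### Change of variables and construction of normal coordinates -/

section ChangeOfVariables

variable {V V₁ : Type*} [NormedAddCommGroup V] [NormedSpace ℝ V]
  [NormedAddCommGroup V₁] [NormedSpace ℝ V₁]

lemma pd_comp_map {u : V → V₁} {Ψ : V → V} {z : V} (hu : DifferentiableAt ℝ u (Ψ z))
    (hΨ : DifferentiableAt ℝ Ψ z) (a : V) :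
    pd a (fun w => u (Ψ w)) z = pd (pd a Ψ z) u (Ψ z) := by
  have h := (hu.hasFDerivAt.comp z hΨ.hasFDerivAt).fderiv
  simp only [pd]
  change fderiv ℝ (u ∘ Ψ) z a = _
  rw [h]
  rfl

lemma pd_pd_eq {Ω : Set V} (hΩ : IsOpen Ω) {u : V → V₁} (hu : ContDiffOn ℝ ∞ u Ω) {z : V}
    (hz : z ∈ Ω) (a b : V) : pd a (pd b u) z = fderiv ℝ (fderiv ℝ u) z a b := by
  have hd : DifferentiableAt ℝ (fderiv ℝ u) z :=
    ((hu.fderiv_of_isOpen (m := ∞) hΩ (by simp)).differentiableOn (by simp)).differentiableAt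
      (hΩ.mem_nhds hz)
  have : pd b u = fun z => fderiv ℝ u z b := rfl
  rw [this, pd, fderiv_clm_apply hd (differentiableAt_const _)]
  simp

lemma pd_pd_comp_map {Ω Ω' : Set V} (hΩ : IsOpen Ω) (hΩ' : IsOpen Ω') {u : V → V₁}
    {Ψ : V → V} (hu : ContDiffOn ℝ ∞ u Ω) (hΨ : ContDiffOn ℝ ∞ Ψ Ω') (hmap : MapsTo Ψ Ω' Ω)
    {z : V} (hz : z ∈ Ω') (a b : V) :
    pd a (pd b fun w => u (Ψ w)) z
      = pd (pd a Ψ z) (pd (pd b Ψ z) u) (Ψ z) + pd (pd a (pd b Ψ) z) u (Ψ z) := by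
  have hu' : ContDiffOn ℝ ∞ (fderiv ℝ u) Ω := hu.fderiv_of_isOpen hΩ (by simp)
  have h1 : EqOn (pd b fun w => u (Ψ w)) (fun w => fderiv ℝ u (Ψ w) (pd b Ψ w)) Ω' :=
    fun w hw => pd_comp_map (differentiableAt_of_contDiffOn hΩ hu (hmap hw))
      (differentiableAt_of_contDiffOn hΩ' hΨ hw) b
  rw [pd_congr hΩ' h1 a hz]
  have h2 := pd_bilin hΩ' (ContinuousLinearMap.id ℝ (V →L[ℝ] V₁)) (hu'.comp hΨ hmap)
    (ContDiffOn.pd hΩ' hΨ b) a hz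
  simp only [ContinuousLinearMap.id_apply, Function.comp_def] at h2
  rw [h2, pd_comp_map (differentiableAt_of_contDiffOn hΩ hu' (hmap hz))
    (differentiableAt_of_contDiffOn hΩ' hΨ hz), pd_pd_eq hΩ hu (hmap hz)]
  rfl

end ChangeOfVariables

section Reparametrization

variable {n : ℕ}

lemma spatial_comp {G : ℝ × Coord n → Ambient n} {Ψ : ℝ × Coord n → ℝ × Coord n}
    {z : ℝ × Coord n} (hG : DifferentiableAt ℝ G (Ψ z)) (hΨ : DifferentiableAt ℝ Ψ z)
    {J : Coord n →L[ℝ] Coord n} (hJ : ∀ a, pd (0, a) Ψ z = (0, J a)) :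
    spatial (fun w => G (Ψ w)) z = spatial G (Ψ z) ∘L J := by
  ext1 a
  rw [spatial_apply (F := fun w => G (Ψ w)) (hG.comp z hΨ), pd_comp_map hG hΨ, hJ,
    ContinuousLinearMap.comp_apply, spatial_apply hG]

lemma curv_comp {F N : ℝ × Coord n → Ambient n} {Ψ : ℝ × Coord n → ℝ × Coord n}
    {z : ℝ × Coord n} (hF : DifferentiableAt ℝ F (Ψ z)) (hN : DifferentiableAt ℝ N (Ψ z))
    (hΨ : DifferentiableAt ℝ Ψ z) {J : Coord n →L[ℝ] Coord n}
    (hJ : ∀ a, pd (0, a) Ψ z = (0, J a)) (hinj : Injective J) :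
    curv (fun w => F (Ψ w)) (fun w => N (Ψ w)) z = curv F N (Ψ z) := by
  rw [curv, spatial_comp hF hΨ hJ, spatial_comp hN hΨ hJ, trace_shape_comp _ _ hinj, curv]

namespace LocalFlow

variable {Φ : ℝ → ℝ} {Ω Ω' : Set (ℝ × Coord n)} {F N : ℝ × Coord n → Ambient n}
  (hf : LocalFlow Φ Ω F N)
include hf

lemma comp {Ψ : ℝ × Coord n → ℝ × Coord n} {J : ℝ × Coord n → Coord n →L[ℝ] Coord n}
    (hΩ' : IsOpen Ω') (hΨ : ContDiffOn ℝ ∞ Ψ Ω') (hmap : MapsTo Ψ Ω' Ω)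
    (ht : ∀ z ∈ Ω', pd (1, 0) Ψ z = (1, 0)) (hJ : ∀ z ∈ Ω', ∀ a, pd (0, a) Ψ z = (0, J z a))
    (hinj : ∀ z ∈ Ω', Injective (J z)) :
    LocalFlow Φ Ω' (fun z => F (Ψ z)) (fun z => N (Ψ z)) := by
  have hdF : ∀ z ∈ Ω', DifferentiableAt ℝ F (Ψ z) := fun z hz =>
    differentiableAt_of_contDiffOn hf.isOpen hf.smooth (hmap hz)
  have hdN : ∀ z ∈ Ω', DifferentiableAt ℝ N (Ψ z) := fun z hz =>
    differentiableAt_of_contDiffOn hf.isOpen hf.smooth_normal (hmap hz)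
  have hdΨ : ∀ z ∈ Ω', DifferentiableAt ℝ Ψ z := fun z hz =>
    differentiableAt_of_contDiffOn hΩ' hΨ hz
  have hcurv : ∀ z ∈ Ω', curv (fun w => F (Ψ w)) (fun w => N (Ψ w)) z = curv F N (Ψ z) :=
    fun z hz => curv_comp (hdF z hz) (hdN z hz) (hdΨ z hz) (hJ z hz) (hinj z hz)
  refine ⟨hΩ', hf.smooth.comp hΨ hmap, hf.smooth_normal.comp hΨ hmap, ?_,
    fun z hz => hf.norm_normal _ (hmap hz), ?_, ?_, ?_⟩
  · intro z hz
    rw [spatial_comp (hdF z hz) (hdΨ z hz) (hJ z hz)]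
    exact (hf.immersion _ (hmap hz)).comp (hinj z hz)
  · intro z hz a
    rw [spatial_comp (hdF z hz) (hdΨ z hz) (hJ z hz)]
    exact hf.orthogonal _ (hmap hz) _
  · intro z hz
    rw [hcurv z hz]
    exact hf.curv_pos _ (hmap hz)
  · intro z hz
    rw [hcurv z hz, pd_comp_map (hdF z hz) (hdΨ z hz), ht z hz, hf.evolution _ (hmap hz)]

end LocalFlow

/-- `P` projects to the tangent space and then inverts `A`, so that `A ∘ P` is the tangential
projection. -/
lemma exists_tangential_inverse {A : Coord n →L[ℝ] Ambient n} (hA : Injective A)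
    {ν : Ambient n} (hν : ‖ν‖ = 1) (horth : ∀ v, (inner ℝ ν (A v) : ℝ) = 0) :
    ∃ P : Ambient n →L[ℝ] Coord n, ∀ x w, (inner ℝ (A (P x)) (A w) : ℝ) = inner ℝ x (A w) := by
  obtain ⟨Q, hQ⟩ := LinearMap.exists_leftInverse_of_injective (A : Coord n →ₗ[ℝ] Ambient n)
    (LinearMap.ker_eq_bot.mpr hA)
  have hQ' : ∀ v, Q (A v) = v := fun v => LinearMap.congr_fun hQ v
  refine ⟨LinearMap.toContinuousLinearMap Q ∘L
    (ContinuousLinearMap.id ℝ _ - (innerSL ℝ ν).smulRight ν), fun x w => ?_⟩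
  have h0 : (inner ℝ ν (x - (inner ℝ ν x : ℝ) • ν) : ℝ) = 0 := by
    rw [inner_sub_right, inner_smul_right, real_inner_self_eq_norm_sq, hν]; ring
  obtain ⟨v, hv⟩ := exists_preimage_of_orthogonal hA hν horth h0
  have : (LinearMap.toContinuousLinearMap Q ∘L
    (ContinuousLinearMap.id ℝ _ - (innerSL ℝ ν).smulRight ν)) x = v := by
    simp only [ContinuousLinearMap.comp_apply, sub_apply,
      ContinuousLinearMap.id_apply, ContinuousLinearMap.smulRight_apply, innerSL_apply_apply,
      LinearMap.coe_toContinuousLinearMap']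
    rw [← hv, hQ']
  rw [this, hv, inner_sub_left, inner_smul_left, horth]
  simp

/-- An orthonormal basis of the tangent hyperplane, pulled back by `A`. -/
lemma exists_isometric_param {A : Coord n →L[ℝ] Ambient n} (hA : Injective A)
    {ν : Ambient n} (hν : ‖ν‖ = 1) (horth : ∀ v, (inner ℝ ν (A v) : ℝ) = 0) :
    ∃ L : Coord n →L[ℝ] Coord n, ∀ a b, (inner ℝ (A (L a)) (A (L b)) : ℝ) = inner ℝ a b := by
  obtain ⟨P, hP⟩ := exists_tangential_inverse hA hν horth
  have hν0 : ν ≠ 0 := by rintro rfl; simp at hν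
  have h1 : Module.finrank ℝ (ℝ ∙ ν)ᗮ = n := by
    have : Fact (Module.finrank ℝ (Ambient n) = n + 1) := ⟨by simp⟩
    exact Submodule.finrank_orthogonal_span_singleton hν0
  let e := (stdOrthonormalBasis ℝ (ℝ ∙ ν)ᗮ).reindex (finCongr h1)
  have hmem : ∀ a, ∃ v, A v = (e.repr.symm a : Ambient n) := fun a =>
    exists_preimage_of_orthogonal hA hν horth
      (Submodule.mem_orthogonal_singleton_iff_inner_right.mp (e.repr.symm a).2)
  refine ⟨P ∘L ((ℝ ∙ ν)ᗮ.subtypeL ∘L (e.repr.symm.toContinuousLinearEquiv :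
    Coord n →L[ℝ] (ℝ ∙ ν)ᗮ)), fun a b => ?_⟩
  change (inner ℝ (A (P (e.repr.symm a : Ambient n))) (A (P (e.repr.symm b : Ambient n))) : ℝ) = _
  obtain ⟨v, hv⟩ := hmem a
  rw [hP, ← hv, real_inner_comm, hP, hv, real_inner_comm, ← Submodule.coe_inner,
    LinearIsometryEquiv.inner_map_map]

namespace LocalFlow

variable {Φ : ℝ → ℝ} {Ω Ω' : Set (ℝ × Coord n)} {F N : ℝ × Coord n → Ambient n}
  (hf : LocalFlow Φ Ω F N)
include hf

/-- Around every point there is a time-independent reparametrization, quadratic in the space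
variable, whose coordinates are normal at that point. -/
lemma exists_normal_reparam {z : ℝ × Coord n} (hz : z ∈ Ω) :
    ∃ (Ω' : Set (ℝ × Coord n)) (Ψ : ℝ × Coord n → ℝ × Coord n)
      (J : ℝ × Coord n → Coord n →L[ℝ] Coord n) (L : Coord n →L[ℝ] Coord n)
      (c : Coord n → Coord n) (z' : ℝ × Coord n),
      IsOpen Ω' ∧ ContDiffOn ℝ ∞ Ψ Ω' ∧ MapsTo Ψ Ω' Ω ∧ (∀ w ∈ Ω', pd (1, 0) Ψ w = (1, 0)) ∧
      (∀ w ∈ Ω', ∀ a, pd (0, a) Ψ w = (0, J w a)) ∧ (∀ w ∈ Ω', Bijective (J w)) ∧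
      z' ∈ Ω' ∧ Ψ z' = z ∧ (∀ w, (Ψ w).1 = w.1) ∧ J z' = L ∧
      (∀ a, pd (0, a) (pd (0, a) Ψ) z' = (0, c a)) ∧
      (∀ a b, (inner ℝ (spatial F z (L a)) (spatial F z (L b)) : ℝ) = inner ℝ a b) ∧
      (∀ a w, (inner ℝ (spatial F z (c a)) (spatial F z w) : ℝ)
        = -inner ℝ (pd (0, L a) (pd (0, L a) F) z) (spatial F z w)) ∧
      NormalAt (fun w => F (Ψ w)) z' := by
  obtain ⟨P, hP⟩ := exists_tangential_inverse (hf.immersion z hz) (hf.norm_normal z hz)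
    (hf.orthogonal z hz)
  obtain ⟨L, hL⟩ := exists_isometric_param (hf.immersion z hz) (hf.norm_normal z hz)
    (hf.orthogonal z hz)
  have hLinj : Injective L := by
    rw [injective_iff_map_eq_zero]
    intro a ha
    have := hL a a
    rw [ha] at this
    simpa using this.symm
  have hLbij : Bijective L :=
    ⟨hLinj, (L : Coord n →ₗ[ℝ] Coord n).injective_iff_surjective.mp hLinj⟩
  let D2 : (ℝ × Coord n) →L[ℝ] (ℝ × Coord n) →L[ℝ] Ambient n := fderiv ℝ (fderiv ℝ F) z
  have hD2 : ∀ a b, D2 a b = pd a (pd b F) z := fun a b => (pd_pd_eq hf.isOpen hf.smooth hz a b).symm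
  have hD2s : ∀ a b, D2 a b = D2 b a := fun a b => by
    rw [hD2, hD2, pd_comm hf.isOpen hf.smooth _ _ hz]
  have hD2l : ∀ b, D2 (0, 0) b = 0 := fun b => by
    rw [show ((0, 0) : ℝ × Coord n) = 0 from rfl, map_zero]; rfl
  have hD2r : ∀ a, D2 a (0, 0) = 0 := fun a => by rw [hD2s, hD2l]
  let ι : (ℝ × Coord n) →L[ℝ] (ℝ × Coord n) := ContinuousLinearMap.inr ℝ ℝ (Coord n) ∘L L ∘L
    ContinuousLinearMap.snd ℝ ℝ (Coord n)
  -- The second derivative of `C w w` in directions `a`, `b` is `C a b + C b a`; this accounts for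
  -- the factor `1/2`.
  let K : Ambient n →L[ℝ] (ℝ × Coord n) := (-(1 / 2) : ℝ) • (ContinuousLinearMap.inr ℝ ℝ (Coord n) ∘L P)
  let C : (ℝ × Coord n) →L[ℝ] (ℝ × Coord n) →L[ℝ] (ℝ × Coord n) :=
    (ContinuousLinearMap.compL ℝ (ℝ × Coord n) (Ambient n) (ℝ × Coord n) K) ∘L (D2.bilinearComp ι ι)
  have hC : ∀ z w : (ℝ × Coord n), C z w = (0, -(1 / 2 : ℝ) • P (D2 (0, L z.2) (0, L w.2))) := by
    intro z w
    change (-(1 / 2) : ℝ) • ((0 : ℝ), P (D2 (0, L z.2) (0, L w.2))) = _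
    ext1 <;> simp
  let Mm : (ℝ × Coord n) →L[ℝ] (ℝ × Coord n) := (ContinuousLinearMap.fst ℝ ℝ (Coord n)).prod
    (L ∘L ContinuousLinearMap.snd ℝ ℝ (Coord n))
  have hMm : ∀ z : (ℝ × Coord n), Mm z = (z.1, L z.2) := fun _ => rfl
  -- The linear part makes the coordinates orthonormal; the quadratic part removes the tangential
  -- component of the second derivatives of `F`. Time is left untouched, so the flow equation
  -- persists without a tangential term.
  let Ψ : (ℝ × Coord n) → (ℝ × Coord n) := fun w => ((0, z.2) : (ℝ × Coord n)) + (Mm w + C w w)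
  have hid : ContDiff ℝ ∞ (fun w : (ℝ × Coord n) => w) := contDiff_id
  have hMs : ContDiff ℝ ∞ (fun w : (ℝ × Coord n) => Mm w) := Mm.contDiff
  have hCs : ContDiff ℝ ∞ (fun w : (ℝ × Coord n) => C w w) := C.contDiff.clm_apply contDiff_id
  have hΨs : ContDiff ℝ ∞ Ψ := contDiff_const.add (hMs.add hCs)
  have hpdid : ∀ a w : (ℝ × Coord n), pd a (fun w : (ℝ × Coord n) => w) w = a := fun a w => by simp [pd]
  have hpdM : ∀ a w : (ℝ × Coord n), pd a (fun w : (ℝ × Coord n) => Mm w) w = Mm a := fun a w => by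
    simp [pd, Mm.fderiv]
  have hpdΨ : ∀ a w : (ℝ × Coord n), pd a Ψ w = Mm a + (C a w + C w a) := by
    intro a w
    have h1 := pd_add isOpen_univ (contDiffOn_const (c := ((0, z.2) : (ℝ × Coord n))))
      (hMs.add hCs).contDiffOn a (mem_univ w)
    have h2 := pd_add isOpen_univ hMs.contDiffOn hCs.contDiffOn a (mem_univ w)
    have h3 := pd_bilin isOpen_univ C hid.contDiffOn hid.contDiffOn a (mem_univ w)
    simp only [hpdid] at h3
    simp only [hpdM, h3] at h2
    rw [pd_const] at h1
    simp only [h2, zero_add] at h1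
    exact h1
  have hpd2Ψ : ∀ a b w : (ℝ × Coord n), pd a (pd b Ψ) w = C b a + C a b := by
    intro a b w
    have h0 : pd b Ψ = fun w => Mm b + (C b + C.flip b) w := by
      ext1 w; rw [hpdΨ]; rfl
    rw [h0]
    simp only [pd]
    rw [fderiv_const_add, ContinuousLinearMap.fderiv]
    rfl
  let J : (ℝ × Coord n) → Coord n →L[ℝ] Coord n := fun w =>
    ContinuousLinearMap.snd ℝ ℝ (Coord n) ∘L (Mm + (C.flip w + C w)) ∘L
      ContinuousLinearMap.inr ℝ ℝ (Coord n)
  have hJcont : Continuous J := by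
    have h : Continuous fun w : (ℝ × Coord n) => Mm + (C.flip w + C w) := by fun_prop
    exact continuous_const.clm_comp (h.clm_comp continuous_const)
  have hJ : ∀ w a, pd (0, a) Ψ w = (0, J w a) := by
    intro w a
    have h : J w a = (pd (0, a) Ψ w).2 := by rw [hpdΨ]; rfl
    ext1
    · rw [hpdΨ, hMm, hC, hC]; simp
    · exact h.symm
  let z' : (ℝ × Coord n) := (z.1, 0)
  have hz'Ψ : Ψ z' = z := by
    change ((0, z.2) : (ℝ × Coord n)) + (Mm (z.1, 0) + C (z.1, 0) (z.1, 0)) = z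
    rw [hMm, hC]
    ext1 <;> simp [hD2l]
  have hJz' : J z' = L := by
    ext1 a
    have h : J z' a = (pd (0, a) Ψ z').2 := by rw [hpdΨ]; rfl
    rw [h, hpdΨ, hMm, hC, hC]
    simp [z', hD2l, hD2r]
  have hΨ1 : ∀ w, (Ψ w).1 = w.1 := by
    intro w
    change (((0, z.2) : (ℝ × Coord n)) + (Mm w + C w w)).1 = w.1
    rw [hMm, hC]; simp
  have hD1 : ∀ a, pd (0, a) Ψ z' = (0, L a) := fun a => by rw [hJ, hJz']
  have hD2Ψ : ∀ a b, pd (0, a) (pd (0, b) Ψ) z' = (0, -P (D2 (0, L a) (0, L b))) := by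
    intro a b
    rw [hpd2Ψ, hC, hC]
    simp only [Prod.mk_add_mk, add_zero, hD2s (0, L b)]
    congr 1
    rw [← add_smul]; norm_num
  have hdF := differentiableAt_of_contDiffOn hf.isOpen hf.smooth hz
  -- Invertibility of the spatial derivative is an open condition and holds at `z'`, where it equals
  -- `L`.
  let Ω' : Set (ℝ × Coord n) := Ψ ⁻¹' Ω ∩ J ⁻¹' {j | IsUnit j}
  have hΩ' : IsOpen Ω' :=
    (hf.isOpen.preimage hΨs.continuous).inter (Units.isOpen.preimage hJcont)
  have hmap : MapsTo Ψ Ω' Ω := fun w hw => hw.1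
  have hz'Ω : z' ∈ Ω' := by
    refine ⟨by rw [mem_preimage, hz'Ψ]; exact hz, ?_⟩
    rw [mem_preimage, hJz']
    exact ContinuousLinearMap.isUnit_iff_bijective.mpr hLbij
  refine ⟨Ω', Ψ, J, L, fun a => -P (D2 (0, L a) (0, L a)), z', hΩ', hΨs.contDiffOn, hmap, ?_,
    fun w _ a => hJ w a, fun w hw => ContinuousLinearMap.isUnit_iff_bijective.mp hw.2, hz'Ω,
    hz'Ψ, hΨ1, hJz', fun a => hD2Ψ a a, hL, ?_, ?_, ?_⟩
  · intro w _
    rw [hpdΨ, hMm, hC, hC]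
    simp [hD2l, hD2r]
  · intro a w
    simp only [map_neg, inner_neg_left, hP, hD2]
  · intro a b
    have h : ∀ a, pd (0, a) (fun w => F (Ψ w)) z' = spatial F z (L a) := by
      intro a
      rw [pd_comp_map (by rw [hz'Ψ]; exact hdF) (hΨs.differentiable (by simp) z'), hD1, hz'Ψ,
        spatial_apply hdF]
    rw [h, h, hL]
  · intro a b c
    have h : pd (0, c) (fun w => F (Ψ w)) z' = spatial F z (L c) := by
      rw [pd_comp_map (by rw [hz'Ψ]; exact hdF) (hΨs.differentiable (by simp) z'), hD1, hz'Ψ,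
        spatial_apply hdF]
    rw [h, pd_pd_comp_map hf.isOpen hΩ' hf.smooth hΨs.contDiffOn hmap hz'Ω, hD1, hD1, hD2Ψ,
      hz'Ψ, ← spatial_apply hdF, inner_add_left, map_neg, inner_neg_left, hP, hD2]
    ring

/-- The mean curvature has no interior space-time minimum. -/
lemma not_min_curv (hΦ : ContDiffOn ℝ ∞ Φ (Ioi 0))
    (hΦ_pos : ∀ x, 0 < x → 0 < Φ x) (hΦ_deriv_pos : ∀ x, 0 < x → 0 < deriv Φ x)
    {z : ℝ × Coord n} (hz : z ∈ Ω)
    (hmin : ∀ᶠ w in 𝓝 z, w.1 ≤ z.1 → curv F N z ≤ curv F N w) : False := by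
  obtain ⟨Ω', Ψ, J, L, c, z', hΩ', hΨ, hmap, ht, hJ, hbij, hz', hzz, h1, -, -, -, -, hn⟩ :=
    hf.exists_normal_reparam hz
  have hf' := hf.comp hΩ' hΨ hmap ht hJ fun w hw => (hbij w hw).1
  have hcurv : ∀ w ∈ Ω', curv (fun w => F (Ψ w)) (fun w => N (Ψ w)) w = curv F N (Ψ w) :=
    fun w hw => curv_comp (differentiableAt_of_contDiffOn hf.isOpen hf.smooth (hmap hw))
      (differentiableAt_of_contDiffOn hf.isOpen hf.smooth_normal (hmap hw))
      (differentiableAt_of_contDiffOn hΩ' hΨ hw) (hJ w hw) (hbij w hw).1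
  refine hf'.not_min_curv_of_normalAt hz' hn hΦ hΦ_pos hΦ_deriv_pos ?_
  have hcont : ContinuousAt Ψ z' := (differentiableAt_of_contDiffOn hΩ' hΨ hz').continuousAt
  have hev := hcont.eventually (by rw [hzz]; exact hmin)
  filter_upwards [hev, hΩ'.mem_nhds hz'] with w hw hwΩ hwt
  rw [hcurv w hwΩ, hcurv z' hz', hzz]
  exact hw (by rw [h1, ← hzz, h1]; exact hwt)

/-- The differential inequality satisfied by a function touching the smallest principal
curvature from below. -/
lemma touching (hΦ : ContDiffOn ℝ ∞ Φ (Ioi 0))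
    (hΦ_deriv_pos : ∀ x, 0 < x → 0 < deriv Φ x)
    (hΦ_deriv2_pos : ∀ x, 0 < x → 0 < deriv (deriv Φ) x)
    {z : ℝ × Coord n} (hz : z ∈ Ω) {φ : ℝ × Coord n → ℝ} (hφ : ContDiffOn ℝ ∞ φ Ω)
    (hmin : ∀ᶠ w in 𝓝 z, w.1 ≤ z.1 → ∀ a,
      φ w * inner ℝ (spatial F w a) (spatial F w a) ≤ (inner ℝ (spatial N w a) (spatial F w a) : ℝ))
    {u : Coord n} (hu : u ≠ 0) (heq : (inner ℝ (spatial N z u) (spatial F z u) : ℝ)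
      = φ z * inner ℝ (spatial F z u) (spatial F z u)) :
    ∃ (L : Coord n →L[ℝ] Coord n) (c : Coord n → Coord n),
      (∀ a b, (inner ℝ (spatial F z (L a)) (spatial F z (L b)) : ℝ) = inner ℝ a b) ∧
      (∀ a w, (inner ℝ (spatial F z (c a)) (spatial F z w) : ℝ)
        = -inner ℝ (pd (0, L a) (pd (0, L a) F) z) (spatial F z w)) ∧
      deriv Φ (curv F N z) * (∑ k, (pd (0, L (basisVec k)) (pd (0, L (basisVec k)) φ) z
          + pd (0, c (basisVec k)) φ z)
        + (shape (spatial F z) (spatial N z) * shape (spatial F z) (spatial N z)).trace * φ z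
        - curv F N z * φ z ^ 2) + Φ (curv F N z) * φ z ^ 2 ≤ pd (1, 0) φ z ∧
      (0 ≤ φ z → curv F N z * φ z ≤
        (shape (spatial F z) (spatial N z) * shape (spatial F z) (spatial N z)).trace) := by
  obtain ⟨Ω', Ψ, J, L, c, z', hΩ', hΨ, hmap, ht, hJ, hbij, hz', hzz, h1, hJL, hc, hL, hcF, hn⟩ :=
    hf.exists_normal_reparam hz
  refine ⟨L, c, hL, hcF, ?_⟩
  have hf' := hf.comp hΩ' hΨ hmap ht hJ fun w hw => (hbij w hw).1
  have hdF : ∀ w ∈ Ω', DifferentiableAt ℝ F (Ψ w) := fun w hw =>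
    differentiableAt_of_contDiffOn hf.isOpen hf.smooth (hmap hw)
  have hdN : ∀ w ∈ Ω', DifferentiableAt ℝ N (Ψ w) := fun w hw =>
    differentiableAt_of_contDiffOn hf.isOpen hf.smooth_normal (hmap hw)
  have hdΨ : ∀ w ∈ Ω', DifferentiableAt ℝ Ψ w := fun w hw =>
    differentiableAt_of_contDiffOn hΩ' hΨ hw
  have hsF : ∀ w ∈ Ω', spatial (fun w => F (Ψ w)) w = spatial F (Ψ w) ∘L J w := fun w hw =>
    spatial_comp (hdF w hw) (hdΨ w hw) (hJ w hw)
  have hsN : ∀ w ∈ Ω', spatial (fun w => N (Ψ w)) w = spatial N (Ψ w) ∘L J w := fun w hw =>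
    spatial_comp (hdN w hw) (hdΨ w hw) (hJ w hw)
  have hφ' : ContDiffOn ℝ ∞ (fun w => φ (Ψ w)) Ω' := hφ.comp hΨ hmap
  have hmin' : ∀ᶠ w in 𝓝 z', w.1 ≤ z'.1 → ∀ a,
      φ (Ψ w) * inner ℝ (spatial (fun w => F (Ψ w)) w a) (spatial (fun w => F (Ψ w)) w a)
        ≤ (inner ℝ (spatial (fun w => N (Ψ w)) w a) (spatial (fun w => F (Ψ w)) w a) : ℝ) := by
    have hev := (hdΨ z' hz').continuousAt.eventually (by rw [hzz]; exact hmin)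
    filter_upwards [hev, hΩ'.mem_nhds hz'] with w hw hwΩ hwt a
    rw [hsF w hwΩ, hsN w hwΩ]
    exact hw (by rw [h1, ← hzz, h1]; exact hwt) (J w a)
  obtain ⟨u', rfl⟩ := (hbij z' hz').2 u
  have hu' : u' ≠ 0 := by rintro rfl; simp at hu
  have h := hf'.touching_of_normalAt hz' hn hΦ hΦ_deriv_pos hΦ_deriv2_pos hφ' hmin' hu' (by
    rw [hsF z' hz', hsN z' hz', hzz]; exact heq)
  have hcurv : curv (fun w => F (Ψ w)) (fun w => N (Ψ w)) z' = curv F N z := by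
    rw [curv_comp (hdF z' hz') (hdN z' hz') (hdΨ z' hz') (hJ z' hz') (hbij z' hz').1, hzz]
  have hdφ := differentiableAt_of_contDiffOn hf.isOpen hφ hz
  rw [hcurv, hsF z' hz', hsN z' hz', trace_shape_sq_comp _ _ (hbij z' hz').1, hzz] at h
  -- In the original coordinates the Laplacian is a sum of second derivatives along an orthonormal
  -- frame plus a drift; the vectors `c` carry the Christoffel terms.
  have hpd2 : ∀ k : Fin n, pd (0, basisVec k) (pd (0, basisVec k) fun w => φ (Ψ w)) z'
      = pd (0, L (basisVec k)) (pd (0, L (basisVec k)) φ) z + pd (0, c (basisVec k)) φ z := by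
    intro k
    rw [pd_pd_comp_map hf.isOpen hΩ' hφ hΨ hmap hz', hJ z' hz', hJL, hc, hzz]
  have hpdt : pd (1, 0) (fun w => φ (Ψ w)) z' = pd (1, 0) φ z := by
    rw [pd_comp_map (by rw [hzz]; exact hdφ) (hdΨ z' hz'), ht z' hz', hzz]
  simp only [hpd2, hpdt] at h
  exact h

end LocalFlow

end Reparametrization

/-! ### Bounds for the principal curvatures as open and closed conditions -/

section Bounds

variable {n : ℕ}

/-- All principal curvatures are larger than `m`. -/
def Above (A N : Coord n →L[ℝ] Ambient n) (m : ℝ) : Prop :=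
  ∀ v, v ≠ 0 → m * inner ℝ (A v) (A v) < (inner ℝ (N v) (A v) : ℝ)

/-- All principal curvatures are at least `m`. -/
def AtLeast (A N : Coord n →L[ℝ] Ambient n) (m : ℝ) : Prop :=
  ∀ v, m * inner ℝ (A v) (A v) ≤ (inner ℝ (N v) (A v) : ℝ)

lemma Above.mono {A N : Coord n →L[ℝ] Ambient n} {m m' : ℝ} (h : Above A N m) (hm : m' ≤ m) :
    Above A N m' := fun v hv =>
  lt_of_le_of_lt (mul_le_mul_of_nonneg_right hm real_inner_self_nonneg) (h v hv)

lemma Above.atLeast {A N : Coord n →L[ℝ] Ambient n} {m : ℝ} (h : Above A N m) :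
    AtLeast A N m := by
  intro v
  by_cases hv : v = 0
  · simp [hv]
  · exact (h v hv).le

lemma AtLeast.above {A N : Coord n →L[ℝ] Ambient n} (hA : Injective A) {m m' : ℝ}
    (h : AtLeast A N m) (hm : m' < m) : Above A N m' := fun v hv =>
  lt_of_lt_of_le (mul_lt_mul_of_pos_right hm (inner_self_map_pos hA hv)) (h v)

lemma above_comp {A N : Coord n →L[ℝ] Ambient n} {J : Coord n →L[ℝ] Coord n}
    (hJ : Bijective J) {m : ℝ} : Above (A ∘L J) (N ∘L J) m ↔ Above A N m := by
  constructor
  · intro h v hv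
    obtain ⟨u, rfl⟩ := hJ.2 v
    exact h u (by rintro rfl; simp at hv)
  · intro h v hv
    exact h (J v) fun h0 => hv (hJ.1 (by simpa using h0))

lemma atLeast_comp {A N : Coord n →L[ℝ] Ambient n} {J : Coord n →L[ℝ] Coord n}
    (hJ : Bijective J) {m : ℝ} : AtLeast (A ∘L J) (N ∘L J) m ↔ AtLeast A N m := by
  constructor
  · intro h v
    obtain ⟨u, rfl⟩ := hJ.2 v
    exact h u
  · exact fun h v => h (J v)

lemma exists_of_not_above {A N : Coord n →L[ℝ] Ambient n} {m : ℝ} (h : ¬ Above A N m)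
    (h' : AtLeast A N m) :
    ∃ u, u ≠ 0 ∧ (inner ℝ (N u) (A u) : ℝ) = m * inner ℝ (A u) (A u) := by
  simp only [Above, not_forall, not_lt] at h
  obtain ⟨u, hu, hle⟩ := h
  exact ⟨u, hu, le_antisymm hle (h' u)⟩

lemma isClosed_atLeast : IsClosed {x : (Coord n →L[ℝ] Ambient n) × (Coord n →L[ℝ] Ambient n) × ℝ |
    AtLeast x.1 x.2.1 x.2.2} := by
  simp only [AtLeast, ofPred_forall]
  exact isClosed_iInter fun v => isClosed_le (by fun_prop) (by fun_prop)

/-- By homogeneity only unit vectors matter, and compactness of the sphere makes the strict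
inequality stable. -/
lemma isOpen_above : IsOpen {x : (Coord n →L[ℝ] Ambient n) × (Coord n →L[ℝ] Ambient n) × ℝ |
    Above x.1 x.2.1 x.2.2} := by
  have hsph : ∀ x : (Coord n →L[ℝ] Ambient n) × (Coord n →L[ℝ] Ambient n) × ℝ,
      Above x.1 x.2.1 x.2.2 ↔ ∀ v ∈ Metric.sphere (0 : Coord n) 1,
        x.2.2 * inner ℝ (x.1 v) (x.1 v) < (inner ℝ (x.2.1 v) (x.1 v) : ℝ) := by
    intro x
    constructor
    · intro h v hv
      exact h v (by rintro rfl; simp at hv)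
    · intro h v hv
      have h1 := h (‖v‖⁻¹ • v) (by simp [norm_smul, hv])
      simp only [map_smul, inner_smul_left, inner_smul_right, conj_trivial] at h1
      have hp : 0 < ‖v‖⁻¹ := by positivity
      have h2 : ‖v‖⁻¹ * (‖v‖⁻¹ * (x.2.2 * inner ℝ (x.1 v) (x.1 v)))
          < ‖v‖⁻¹ * (‖v‖⁻¹ * (inner ℝ (x.2.1 v) (x.1 v) : ℝ)) := by linarith
      exact lt_of_mul_lt_mul_left (lt_of_mul_lt_mul_left h2 hp.le) hp.le
  rw [isOpen_iff_eventually]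
  intro x hx
  have := (isCompact_sphere (0 : Coord n) 1).eventually_forall_of_forall_eventually (x₀ := x)
    (P := fun x v => x.2.2 * inner ℝ (x.1 v) (x.1 v) < (inner ℝ (x.2.1 v) (x.1 v) : ℝ))
    (fun v hv => by
      have hopen : IsOpen {y : ((Coord n →L[ℝ] Ambient n) × (Coord n →L[ℝ] Ambient n) × ℝ) × Coord n |
          y.1.2.2 * inner ℝ (y.1.1 y.2) (y.1.1 y.2) < (inner ℝ (y.1.2.1 y.2) (y.1.1 y.2) : ℝ)} :=
        isOpen_lt (by fun_prop) (by fun_prop)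
      exact hopen.mem_nhds ((hsph x).mp hx v hv))
  filter_upwards [this] with y hy
  exact (hsph y).mpr hy

/-- A closed condition that holds at earlier times near a point also holds at that time. -/
lemma eventually_le_of_eventually_lt {E Y : Type*} [NormedAddCommGroup E] [NormedSpace ℝ E]
    [TopologicalSpace Y] {G : ℝ × E → Y} {C : Set Y} (hC : IsClosed C) {z : ℝ × E}
    (hG : ∀ᶠ w in 𝓝 z, ContinuousAt G w) (h : ∀ᶠ w in 𝓝 z, w.1 < z.1 → G w ∈ C) :
    ∀ᶠ w in 𝓝 z, w.1 ≤ z.1 → G w ∈ C := by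
  filter_upwards [hG, eventually_eventually_nhds.mpr h] with w hw1 hw2 hle
  have hcont : ContinuousAt (fun s : ℝ => w + s • ((1, 0) : ℝ × E)) 0 := by fun_prop
  have ht : Tendsto (fun s : ℝ => w + s • ((1, 0) : ℝ × E)) (𝓝[<] 0) (𝓝 w) := by
    have := hcont.tendsto.mono_left (nhdsWithin_le_nhds (s := Iio 0))
    simpa using this
  refine hC.mem_of_tendsto (hw1.tendsto.comp ht) ?_
  filter_upwards [ht.eventually hw2, self_mem_nhdsWithin] with s hs (hs0 : s < 0)
  refine hs ?_
  simp only [Prod.fst_add, Prod.smul_fst, smul_eq_mul, mul_one]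
  linarith

/-- Uniform ellipticity of the Laplacian: writing `y = L b`, Cauchy–Schwarz bounds `‖y‖⁴` by `‖b‖²`
times the sum, and `‖b‖ = ‖A y‖ ≤ M ‖y‖`. -/
lemma norm_sq_le_of_isometric {A : Coord n →L[ℝ] Ambient n} {L : Coord n →L[ℝ] Coord n}
    (hL : ∀ a b, (inner ℝ (A (L a)) (A (L b)) : ℝ) = inner ℝ a b) {M : ℝ} (hM : ‖A‖ ≤ M)
    (y : Coord n) :
    ‖y‖ ^ 2 ≤ M ^ 2 * ∑ k, (inner ℝ y (L (basisVec k)) : ℝ) ^ 2 := by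
  have hLinj : Injective L := by
    rw [injective_iff_map_eq_zero]
    intro a ha
    have := hL a a
    rw [ha] at this
    simpa using this.symm
  obtain ⟨b, rfl⟩ := (L : Coord n →ₗ[ℝ] Coord n).injective_iff_surjective.mp hLinj y
  change ‖L b‖ ^ 2 ≤ M ^ 2 * ∑ k, (inner ℝ (L b) (L (basisVec k)) : ℝ) ^ 2
  have h1 : ‖b‖ ≤ M * ‖L b‖ := by
    have h2 : ‖b‖ = ‖A (L b)‖ := by
      have := hL b b
      rw [real_inner_self_eq_norm_sq, real_inner_self_eq_norm_sq] at this
      exact (sq_eq_sq₀ (norm_nonneg _) (norm_nonneg _)).mp this.symm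
    rw [h2]
    exact (A.le_opNorm _).trans (mul_le_mul_of_nonneg_right hM (norm_nonneg _))
  set S := ∑ k, (inner ℝ (L b) (L (basisVec k)) : ℝ) ^ 2 with hS
  have h3 : ‖L b‖ ^ 2 = ∑ k, b k * inner ℝ (L b) (L (basisVec k)) := by
    rw [← real_inner_self_eq_norm_sq]
    nth_rewrite 2 [map_sum_basisVec L b]
    simp [inner_sum, inner_smul_right]
  have h4 : (‖L b‖ ^ 2) ^ 2 ≤ ‖b‖ ^ 2 * S := by
    rw [h3, EuclideanSpace.norm_sq_eq]
    simp only [Real.norm_eq_abs, sq_abs]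
    exact Finset.sum_mul_sq_le_sq_mul_sq _ _ _
  have hS0 : 0 ≤ S := Finset.sum_nonneg fun _ _ => sq_nonneg _
  have h5 : ‖b‖ ^ 2 * S ≤ (M * ‖L b‖) ^ 2 * S :=
    mul_le_mul_of_nonneg_right (pow_le_pow_left₀ (norm_nonneg _) h1 2) hS0
  by_cases h0 : ‖L b‖ = 0
  · rw [h0, zero_pow two_ne_zero]; exact mul_nonneg (sq_nonneg M) hS0
  · have hp : 0 < ‖L b‖ ^ 2 := by positivity
    have h6 : ‖L b‖ ^ 2 * ‖L b‖ ^ 2 ≤ ‖L b‖ ^ 2 * (M ^ 2 * S) := by nlinarith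
    exact le_of_mul_le_mul_left h6 hp

end Bounds

/-! ### The barrier and its derivatives -/

section Barrier

variable {n : ℕ} (c : Coord n) (t₀ δ β ε K η : ℝ)

/-- The defining function of a ball whose radius grows in time. -/
def ballFn (z : ℝ × Coord n) : ℝ := δ ^ 2 + β * (z.1 - t₀) - inner ℝ (z.2 - c) (z.2 - c)

/-- A subsolution supported in a growing ball. -/
def barrier (z : ℝ × Coord n) : ℝ :=
  ε * Real.exp (-K * (z.1 - t₀)) * (ballFn c t₀ δ β z * ballFn c t₀ δ β z) - η

lemma contDiff_ballFn : ContDiff ℝ ∞ (ballFn c t₀ δ β) := by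
  unfold ballFn
  refine ContDiff.sub (by fun_prop) (ContDiff.inner ℝ (by fun_prop) (by fun_prop))

lemma pd_ballFn (a z : ℝ × Coord n) :
    pd a (ballFn c t₀ δ β) z = β * a.1 - 2 * inner ℝ (z.2 - c) a.2 := by
  have h1 : HasFDerivAt (fun z : ℝ × Coord n => z.2 - c)
      (ContinuousLinearMap.snd ℝ ℝ (Coord n)) z :=
    (ContinuousLinearMap.snd ℝ ℝ (Coord n)).hasFDerivAt.sub_const c
  have h2 : HasFDerivAt (fun z : ℝ × Coord n => δ ^ 2 + β * (z.1 - t₀))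
      (β • ContinuousLinearMap.fst ℝ ℝ (Coord n)) z :=
    (((ContinuousLinearMap.fst ℝ ℝ (Coord n)).hasFDerivAt.sub_const t₀).const_mul β).const_add _
  have h3 := h2.sub (h1.inner ℝ h1)
  have h4 : fderiv ℝ (ballFn c t₀ δ β) z = _ := h3.fderiv
  rw [pd, h4]
  simp [real_inner_comm]
  ring

lemma pd_pd_ballFn (a : Coord n) (z : ℝ × Coord n) :
    pd (0, a) (pd (0, a) (ballFn c t₀ δ β)) z = -2 * inner ℝ a a := by
  have h1 : HasFDerivAt (fun z : ℝ × Coord n => z.2 - c)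
      (ContinuousLinearMap.snd ℝ ℝ (Coord n)) z :=
    (ContinuousLinearMap.snd ℝ ℝ (Coord n)).hasFDerivAt.sub_const c
  have h2 : pd (0, a) (ballFn c t₀ δ β) = fun z => -2 * inner ℝ (z.2 - c) a := by
    ext z; rw [pd_ballFn]; ring
  have h3 := (h1.inner ℝ (hasFDerivAt_const a z)).const_mul (-2 : ℝ)
  rw [h2, pd, h3.fderiv]
  simp

lemma contDiff_barrier : ContDiff ℝ ∞ (barrier c t₀ δ β ε K η) := by
  have h := contDiff_ballFn c t₀ δ β
  unfold barrier
  exact (ContDiff.mul (by fun_prop) (h.mul h)).sub contDiff_const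

lemma pd_expFn (a z : ℝ × Coord n) :
    pd a (fun z : ℝ × Coord n => ε * Real.exp (-K * (z.1 - t₀))) z
      = ε * Real.exp (-K * (z.1 - t₀)) * (-K * a.1) := by
  have h1 : HasFDerivAt (fun z : ℝ × Coord n => -K * (z.1 - t₀))
      (-K • ContinuousLinearMap.fst ℝ ℝ (Coord n)) z :=
    ((ContinuousLinearMap.fst ℝ ℝ (Coord n)).hasFDerivAt.sub_const t₀).const_mul (-K)
  rw [pd, (h1.exp.const_mul ε).fderiv]
  simp
  ring

lemma pd_barrier (a z : ℝ × Coord n) :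
    pd a (barrier c t₀ δ β ε K η) z = ε * Real.exp (-K * (z.1 - t₀)) *
      (2 * ballFn c t₀ δ β z * pd a (ballFn c t₀ δ β) z
        - K * a.1 * (ballFn c t₀ δ β z * ballFn c t₀ δ β z)) := by
  have hb := (contDiff_ballFn c t₀ δ β).contDiffOn (s := univ)
  have he : ContDiffOn ℝ ∞ (fun z : ℝ × Coord n => ε * Real.exp (-K * (z.1 - t₀))) univ := by
    fun_prop
  have h1 := pd_sub isOpen_univ (he.mul (hb.mul hb)) (contDiffOn_const (c := η)) a (mem_univ z)
  have h2 := pd_mul isOpen_univ he (hb.mul hb) a (mem_univ z)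
  have h3 := pd_mul isOpen_univ hb hb a (mem_univ z)
  rw [pd_const] at h1
  simp only [h3, pd_expFn] at h2
  simp only [h2] at h1
  have h4 : pd a (barrier c t₀ δ β ε K η) z = _ := h1
  rw [h4]
  ring

/-- Squaring the ball function produces the term `2 |∂w|²`, which stays positive where `w` vanishes
and drives the comparison near the edge of the ball. -/
lemma pd_pd_barrier (a : Coord n) (z : ℝ × Coord n) :
    pd (0, a) (pd (0, a) (barrier c t₀ δ β ε K η)) z = ε * Real.exp (-K * (z.1 - t₀)) *
      (2 * pd (0, a) (ballFn c t₀ δ β) z ^ 2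
        + 2 * ballFn c t₀ δ β z * pd (0, a) (pd (0, a) (ballFn c t₀ δ β)) z) := by
  have hb := (contDiff_ballFn c t₀ δ β).contDiffOn (s := univ)
  have hb' := ContDiffOn.pd isOpen_univ hb (0, a)
  have he : ContDiffOn ℝ ∞ (fun z : ℝ × Coord n => ε * Real.exp (-K * (z.1 - t₀))) univ := by
    fun_prop
  have h0 : pd (0, a) (barrier c t₀ δ β ε K η) = fun z => ε * Real.exp (-K * (z.1 - t₀)) *
      (ballFn c t₀ δ β z * (2 * pd (0, a) (ballFn c t₀ δ β) z)) := by
    ext z; rw [pd_barrier]; ring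
  have hb2 : ContDiffOn ℝ ∞ (fun z => 2 * pd (0, a) (ballFn c t₀ δ β) z) univ :=
    contDiffOn_const.mul hb'
  have h2 := pd_mul isOpen_univ he (hb.mul hb2) (0, a) (mem_univ z)
  have h3 := pd_mul isOpen_univ hb hb2 (0, a) (mem_univ z)
  have h4 := pd_mul isOpen_univ (contDiffOn_const (c := (2 : ℝ))) hb' (0, a) (mem_univ z)
  rw [pd_const] at h4
  simp only at h4
  simp only [h4] at h3
  simp only [h3, pd_expFn] at h2
  rw [h0, h2]
  ring

end Barrier

/-! ### Instantaneous spreading of strict convexity -/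

section Propagation

variable {n : ℕ}

lemma exists_lower_bound_on_compact {V : Type*} [TopologicalSpace V]
    {A : V → Coord n →L[ℝ] Ambient n} {S : Set V} (hS : IsCompact S) (hA : ContinuousOn A S)
    (hinj : ∀ z ∈ S, Injective (A z)) : ∃ a > 0, ∀ z ∈ S, ∀ v, a * ‖v‖ ≤ ‖A z v‖ := by
  have hcomp : IsCompact (S ×ˢ Metric.sphere (0 : Coord n) 1) := hS.prod (isCompact_sphere _ _)
  have hcont : ContinuousOn (fun x : V × Coord n => ‖A x.1 x.2‖)
      (S ×ˢ Metric.sphere (0 : Coord n) 1) :=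
    ((hA.comp continuousOn_fst fun x hx => hx.1).clm_apply continuousOn_snd).norm
  obtain ⟨a, ha, hle⟩ : ∃ a > 0, ∀ x ∈ S ×ˢ Metric.sphere (0 : Coord n) 1, a ≤ ‖A x.1 x.2‖ := by
    rcases (S ×ˢ Metric.sphere (0 : Coord n) 1).eq_empty_or_nonempty with h | h
    · exact ⟨1, one_pos, by simp [h]⟩
    · obtain ⟨x, hx, hmin⟩ := hcomp.exists_isMinOn h hcont
      refine ⟨_, ?_, fun y hy => hmin hy⟩
      have hx2 : x.2 ≠ 0 := by
        intro h0
        have := hx.2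
        rw [h0] at this
        simp at this
      exact norm_pos_iff.mpr fun h0 => hx2 (hinj _ hx.1 (by simpa using h0))
  refine ⟨a, ha, fun z hz v => ?_⟩
  by_cases hv : v = 0
  · simp [hv]
  · have h := hle (z, ‖v‖⁻¹ • v) ⟨hz, by simp [norm_smul, hv]⟩
    simp only [map_smul, norm_smul, norm_inv, norm_norm] at h
    have hp : 0 < ‖v‖ := norm_pos_iff.mpr hv
    rwa [inv_mul_eq_div, le_div_iff₀ hp] at h

lemma exists_pos_bounds_on_compact {V : Type*} [TopologicalSpace V] {f : V → ℝ} {S : Set V}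
    (hS : IsCompact S) (hf : ContinuousOn f S) (hpos : ∀ z ∈ S, 0 < f z) :
    ∃ m > 0, ∃ M > 0, ∀ z ∈ S, m ≤ f z ∧ f z ≤ M := by
  rcases S.eq_empty_or_nonempty with h | h
  · exact ⟨1, one_pos, 1, one_pos, by simp [h]⟩
  · obtain ⟨x, hx, hmin⟩ := hS.exists_isMinOn h hf
    obtain ⟨y, hy, hmax⟩ := hS.exists_isMaxOn h hf
    exact ⟨f x, hpos x hx, f y, hpos y hy, fun z hz => ⟨hmin hz, hmax hz⟩⟩

lemma exists_norm_bound_on_compact {V W : Type*} [TopologicalSpace V] [NormedAddCommGroup W]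
    {f : V → W} {S : Set V} (hS : IsCompact S) (hf : ContinuousOn f S) :
    ∃ M > 0, ∀ z ∈ S, ‖f z‖ ≤ M := by
  obtain ⟨M, hM⟩ := hS.exists_bound_of_continuousOn hf
  exact ⟨max M 1, by positivity, fun z hz => (hM z hz).trans (le_max_left _ _)⟩

/-- The constants of the barrier are chosen so that it violates the differential inequality
of a touching function. -/
lemma barrier_inequality_false {P' m M' θ C₁ β δ w r Q : ℝ} (hm : 0 < m) (hP1 : m ≤ P')
    (hP2 : P' ≤ M') (hθ : 0 < θ) (hC : 0 ≤ C₁) (hδ : 0 < δ) (hw : 0 ≤ w)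
    (hr : δ ^ 2 - w ≤ r) (hQ : 8 * (θ * r) - C₁ * w ≤ Q)
    (h : P' * Q ≤ 2 * w * β - (2 * β + M' * (8 * θ + C₁)) ^ 2 / (8 * θ * m * δ ^ 2) * (w * w)) :
    False := by
  set B := 2 * β + M' * (8 * θ + C₁) with hB
  have hp : 0 < 8 * θ * m * δ ^ 2 := by positivity
  set p := 8 * θ * m * δ ^ 2 with hpdef
  have hP' : 0 < P' := by linarith
  have h1 : P' * (8 * (θ * (δ ^ 2 - w)) - C₁ * w) ≤ P' * Q := by
    refine mul_le_mul_of_nonneg_left (le_trans ?_ hQ) hP'.le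
    have := mul_le_mul_of_nonneg_left hr hθ.le
    linarith
  have h2 : p ≤ P' * (8 * θ * δ ^ 2) := by
    have : m * (8 * θ * δ ^ 2) ≤ P' * (8 * θ * δ ^ 2) :=
      mul_le_mul_of_nonneg_right hP1 (by positivity)
    rw [hpdef]; linarith
  have h3 : P' * ((8 * θ + C₁) * w) ≤ M' * ((8 * θ + C₁) * w) :=
    mul_le_mul_of_nonneg_right hP2 (by positivity)
  -- Near the edge of the ball the constant `p` from the gradient term dominates, further inside the
  -- quadratic term from the time decay; the coefficient `B² / p` makes the quadratic positive for
  -- every `w`.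
  have h4 : p - B * w + B ^ 2 / p * (w * w) ≤ 0 := by
    rw [hB] at *
    linarith
  have h5 : p * (p - B * w + B ^ 2 / p * (w * w)) = p ^ 2 - p * (B * w) + (B * w) ^ 2 := by
    field_simp
  have h6 : p * (p - B * w + B ^ 2 / p * (w * w)) ≤ 0 := mul_nonpos_of_nonneg_of_nonpos hp.le h4
  rw [h5] at h6
  nlinarith [sq_nonneg (p - B * w), sq_nonneg (p + B * w), sq_nonneg (B * w)]

namespace LocalFlow

variable {Φ : ℝ → ℝ} {Ω : Set (ℝ × Coord n)} {F N : ℝ × Coord n → Ambient n}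
  (hf : LocalFlow Φ Ω F N)
include hf

/-- Positivity of the principal curvatures spreads instantly inside a coordinate ball. -/
lemma propagation (hΦ : ContDiffOn ℝ ∞ Φ (Ioi 0)) (hΦ_pos : ∀ x, 0 < x → 0 < Φ x)
    (hΦ_deriv_pos : ∀ x, 0 < x → 0 < deriv Φ x)
    (hΦ_deriv2_pos : ∀ x, 0 < x → 0 < deriv (deriv Φ) x)
    (hconv : ∀ z ∈ Ω, AtLeast (spatial F z) (spatial N z) 0)
    {t₀ t₁ R : ℝ} {c : Coord n} (ht : t₀ < t₁) (hR : 0 < R)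
    (hsub : Icc t₀ t₁ ×ˢ Metric.closedBall c R ⊆ Ω)
    (hpos : Above (spatial F (t₀, c)) (spatial N (t₀, c)) 0)
    {x : Coord n} (hx : x ∈ Metric.ball c R) :
    Above (spatial F (t₁, x)) (spatial N (t₁, x)) 0 := by
  set S := Icc t₀ t₁ ×ˢ Metric.closedBall c R with hSdef
  have hS : IsCompact S := isCompact_Icc.prod (isCompact_closedBall c R)
  have hAc : ContinuousOn (spatial F) Ω := (hf.contDiffOn_spatial hf.smooth).continuousOn
  have hNc : ContinuousOn (spatial N) Ω := (hf.contDiffOn_spatial hf.smooth_normal).continuousOn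
  have hHc : ContinuousOn (curv F N) Ω := hf.contDiffOn_curv.continuousOn
  have hz0 : (t₀, c) ∈ Ω := hsub ⟨left_mem_Icc.mpr ht.le, Metric.mem_closedBall_self hR.le⟩
  -- a small initial ball with a uniform lower bound
  obtain ⟨m₀, hm₀, δ, hδ, hδR, hinit⟩ : ∃ m₀ > 0, ∃ δ > 0, δ < R ∧ ∀ y ∈ Metric.closedBall c δ,
      Above (spatial F (t₀, y)) (spatial N (t₀, y)) m₀ := by
    have hcA := hAc.continuousAt (hf.isOpen.mem_nhds hz0)
    have hcN := hNc.continuousAt (hf.isOpen.mem_nhds hz0)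
    have h1 : ContinuousAt (fun y : ℝ × Coord n => (t₀, y.2)) (0, c) := by fun_prop
    have h2 : ContinuousAt (fun y : ℝ × Coord n =>
        (spatial F (t₀, y.2), spatial N (t₀, y.2), y.1)) (0, c) :=
      (ContinuousAt.comp (g := spatial F) (f := fun y : ℝ × Coord n => (t₀, y.2)) hcA h1).prodMk
        ((ContinuousAt.comp (g := spatial N) (f := fun y : ℝ × Coord n => (t₀, y.2)) hcN h1).prodMk
          continuousAt_fst)
    have h3 := h2.eventually (isOpen_above.mem_nhds hpos)
    obtain ⟨r, hr, hball⟩ := Metric.eventually_nhds_iff.mp h3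
    refine ⟨r / 2, by positivity, min (r / 2) (R / 2), by positivity,
      (min_le_right _ _).trans_lt (by linarith), fun y hy => ?_⟩
    refine hball (y := (r / 2, y)) ?_
    rw [Prod.dist_eq]
    refine max_lt ?_ ?_
    · simp only [Real.dist_eq, sub_zero]
      rw [abs_of_pos (by positivity)]; linarith
    · have := (Metric.mem_closedBall.mp hy).trans (min_le_left _ _)
      simp only
      linarith
  -- uniform bounds
  obtain ⟨a, ha, hAlow⟩ := exists_lower_bound_on_compact hS (hAc.mono hsub)
    fun z hz => hf.immersion z (hsub hz)
  obtain ⟨M₁, hM₁, hAup⟩ := exists_norm_bound_on_compact hS (hAc.mono hsub)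
  have hF1 : ContDiffOn ℝ ∞ (fderiv ℝ F) Ω := hf.smooth.fderiv_of_isOpen hf.isOpen (by simp)
  have hF2 : ContDiffOn ℝ ∞ (fderiv ℝ (fderiv ℝ F)) Ω := hF1.fderiv_of_isOpen hf.isOpen (by simp)
  obtain ⟨M₂, hM₂, hD2⟩ := exists_norm_bound_on_compact hS (hF2.continuousOn.mono hsub)
  have hΦ'c : ContinuousOn (fun z => deriv Φ (curv F N z)) S :=
    ((contDiffOn_deriv_pos hΦ).continuousOn.comp hHc hf.curv_pos).mono hsub
  obtain ⟨m, hm, M', hM', hΦ'b⟩ := exists_pos_bounds_on_compact hS hΦ'c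
    fun z hz => hΦ_deriv_pos _ (hf.curv_pos z (hsub hz))
  -- The radius grows from `δ` at time `t₀` to `R` at time `t₁`.
  set β := (R ^ 2 - δ ^ 2) / (t₁ - t₀) with hβ
  have hβ0 : 0 < β := div_pos (by nlinarith) (by linarith)
  have hβt : β * (t₁ - t₀) = R ^ 2 - δ ^ 2 := div_mul_cancel₀ _ (by linarith)
  -- `θ` is the ellipticity constant of the Laplacian, and `C₁ w` bounds the second derivatives of
  -- `w` and the drift.
  set θ := (M₁ ^ 2)⁻¹ with hθ
  have hθ0 : 0 < θ := by positivity
  set C₁ := 4 * (n * (a⁻¹ ^ 2 + R * (a⁻¹ * (M₂ * a⁻¹ ^ 2)))) with hC₁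
  have hC₁0 : 0 ≤ C₁ := by positivity
  -- At time `t₀` one has `w ≤ δ²`, so this makes the barrier lie below `m₀` initially.
  set ε := m₀ / δ ^ 4 with hε
  have hε0 : 0 < ε := by positivity
  set K := (2 * β + M' * (8 * θ + C₁)) ^ 2 / (8 * θ * m * δ ^ 2) with hK
  let w := ballFn c t₀ δ β
  have hwdef : ∀ z, w z = δ ^ 2 + β * (z.1 - t₀) - ‖z.2 - c‖ ^ 2 := fun z => by
    rw [← real_inner_self_eq_norm_sq]; rfl
  have hwc : Continuous w := (contDiff_ballFn c t₀ δ β).continuous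
  -- Subtracting `η` makes the barrier negative where `w = 0`, so weak convexity excludes a first
  -- contact there.
  have key : ∀ η > 0, ∀ z ∈ S, 0 ≤ w z →
      Above (spatial F z) (spatial N z) (barrier c t₀ δ β ε K η z) := by
    intro η hη
    set φ := barrier c t₀ δ β ε K η with hφ
    have hφdef : ∀ z, φ z = ε * Real.exp (-K * (z.1 - t₀)) * (w z * w z) - η := fun z => rfl
    have hφs : ContDiff ℝ ∞ φ := contDiff_barrier c t₀ δ β ε K η
    by_contra! hcon
    have hGc : ContinuousOn (fun z => (spatial F z, spatial N z, φ z)) Ω :=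
      hAc.prodMk (hNc.prodMk hφs.continuous.continuousOn)
    have hDc : IsCompact ((S ∩ (fun z => (spatial F z, spatial N z, φ z)) ⁻¹'
        {x | Above x.1 x.2.1 x.2.2}ᶜ) ∩ w ⁻¹' Ici 0) := by
      refine IsCompact.inter_right ?_ (isClosed_Ici.preimage hwc)
      exact hS.of_isClosed_subset ((hGc.mono hsub).preimage_isClosed_of_isClosed hS.isClosed
        isOpen_above.isClosed_compl) inter_subset_left
    obtain ⟨z1, hz1S, hz1w, hz1⟩ := hcon
    obtain ⟨z, ⟨⟨hzS, hznA⟩, hzw⟩, hzmin⟩ :=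
      hDc.exists_isMinOn ⟨z1, ⟨hz1S, hz1⟩, hz1w⟩ continuous_fst.continuousOn
    replace hznA : ¬ Above (spatial F z) (spatial N z) (φ z) := hznA
    replace hzw : 0 ≤ w z := hzw
    have hzΩ := hsub hzS
    have hztime : t₀ < z.1 := by
      refine lt_of_le_of_ne hzS.1.1 fun h0 => hznA ?_
      have hw1 : w z = δ ^ 2 - ‖z.2 - c‖ ^ 2 := by rw [hwdef, ← h0]; ring
      have hball : z.2 ∈ Metric.closedBall c δ := by
        rw [mem_closedBall_iff_norm]
        exact (sq_le_sq₀ (norm_nonneg _) hδ.le).mp (by linarith)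
      have h1 := hinit z.2 hball
      rw [h0, Prod.mk.eta] at h1
      refine h1.mono ?_
      have h2 : w z ≤ δ ^ 2 := by rw [hw1]; linarith [sq_nonneg ‖z.2 - c‖]
      have h3 : w z * w z ≤ δ ^ 4 := by
        calc w z * w z ≤ δ ^ 2 * δ ^ 2 := mul_le_mul h2 h2 hzw (sq_nonneg δ)
          _ = δ ^ 4 := by ring
      rw [hφdef, ← h0, sub_self, mul_zero, Real.exp_zero, mul_one]
      have h4 : ε * (w z * w z) ≤ ε * δ ^ 4 := mul_le_mul_of_nonneg_left h3 hε0.le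
      have h5 : ε * δ ^ 4 = m₀ := div_mul_cancel₀ _ (by positivity)
      linarith
    have hwpos : 0 < w z := by
      refine lt_of_le_of_ne hzw fun h0 => hznA ?_
      refine (hconv z hzΩ).above (hf.immersion z hzΩ) ?_
      rw [hφdef, ← h0]
      linarith
    -- By the choice of the earliest failure, the barrier is a strict lower bound at earlier times.
    -- Points with `w > 0` stay in the ball of radius `R`, so they belong to the compact set under
    -- consideration.
    have hev : ∀ᶠ y in 𝓝 z, y.1 < z.1 →
        (spatial F y, spatial N y, φ y) ∈ {x : (Coord n →L[ℝ] Ambient n) ×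
          (Coord n →L[ℝ] Ambient n) × ℝ | AtLeast x.1 x.2.1 x.2.2} := by
      filter_upwards [hwc.continuousAt.eventually (lt_mem_nhds hwpos),
        continuous_fst.continuousAt.eventually (lt_mem_nhds hztime)] with y hyw hyt hlt
      by_contra hyn
      have hyR : ‖y.2 - c‖ ^ 2 ≤ R ^ 2 := by
        rw [hwdef] at hyw
        have : β * (y.1 - t₀) ≤ β * (t₁ - t₀) :=
          mul_le_mul_of_nonneg_left (by linarith [hzS.1.2]) hβ0.le
        linarith
      have hyS : y ∈ S := by
        refine ⟨⟨hyt.le, hlt.le.trans hzS.1.2⟩, ?_⟩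
        rw [mem_closedBall_iff_norm]
        exact (sq_le_sq₀ (norm_nonneg _) hR.le).mp hyR
      have := hzmin (show y ∈ _ from ⟨⟨hyS, fun h : Above _ _ _ => hyn h.atLeast⟩, hyw.le⟩)
      exact absurd hlt (not_lt.mpr this)
    have hev' := eventually_le_of_eventually_lt isClosed_atLeast
      (by filter_upwards [hf.isOpen.mem_nhds hzΩ] with y hy
          using hGc.continuousAt (hf.isOpen.mem_nhds hy)) hev
    have hzat : AtLeast (spatial F z) (spatial N z) (φ z) := hev'.self_of_nhds le_rfl
    obtain ⟨u, hu, heq⟩ := exists_of_not_above hznA hzat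
    have hgu := inner_self_map_pos (hf.immersion z hzΩ) hu
    -- At contact the barrier equals a principal curvature, which is nonnegative by weak convexity.
    have hφ0 : 0 ≤ φ z := by
      have h1 := hconv z hzΩ u
      rw [zero_mul, heq] at h1
      exact nonneg_of_mul_nonneg_left h1 hgu
    obtain ⟨L, d, hL, hd, hineq, hQ⟩ := hf.touching hΦ hΦ_deriv_pos hΦ_deriv2_pos hzΩ
      hφs.contDiffOn hev' hu heq
    have hLb : ∀ k : Fin n, ‖L (basisVec k)‖ ≤ a⁻¹ := by
      intro k
      have h1 := hAlow z hzS (L (basisVec k))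
      have h2 : ‖spatial F z (L (basisVec k))‖ = 1 := by
        have := hL (basisVec k) (basisVec k)
        rw [inner_basisVec, real_inner_self_eq_norm_sq] at this
        have h3 : ‖spatial F z (L (basisVec k))‖ ^ 2 = 1 := by
          rw [this]; simp [basisVec]
        exact (pow_eq_one_iff_of_nonneg (norm_nonneg _) two_ne_zero).mp h3
      rw [h2] at h1
      rw [← one_div, le_div_iff₀ ha]
      linarith
    have hdb : ∀ k : Fin n, ‖d (basisVec k)‖ ≤ a⁻¹ * (M₂ * a⁻¹ ^ 2) := by
      intro k
      set e := L (basisVec k) with he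
      set v := spatial F z (d (basisVec k)) with hv
      have h1 : ‖pd (0, e) (pd (0, e) F) z‖ ≤ M₂ * a⁻¹ ^ 2 := by
        rw [pd_pd_eq hf.isOpen hf.smooth hzΩ]
        have hn0 : ‖((0, e) : ℝ × Coord n)‖ = ‖e‖ := by simp [Prod.norm_def]
        have h2 := (fderiv ℝ (fderiv ℝ F) z).le_opNorm₂ (0, e) (0, e)
        rw [hn0] at h2
        refine h2.trans ?_
        rw [mul_assoc, ← sq]
        exact mul_le_mul (hD2 z hzS) (pow_le_pow_left₀ (norm_nonneg _) (hLb k) 2)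
          (sq_nonneg _) hM₂.le
      have h3 : ‖v‖ ≤ M₂ * a⁻¹ ^ 2 := by
        have h4 := hd (basisVec k) (d (basisVec k))
        rw [real_inner_self_eq_norm_sq] at h4
        have h5 := abs_real_inner_le_norm (pd (0, e) (pd (0, e) F) z) v
        have h6 : ‖v‖ * ‖v‖ ≤ (M₂ * a⁻¹ ^ 2) * ‖v‖ := by
          calc ‖v‖ * ‖v‖ = -inner ℝ (pd (0, e) (pd (0, e) F) z) v := by rw [← h4]; ring
            _ ≤ |inner ℝ (pd (0, e) (pd (0, e) F) z) v| := neg_le_abs _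
            _ ≤ _ := h5
            _ ≤ _ := mul_le_mul_of_nonneg_right h1 (norm_nonneg _)
        rcases (norm_nonneg v).eq_or_lt with h0 | h0
        · rw [← h0]; positivity
        · exact le_of_mul_le_mul_right h6 h0
      have h7 := (hAlow z hzS (d (basisVec k))).trans h3
      rw [inv_mul_eq_div, le_div_iff₀ ha]
      linarith
    have hSum : ∑ k, (pd (0, L (basisVec k)) (pd (0, L (basisVec k)) φ) z
          + pd (0, d (basisVec k)) φ z)
        = ε * Real.exp (-K * (z.1 - t₀)) * ∑ k, (8 * inner ℝ (z.2 - c) (L (basisVec k)) ^ 2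
          - 4 * w z * (‖L (basisVec k)‖ ^ 2 + inner ℝ (z.2 - c) (d (basisVec k)))) := by
      rw [Finset.mul_sum]
      refine Finset.sum_congr rfl fun k _ => ?_
      rw [hφ, pd_pd_barrier, pd_barrier, pd_pd_ballFn, pd_ballFn, pd_ballFn,
        real_inner_self_eq_norm_sq]
      change _ * (2 * _ ^ 2 + 2 * w z * _) + _ * (2 * w z * _ - _) = _
      ring
    have hTime : pd (1, 0) φ z = ε * Real.exp (-K * (z.1 - t₀)) *
        (2 * w z * β - K * (w z * w z)) := by
      rw [hφ, pd_barrier, pd_ballFn]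
      change _ * (2 * w z * (β * 1 - 2 * inner ℝ (z.2 - c) 0) - K * 1 * (w z * w z)) = _
      rw [inner_zero_right]
      ring
    have hE : 0 < ε * Real.exp (-K * (z.1 - t₀)) := by positivity
    have hH := hf.curv_pos z hzΩ
    rw [hSum, hTime] at hineq
    set QQ := ∑ k, (8 * (inner ℝ (z.2 - c) (L (basisVec k)) : ℝ) ^ 2
          - 4 * w z * (‖L (basisVec k)‖ ^ 2 + inner ℝ (z.2 - c) (d (basisVec k)))) with hQQ
    -- The reaction terms are nonnegative when `φ ≥ 0`, because `Hφ ≤ |A|²`. After division by the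
    -- exponential factor a pure heat-type inequality for `w` remains.
    have hmain : deriv Φ (curv F N z) * QQ ≤ 2 * w z * β - K * (w z * w z) := by
      have h1 : 0 ≤ deriv Φ (curv F N z) *
          ((shape (spatial F z) (spatial N z) * shape (spatial F z) (spatial N z)).trace * φ z
            - curv F N z * φ z ^ 2) := by
        refine mul_nonneg (hΦ_deriv_pos _ hH).le ?_
        have := mul_le_mul_of_nonneg_right (hQ hφ0) hφ0
        linarith
      have h2 : 0 ≤ Φ (curv F N z) * φ z ^ 2 := mul_nonneg (hΦ_pos _ hH).le (sq_nonneg _)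
      refine le_of_mul_le_mul_left ?_ hE
      linarith
    have hyR : ‖z.2 - c‖ ≤ R := mem_closedBall_iff_norm.mp hzS.2
    have hQQb : 8 * (θ * ‖z.2 - c‖ ^ 2) - C₁ * w z ≤ QQ := by
      have h1 := norm_sq_le_of_isometric hL (hAup z hzS) (z.2 - c)
      have h2 : θ * ‖z.2 - c‖ ^ 2 ≤ ∑ k, (inner ℝ (z.2 - c) (L (basisVec k)) : ℝ) ^ 2 := by
        rw [hθ, inv_mul_le_iff₀ (by positivity)]
        exact h1
      have h3 : ∑ k : Fin n, (‖L (basisVec k)‖ ^ 2 + inner ℝ (z.2 - c) (d (basisVec k)))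
          ≤ n * (a⁻¹ ^ 2 + R * (a⁻¹ * (M₂ * a⁻¹ ^ 2))) := by
        calc ∑ k : Fin n, (‖L (basisVec k)‖ ^ 2 + inner ℝ (z.2 - c) (d (basisVec k)))
            ≤ ∑ _k : Fin n, (a⁻¹ ^ 2 + R * (a⁻¹ * (M₂ * a⁻¹ ^ 2))) := by
              refine Finset.sum_le_sum fun k _ => add_le_add
                (pow_le_pow_left₀ (norm_nonneg _) (hLb k) 2) ?_
              exact (real_inner_le_norm _ _).trans
                (mul_le_mul hyR (hdb k) (norm_nonneg _) hR.le)
          _ = _ := by rw [Finset.sum_const, Finset.card_univ, Fintype.card_fin, nsmul_eq_mul]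
      have h4 : QQ = 8 * ∑ k, (inner ℝ (z.2 - c) (L (basisVec k)) : ℝ) ^ 2
          - 4 * w z * ∑ k : Fin n,
            (‖L (basisVec k)‖ ^ 2 + inner ℝ (z.2 - c) (d (basisVec k))) := by
        rw [hQQ, Finset.sum_sub_distrib, ← Finset.mul_sum, ← Finset.mul_sum]
      have h5 := mul_le_mul_of_nonneg_left h3 hzw
      rw [h4, hC₁]
      linarith
    refine barrier_inequality_false (P' := deriv Φ (curv F N z)) hm (hΦ'b z hzS).1 (hΦ'b z hzS).2
      hθ0 hC₁0 hδ hzw ?_ hQQb hmain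
    rw [hwdef]
    have := mul_nonneg hβ0.le (sub_nonneg.mpr hztime.le)
    linarith
  have hwx : 0 < w (t₁, x) := by
    rw [hwdef]
    have h1 : ‖x - c‖ < R := mem_ball_iff_norm.mp hx
    have h2 : ‖x - c‖ ^ 2 < R ^ 2 := pow_lt_pow_left₀ h1 (norm_nonneg _) two_ne_zero
    simp only
    linarith
  -- Half of the main term of the barrier at `(t₁, x)`, so its value there stays positive.
  set η := ε * Real.exp (-K * (t₁ - t₀)) * (w (t₁, x) * w (t₁, x)) / 2 with hη
  have hη0 : 0 < η := by positivity
  refine (key η hη0 (t₁, x) ⟨right_mem_Icc.mpr ht.le, Metric.ball_subset_closedBall hx⟩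
    hwx.le).mono ?_
  have : barrier c t₀ δ β ε K η (t₁, x)
      = ε * Real.exp (-K * (t₁ - t₀)) * (w (t₁, x) * w (t₁, x)) - η := rfl
  rw [this]
  linarith

end LocalFlow

end Propagation

/-! ### Symmetry of the second fundamental form on a time slice -/

section Slice

variable {n : ℕ} {V : Type*} [NormedAddCommGroup V] [NormedSpace ℝ V] {U : Set V}
  {f ν : V → Ambient n}

lemma second_form_slice (hU : IsOpen U) (hf : ContDiffOn ℝ ∞ f U) (hν : ContDiffOn ℝ ∞ ν U)
    (horth : ∀ x ∈ U, ∀ v, (inner ℝ (ν x) (pd v f x) : ℝ) = 0) {x : V} (hx : x ∈ U) (v w : V) :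
    (inner ℝ (pd v ν x) (pd w f x) : ℝ) = -inner ℝ (ν x) (pd v (pd w f) x) := by
  have h : EqOn (fun z => (inner ℝ (ν z) (pd w f z) : ℝ)) (fun _ => 0) U :=
    fun y hy => horth y hy w
  have h1 := pd_congr hU h v hx
  rw [pd_inner hU hν (ContDiffOn.pd hU hf _) v hx, pd_const] at h1
  simp only at h1
  linarith

lemma second_form_slice_symm (hU : IsOpen U) (hf : ContDiffOn ℝ ∞ f U)
    (hν : ContDiffOn ℝ ∞ ν U)
    (horth : ∀ x ∈ U, ∀ v, (inner ℝ (ν x) (pd v f x) : ℝ) = 0) {x : V} (hx : x ∈ U) (v w : V) :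
    (inner ℝ (pd v ν x) (pd w f x) : ℝ) = inner ℝ (pd w ν x) (pd v f x) := by
  rw [second_form_slice hU hf hν horth hx, second_form_slice hU hf hν horth hx,
    pd_comm hU hf _ _ hx]

end Slice

/-! ### Passage between the manifold and its charts -/

section Charts

variable {n : ℕ} {M : Type*} [TopologicalSpace M] [ChartedSpace (EuclideanSpace ℝ (Fin n)) M]

/-- A time-dependent map in the preferred chart around `q`. -/
def chartRep (q : M) (Y : ℝ → M → Ambient n) (z : ℝ × Coord n) : Ambient n :=
  Y z.1 ((extChartAt (𝓡 n) q).symm z.2)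

/-- The differential of `F` at `p` in the preferred chart around `p`. -/
def coordDiff (F : M → Ambient n) (p : M) : Coord n →L[ℝ] Ambient n := differential F p

/-- The differential at `p` of the preferred chart around `q`. -/
def chartDiff (q p : M) : Coord n →L[ℝ] Coord n :=
  mfderiv (𝓡 n) 𝓘(ℝ, EuclideanSpace ℝ (Fin n)) (extChartAt (𝓡 n) q) p

lemma weingarten_eq_shape (X ν : M → Ambient n) (p : M) :
    weingarten X ν p = shape (coordDiff X p) (coordDiff ν p) := rfl

variable [IsManifold (𝓡 n) ∞ M] {T : ℝ} {Y : ℝ → M → Ambient n}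

lemma bijective_chartDiff {q p : M} (hp : p ∈ (extChartAt (𝓡 n) q).source) :
    Bijective (chartDiff (n := n) q p) := by
  have : IsManifold (𝓡 n) 1 M := IsManifold.of_le (n := ∞) (by simp)
  exact (isInvertible_mfderiv_extChartAt (I := 𝓡 n) hp).bijective

lemma contDiffOn_chartRep
    (hY : ContMDiffOn (𝓘(ℝ, ℝ).prod (𝓡 n)) 𝓘(ℝ, Ambient n) ∞ (uncurry Y) (Ico 0 T ×ˢ univ))
    (q : M) : ContDiffOn ℝ ∞ (chartRep q Y) (Ico 0 T ×ˢ (extChartAt (𝓡 n) q).target) := by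
  rw [← contMDiffOn_iff_contDiffOn]
  have h1 : ContMDiffOn 𝓘(ℝ, ℝ × Coord n) 𝓘(ℝ, ℝ) ∞ (fun z : ℝ × Coord n => z.1)
      (Ico 0 T ×ˢ (extChartAt (𝓡 n) q).target) := contDiff_fst.contMDiff.contMDiffOn
  have h2 : ContMDiffOn 𝓘(ℝ, ℝ × Coord n) (𝓡 n) ∞
      (fun z : ℝ × Coord n => (extChartAt (𝓡 n) q).symm z.2)
      (Ico 0 T ×ˢ (extChartAt (𝓡 n) q).target) :=
    (contMDiffOn_extChartAt_symm q).comp contDiff_snd.contMDiff.contMDiffOn fun z hz => hz.2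
  exact hY.comp (h1.prodMk h2) fun z hz => ⟨hz.1, mem_univ _⟩

lemma contDiffOn_chartRep_slice
    (hY : ContMDiffOn (𝓘(ℝ, ℝ).prod (𝓡 n)) 𝓘(ℝ, Ambient n) ∞ (uncurry Y) (Ico 0 T ×ˢ univ))
    (q : M) {t : ℝ} (ht : t ∈ Ico 0 T) :
    ContDiffOn ℝ ∞ (fun y => chartRep q Y (t, y)) (extChartAt (𝓡 n) q).target :=
  (contDiffOn_chartRep hY q).comp (by fun_prop) fun y hy => ⟨ht, hy⟩

/-- At `t = 0` only one-sided smoothness is given. The spatial derivative is the restriction of the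
derivative within the domain to spatial vectors, and that one is continuous up to the initial time.
-/
lemma continuousOn_spatial_chartRep
    (hY : ContMDiffOn (𝓘(ℝ, ℝ).prod (𝓡 n)) 𝓘(ℝ, Ambient n) ∞ (uncurry Y) (Ico 0 T ×ˢ univ))
    (q : M) :
    ContinuousOn (spatial (chartRep q Y)) (Ico 0 T ×ˢ (extChartAt (𝓡 n) q).target) := by
  have hs := contDiffOn_chartRep hY q
  have hU := isOpen_extChartAt_target (I := 𝓡 n) q
  have hu : UniqueDiffOn ℝ (Ico 0 T ×ˢ (extChartAt (𝓡 n) q).target) :=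
    (uniqueDiffOn_Ico 0 T).prod hU.uniqueDiffOn
  have hc : ContinuousOn (fun z => (fderivWithin ℝ (chartRep q Y)
      (Ico 0 T ×ˢ (extChartAt (𝓡 n) q).target) z).comp (ContinuousLinearMap.inr ℝ ℝ (Coord n)))
      (Ico 0 T ×ˢ (extChartAt (𝓡 n) q).target) :=
    (hs.continuousOn_fderivWithin hu (by simp)).clm_comp continuousOn_const
  refine hc.congr fun z hz => ?_
  have h1 := ((hs.differentiableOn (by simp)) z hz).hasFDerivWithinAt
  have h2 : HasFDerivWithinAt (fun y : Coord n => (z.1, y))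
      (ContinuousLinearMap.inr ℝ ℝ (Coord n)) (extChartAt (𝓡 n) q).target z.2 :=
    (hasFDerivAt_prodMk_right _ _).hasFDerivWithinAt
  have h3 := HasFDerivWithinAt.comp z.2 (f := fun y : Coord n => (z.1, y)) h1 h2
    fun y hy => ⟨hz.1, hy⟩
  exact (h3.hasFDerivAt (hU.mem_nhds hz.2)).fderiv

/-- The definitions use the preferred chart of each point, which varies with the point. Expressing
all differentials in one fixed chart around `q` costs only composition with an invertible map. -/
lemma coordDiff_eq
    (hY : ContMDiffOn (𝓘(ℝ, ℝ).prod (𝓡 n)) 𝓘(ℝ, Ambient n) ∞ (uncurry Y) (Ico 0 T ×ˢ univ))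
    {q p : M} (hp : p ∈ (extChartAt (𝓡 n) q).source) {t : ℝ} (ht : t ∈ Ico 0 T) :
    coordDiff (Y t) p
      = spatial (chartRep q Y) (t, extChartAt (𝓡 n) q p) ∘L chartDiff q p := by
  have hpt : extChartAt (𝓡 n) q p ∈ (extChartAt (𝓡 n) q).target :=
    (extChartAt (𝓡 n) q).map_source hp
  have hd : DifferentiableAt ℝ (fun y => chartRep q Y (t, y)) (extChartAt (𝓡 n) q p) :=
    differentiableAt_of_contDiffOn (isOpen_extChartAt_target q)
      (contDiffOn_chartRep_slice hY q ht) hpt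
  have hp' : p ∈ (chartAt (EuclideanSpace ℝ (Fin n)) q).source := by
    rwa [extChartAt_source] at hp
  have he : MDifferentiableAt (𝓡 n) 𝓘(ℝ, EuclideanSpace ℝ (Fin n)) (extChartAt (𝓡 n) q) p :=
    (contMDiffAt_extChartAt' (n := ∞) hp').mdifferentiableAt (by simp)
  have hev : Y t =ᶠ[𝓝 p] (fun y => chartRep q Y (t, y)) ∘ extChartAt (𝓡 n) q := by
    filter_upwards [(isOpen_extChartAt_source (I := 𝓡 n) q).mem_nhds hp] with y hy
    simp only [chartRep, comp_apply]
    rw [(extChartAt (𝓡 n) q).left_inv hy]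
  have h1 : mfderiv (𝓡 n) 𝓘(ℝ, Ambient n) (Y t) p
      = (mfderiv 𝓘(ℝ, EuclideanSpace ℝ (Fin n)) 𝓘(ℝ, Ambient n)
          (fun y => chartRep q Y (t, y)) (extChartAt (𝓡 n) q p)).comp
        (mfderiv (𝓡 n) 𝓘(ℝ, EuclideanSpace ℝ (Fin n)) (extChartAt (𝓡 n) q) p) := by
    rw [hev.mfderiv_eq]
    exact mfderiv_comp p hd.mdifferentiableAt he
  rw [mfderiv_eq_fderiv] at h1
  exact h1

omit [IsManifold (𝓡 n) ∞ M] in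
lemma tendsto_chart {q p : M} (hp : p ∈ (extChartAt (𝓡 n) q).source) (t : ℝ) :
    Tendsto (fun z : ℝ × M => (z.1, extChartAt (𝓡 n) q z.2)) (𝓝[Ico 0 T ×ˢ univ] (t, p))
      (𝓝[Ico 0 T ×ˢ (extChartAt (𝓡 n) q).target] (t, extChartAt (𝓡 n) q p)) := by
  have hc : ContinuousAt (fun z : ℝ × M => (z.1, extChartAt (𝓡 n) q z.2)) (t, p) :=
    continuousAt_fst.prodMk
      (ContinuousAt.comp (g := extChartAt (𝓡 n) q) (continuousAt_extChartAt' hp) continuousAt_snd)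
  refine tendsto_nhdsWithin_iff.mpr ⟨hc.tendsto.mono_left nhdsWithin_le_nhds, ?_⟩
  have h2 : ∀ᶠ z in 𝓝 (t, p), z.2 ∈ (extChartAt (𝓡 n) q).source :=
    (continuousAt_snd (p := (t, p))).eventually
      ((isOpen_extChartAt_source (I := 𝓡 n) q).mem_nhds hp)
  filter_upwards [self_mem_nhdsWithin, h2.filter_mono nhdsWithin_le_nhds] with z hz hz2
  exact ⟨hz.1, (extChartAt (𝓡 n) q).map_source hz2⟩

end Charts

/-! ### Geometric quantities of a solution in charts -/

section Solution

variable {n : ℕ} {M : Type*} [TopologicalSpace M] [ChartedSpace (EuclideanSpace ℝ (Fin n)) M]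
  [IsManifold (𝓡 n) ∞ M] {Φ : ℝ → ℝ} {T : ℝ} {X ν : ℝ → M → Ambient n}

/-- The squared norm of the second fundamental form. -/
def normSqCurv (X ν : M → Ambient n) (p : M) : ℝ :=
  (weingarten X ν p * weingarten X ν p).trace

namespace IsSolution

variable (hs : IsSolution Φ T X ν)
include hs

lemma above_iff {q p : M} (hp : p ∈ (extChartAt (𝓡 n) q).source) {t : ℝ} (ht : t ∈ Ico 0 T)
    {m : ℝ} : Above (coordDiff (X t) p) (coordDiff (ν t) p) m
      ↔ Above (spatial (chartRep q X) (t, extChartAt (𝓡 n) q p))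
        (spatial (chartRep q ν) (t, extChartAt (𝓡 n) q p)) m := by
  rw [coordDiff_eq hs.smooth hp ht, coordDiff_eq hs.smooth_normal hp ht]
  exact above_comp (bijective_chartDiff hp)

lemma atLeast_iff {q p : M} (hp : p ∈ (extChartAt (𝓡 n) q).source) {t : ℝ} (ht : t ∈ Ico 0 T)
    {m : ℝ} : AtLeast (coordDiff (X t) p) (coordDiff (ν t) p) m
      ↔ AtLeast (spatial (chartRep q X) (t, extChartAt (𝓡 n) q p))
        (spatial (chartRep q ν) (t, extChartAt (𝓡 n) q p)) m := by
  rw [coordDiff_eq hs.smooth hp ht, coordDiff_eq hs.smooth_normal hp ht]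
  exact atLeast_comp (bijective_chartDiff hp)

lemma meanCurvature_eq {q p : M} (hp : p ∈ (extChartAt (𝓡 n) q).source) {t : ℝ}
    (ht : t ∈ Ico 0 T) : meanCurvature (X t) (ν t) p
      = curv (chartRep q X) (chartRep q ν) (t, extChartAt (𝓡 n) q p) := by
  rw [meanCurvature, weingarten_eq_shape, coordDiff_eq hs.smooth hp ht,
    coordDiff_eq hs.smooth_normal hp ht, trace_shape_comp _ _ (bijective_chartDiff hp).1, curv]

lemma normSqCurv_eq {q p : M} (hp : p ∈ (extChartAt (𝓡 n) q).source) {t : ℝ}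
    (ht : t ∈ Ico 0 T) : normSqCurv (X t) (ν t) p
      = (shape (spatial (chartRep q X) (t, extChartAt (𝓡 n) q p))
          (spatial (chartRep q ν) (t, extChartAt (𝓡 n) q p))
        * shape (spatial (chartRep q X) (t, extChartAt (𝓡 n) q p))
          (spatial (chartRep q ν) (t, extChartAt (𝓡 n) q p))).trace := by
  rw [normSqCurv, weingarten_eq_shape, coordDiff_eq hs.smooth hp ht,
    coordDiff_eq hs.smooth_normal hp ht, trace_shape_sq_comp _ _ (bijective_chartDiff hp).1]

omit [IsManifold (𝓡 n) ∞ M] in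
lemma injective_coordDiff {t : ℝ} (ht : t ∈ Ico 0 T) (p : M) : Injective (coordDiff (X t) p) :=
  hs.immersion t ht p

omit [IsManifold (𝓡 n) ∞ M] in
lemma orthogonal_coordDiff {t : ℝ} (ht : t ∈ Ico 0 T) (p : M) (v : Coord n) :
    (inner ℝ (ν t p) (coordDiff (X t) p v) : ℝ) = 0 :=
  hs.normal_orthogonal t ht p v

lemma injective_spatial (q : M) {z : ℝ × Coord n}
    (hz : z ∈ Ico 0 T ×ˢ (extChartAt (𝓡 n) q).target) :
    Injective (spatial (chartRep q X) z) := by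
  have hp := (extChartAt (𝓡 n) q).map_target hz.2
  have h1 := hs.injective_coordDiff hz.1 ((extChartAt (𝓡 n) q).symm z.2)
  rw [coordDiff_eq hs.smooth hp hz.1, (extChartAt (𝓡 n) q).right_inv hz.2] at h1
  intro v w hvw
  obtain ⟨v', rfl⟩ := (bijective_chartDiff hp).2 v
  obtain ⟨w', rfl⟩ := (bijective_chartDiff hp).2 w
  rw [h1 hvw]

lemma orthogonal_spatial (q : M) {z : ℝ × Coord n}
    (hz : z ∈ Ico 0 T ×ˢ (extChartAt (𝓡 n) q).target) (v : Coord n) :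
    (inner ℝ (chartRep q ν z) (spatial (chartRep q X) z v) : ℝ) = 0 := by
  have hp := (extChartAt (𝓡 n) q).map_target hz.2
  obtain ⟨v', rfl⟩ := (bijective_chartDiff hp).2 v
  have h1 := hs.orthogonal_coordDiff hz.1 ((extChartAt (𝓡 n) q).symm z.2) v'
  rw [coordDiff_eq hs.smooth hp hz.1, (extChartAt (𝓡 n) q).right_inv hz.2] at h1
  exact h1

lemma continuousOn_shape_chartRep (q : M) (i j : Fin n) :
    ContinuousOn (fun z => shape (spatial (chartRep q X) z) (spatial (chartRep q ν) z) i j)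
      (Ico 0 T ×ˢ (extChartAt (𝓡 n) q).target) := by
  refine ContDiffOn.continuousOn (𝕜 := ℝ) (n := 0) ?_
  exact contDiffOn_shape (contDiffOn_zero.mpr (continuousOn_spatial_chartRep hs.smooth q))
    (contDiffOn_zero.mpr (continuousOn_spatial_chartRep hs.smooth_normal q))
    (fun z hz => hs.injective_spatial q hz) i j

lemma continuousOn_curv_chartRep (q : M) :
    ContinuousOn (curv (chartRep q X) (chartRep q ν))
      (Ico 0 T ×ˢ (extChartAt (𝓡 n) q).target) := by
  rw [curv_eq_sum]
  exact continuousOn_finsetSum _ fun i _ => hs.continuousOn_shape_chartRep q i i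

omit hs [IsManifold (𝓡 n) ∞ M] in
lemma continuousOn_of_chart {f : ℝ × M → ℝ} {g : M → ℝ × Coord n → ℝ}
    (hg : ∀ q, ContinuousOn (g q) (Ico 0 T ×ˢ (extChartAt (𝓡 n) q).target))
    (heq : ∀ q p, p ∈ (extChartAt (𝓡 n) q).source → ∀ t ∈ Ico 0 T,
      f (t, p) = g q (t, extChartAt (𝓡 n) q p)) : ContinuousOn f (Ico 0 T ×ˢ univ) := by
  rintro ⟨t, q⟩ ⟨ht, -⟩
  have hq := mem_extChartAt_source (I := 𝓡 n) q
  have h1 := (hg q) (t, extChartAt (𝓡 n) q q) ⟨ht, (extChartAt (𝓡 n) q).map_source hq⟩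
  have h2 : ContinuousWithinAt (fun z : ℝ × M => g q (z.1, extChartAt (𝓡 n) q z.2))
      (Ico 0 T ×ˢ univ) (t, q) := Tendsto.comp h1 (tendsto_chart (T := T) hq t)
  refine h2.congr_of_eventuallyEq ?_ (heq q q hq t ht)
  have h3 : ∀ᶠ z in 𝓝 (t, q), z.2 ∈ (extChartAt (𝓡 n) q).source :=
    (continuousAt_snd (p := (t, q))).eventually
      ((isOpen_extChartAt_source (I := 𝓡 n) q).mem_nhds hq)
  filter_upwards [self_mem_nhdsWithin, h3.filter_mono nhdsWithin_le_nhds] with z hz hz2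
  exact heq q z.2 hz2 z.1 hz.1

lemma continuousOn_meanCurvature :
    ContinuousOn (fun z : ℝ × M => meanCurvature (X z.1) (ν z.1) z.2) (Ico 0 T ×ˢ univ) :=
  continuousOn_of_chart (fun q => hs.continuousOn_curv_chartRep q)
    fun _ _ hp _ ht => hs.meanCurvature_eq hp ht

lemma continuousOn_normSqCurv :
    ContinuousOn (fun z : ℝ × M => normSqCurv (X z.1) (ν z.1) z.2) (Ico 0 T ×ˢ univ) := by
  refine continuousOn_of_chart (g := fun q z =>
    (shape (spatial (chartRep q X) z) (spatial (chartRep q ν) z)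
      * shape (spatial (chartRep q X) z) (spatial (chartRep q ν) z)).trace) (fun q => ?_)
    fun _ _ hp _ ht => hs.normSqCurv_eq hp ht
  simp only [Matrix.trace, Matrix.diag_apply, Matrix.mul_apply]
  exact continuousOn_finsetSum _ fun i _ => continuousOn_finsetSum _ fun j _ =>
    (hs.continuousOn_shape_chartRep q i j).mul (hs.continuousOn_shape_chartRep q j i)

lemma eventually_above {m : ℝ → ℝ} (hm : Continuous m) {t : ℝ} (ht : t ∈ Ico 0 T) {p : M}
    (h : Above (coordDiff (X t) p) (coordDiff (ν t) p) (m t)) :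
    ∀ᶠ z in 𝓝[Ico 0 T ×ˢ univ] (t, p),
      Above (coordDiff (X z.1) z.2) (coordDiff (ν z.1) z.2) (m z.1) := by
  have hp := mem_extChartAt_source (I := 𝓡 n) p
  have hpt := (extChartAt (𝓡 n) p).map_source hp
  have h1 : ContinuousWithinAt (fun z : ℝ × Coord n =>
      (spatial (chartRep p X) z, spatial (chartRep p ν) z, m z.1))
      (Ico 0 T ×ˢ (extChartAt (𝓡 n) p).target) (t, extChartAt (𝓡 n) p p) :=
    (continuousOn_spatial_chartRep hs.smooth p _ ⟨ht, hpt⟩).prodMk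
      ((continuousOn_spatial_chartRep hs.smooth_normal p _ ⟨ht, hpt⟩).prodMk
        (hm.comp continuous_fst).continuousWithinAt)
  have h2 := (Tendsto.comp h1 (tendsto_chart (T := T) hp t)).eventually
    (isOpen_above.mem_nhds ((hs.above_iff hp ht).mp h))
  have h3 : ∀ᶠ z in 𝓝 (t, p), z.2 ∈ (extChartAt (𝓡 n) p).source :=
    (continuousAt_snd (p := (t, p))).eventually
      ((isOpen_extChartAt_source (I := 𝓡 n) p).mem_nhds hp)
  filter_upwards [self_mem_nhdsWithin, h2, h3.filter_mono nhdsWithin_le_nhds] with z hz hz2 hz3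
  exact (hs.above_iff hz3 hz.1).mpr hz2

/-- Times are restricted to the open interval, where the one-sided time derivative is a genuine one.
Positivity of `H` is required only on `Ω`, so the result is available before that positivity is
known globally. -/
lemma localFlow (q : M) {Ω : Set (ℝ × Coord n)} (hΩ : IsOpen Ω)
    (hsub : Ω ⊆ Ioo 0 T ×ˢ (extChartAt (𝓡 n) q).target)
    (hpos : ∀ z ∈ Ω, 0 < curv (chartRep q X) (chartRep q ν) z) :
    LocalFlow Φ Ω (chartRep q X) (chartRep q ν) := by
  have hsub' : Ω ⊆ Ico 0 T ×ˢ (extChartAt (𝓡 n) q).target :=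
    hsub.trans (prod_mono Ioo_subset_Ico_self le_rfl)
  have hF := (contDiffOn_chartRep hs.smooth q).mono hsub'
  refine ⟨hΩ, hF, (contDiffOn_chartRep hs.smooth_normal q).mono hsub',
    fun z hz => hs.injective_spatial q (hsub' hz),
    fun z hz => hs.norm_normal _ (hsub' hz).1 _,
    fun z hz v => hs.orthogonal_spatial q (hsub' hz) v, hpos, fun z hz => ?_⟩
  have hp := (extChartAt (𝓡 n) q).map_target (hsub' hz).2
  have h1 := (hs.evolution z.1 (hsub' hz).1 ((extChartAt (𝓡 n) q).symm z.2)).hasDerivAt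
    (Ico_mem_nhds (hsub hz).1.1 (hsub hz).1.2)
  rw [hs.meanCurvature_eq hp (hsub' hz).1, (extChartAt (𝓡 n) q).right_inv (hsub' hz).2] at h1
  have hline : HasDerivAt (fun s : ℝ => (s, z.2)) ((1 : ℝ), (0 : Coord n)) z.1 :=
    (hasDerivAt_id z.1).prodMk (hasDerivAt_const z.1 z.2)
  have h2 := HasFDerivAt.comp_hasDerivAt (f := fun s : ℝ => (s, z.2)) z.1
    (differentiableAt_of_contDiffOn hΩ hF hz).hasFDerivAt hline
  exact h2.unique h1

/-- Needed also at `t = 0`, where no open space-time neighbourhood is available; hence the argument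
on a single slice. -/
lemma symm_coordDiff {t : ℝ} (ht : t ∈ Ico 0 T) (p : M) (v w : Coord n) :
    (inner ℝ (coordDiff (ν t) p v) (coordDiff (X t) p w) : ℝ)
      = inner ℝ (coordDiff (ν t) p w) (coordDiff (X t) p v) := by
  have hp := mem_extChartAt_source (I := 𝓡 n) p
  rw [coordDiff_eq hs.smooth hp ht, coordDiff_eq hs.smooth_normal hp ht]
  exact second_form_slice_symm (isOpen_extChartAt_target p)
    (contDiffOn_chartRep_slice hs.smooth p ht) (contDiffOn_chartRep_slice hs.smooth_normal p ht)
    (fun x hx v => hs.orthogonal_spatial p (z := (t, x)) ⟨ht, hx⟩ v)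
    ((extChartAt (𝓡 n) p).map_source hp) _ _

/-- A point at which the distance to the origin is locally maximal is strictly convex. -/
lemma above_of_isLocalMax {t : ℝ} (ht : t ∈ Ico 0 T) {p : M}
    (hconv : AtLeast (coordDiff (X t) p) (coordDiff (ν t) p) 0)
    (hmax : IsLocalMax (fun y => ‖X t y‖) p) :
    Above (coordDiff (X t) p) (coordDiff (ν t) p) 0 := by
  have hp := mem_extChartAt_source (I := 𝓡 n) p
  set x := extChartAt (𝓡 n) p p with hx
  have hxt : x ∈ (extChartAt (𝓡 n) p).target := (extChartAt (𝓡 n) p).map_source hp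
  have hU := isOpen_extChartAt_target (I := 𝓡 n) p
  set f : Coord n → Ambient n := fun y => chartRep p X (t, y) with hfdef
  set N : Coord n → Ambient n := fun y => chartRep p ν (t, y) with hNdef
  have hf : ContDiffOn ℝ ∞ f (extChartAt (𝓡 n) p).target :=
    contDiffOn_chartRep_slice hs.smooth p ht
  have hN : ContDiffOn ℝ ∞ N (extChartAt (𝓡 n) p).target :=
    contDiffOn_chartRep_slice hs.smooth_normal p ht
  have horth : ∀ y ∈ (extChartAt (𝓡 n) p).target, ∀ v, (inner ℝ (N y) (pd v f y) : ℝ) = 0 :=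
    fun y hy v => hs.orthogonal_spatial p (z := (t, y)) ⟨ht, hy⟩ v
  rw [hs.above_iff hp ht]
  rw [hs.atLeast_iff hp ht] at hconv
  have hinj := hs.injective_spatial p (z := (t, x)) ⟨ht, hxt⟩
  have hff : ContDiffOn ℝ ∞ (fun y => -(inner ℝ (f y) (f y) : ℝ)) (extChartAt (𝓡 n) p).target :=
    (hf.inner ℝ hf).neg
  have hcrit : ∀ v, pd v (fun y => -(inner ℝ (f y) (f y) : ℝ)) x = 0 ∧
      0 ≤ pd v (pd v fun y => -(inner ℝ (f y) (f y) : ℝ)) x := by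
    intro v
    refine pd_pd_nonneg_of_isLocalMin hU hff hxt v ?_
    have hc1 : ContinuousAt (fun s : ℝ => x + s • v) 0 := by fun_prop
    have hc2 : ContinuousAt (extChartAt (𝓡 n) p).symm x := continuousAt_extChartAt_symm p
    have hc : Tendsto (fun s : ℝ => (extChartAt (𝓡 n) p).symm (x + s • v)) (𝓝 0) (𝓝 p) := by
      have h1 : Tendsto (fun s : ℝ => x + s • v) (𝓝 0) (𝓝 x) := by
        simpa using hc1.tendsto
      have h2 := hc2.tendsto.comp h1
      rwa [hx, extChartAt_to_inv] at h2
    filter_upwards [hc.eventually hmax] with s hs'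
    have h3 : f (x + (0 : ℝ) • v) = X t p := by
      simp [hfdef, chartRep, hx]
    simp only [h3]
    rw [real_inner_self_eq_norm_sq, real_inner_self_eq_norm_sq]
    have h4 : ‖f (x + s • v)‖ ≤ ‖X t p‖ := hs'
    have h5 := pow_le_pow_left₀ (norm_nonneg _) h4 2
    linarith
  have hgrad : ∀ v, (inner ℝ (f x) (pd v f x) : ℝ) = 0 := by
    intro v
    have h1 := (hcrit v).1
    rw [pd_neg] at h1
    simp only at h1
    rw [pd_inner hU hf hf v hxt] at h1
    simp only at h1
    rw [real_inner_comm] at h1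
    linarith
  -- At a critical point of the distance the position vector is a multiple of the normal, of
  -- undetermined sign. Therefore the second order condition only excludes `h(v,v) = 0`, and weak
  -- convexity supplies the sign.
  have hfN := eq_smul_of_orthogonal hinj (hs.norm_normal t ht _)
    (fun v => hs.orthogonal_spatial p (z := (t, x)) ⟨ht, hxt⟩ v) (x := f x) hgrad
  intro v hv
  have h0 : (0 : ℝ) ≤ inner ℝ (pd v N x) (pd v f x) := by
    have := hconv v
    rwa [zero_mul] at this
  have h1 := (hcrit v).2
  rw [pd_neg, pd_neg] at h1
  simp only at h1
  rw [pd_pd_inner hU hf hf v v hxt] at h1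
  simp only at h1
  have h2 := second_form_slice hU hf hN horth hxt v v
  have h3 : (0 : ℝ) < inner ℝ (pd v f x) (pd v f x) := inner_self_map_pos hinj hv
  change 0 * inner ℝ (pd v f x) (pd v f x) < (inner ℝ (pd v N x) (pd v f x) : ℝ)
  rw [zero_mul]
  refine lt_of_le_of_ne h0 fun h4 => ?_
  rw [← h4] at h2
  have h5 : (inner ℝ (f x) (pd v (pd v f) x) : ℝ) = 0 := by
    rw [hfN, inner_smul_left]
    have : (inner ℝ (N x) (pd v (pd v f) x) : ℝ) = 0 := by linarith
    rw [show ν t ((extChartAt (𝓡 n) p).symm (t, x).2) = N x from rfl, this, mul_zero]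
  rw [real_inner_comm, h5] at h1
  linarith

end IsSolution

end Solution

/-- The failure set of a relatively open condition on a compact space-time set is compact, so a
first time of failure exists. -/
lemma isCompact_setOf_not {α : Type*} [TopologicalSpace α] {K : Set α} (hK : IsCompact K)
    (hc : IsClosed K) {P : α → Prop} (h : ∀ z ∈ K, P z → ∀ᶠ y in 𝓝[K] z, P y) :
    IsCompact {z | z ∈ K ∧ ¬ P z} := by
  refine hK.of_isClosed_subset (isClosed_of_closure_subset fun z hz => ?_) fun z hz => hz.1
  have hzK : z ∈ K := hc.closure_subset (closure_mono (fun y hy => hy.1) hz)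
  refine ⟨hzK, fun hP => ?_⟩
  rw [mem_closure_iff_frequently] at hz
  have h1 := eventually_nhdsWithin_iff.mp (h z hzK hP)
  obtain ⟨y, hy1, hy2⟩ := (hz.and_eventually h1).exists
  exact hy1.2 (hy2 hy1.1)

/-! ### Comparison arguments on the compact manifold -/

section Global

variable {n : ℕ} {M : Type*} [TopologicalSpace M] [CompactSpace M]
  [ChartedSpace (EuclideanSpace ℝ (Fin n)) M]
  [IsManifold (𝓡 n) ∞ M] {Φ : ℝ → ℝ} {T : ℝ} {X ν : ℝ → M → Ambient n}

namespace IsSolution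

variable (hs : IsSolution Φ T X ν) (hΦ : ContDiffOn ℝ ∞ Φ (Ioi 0))
  (hΦ_pos : ∀ x, 0 < x → 0 < Φ x) (hΦ_deriv_pos : ∀ x, 0 < x → 0 < deriv Φ x)
include hs hΦ hΦ_pos hΦ_deriv_pos

/-- Positivity of the mean curvature is preserved. -/
theorem meanCurvature_pos (hmean : ∀ p : M, 0 < meanCurvature (X 0) (ν 0) p) {t : ℝ}
    (ht : t ∈ Ico 0 T) (p : M) : 0 < meanCurvature (X t) (ν t) p := by
  have h0T : (0 : ℝ) ∈ Ico 0 T := ⟨le_rfl, ht.1.trans_lt ht.2⟩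
  by_contra hneg
  set H : ℝ × M → ℝ := fun z => meanCurvature (X z.1) (ν z.1) z.2 with hH
  have hHc : ContinuousOn H (Ico 0 T ×ˢ univ) := hs.continuousOn_meanCurvature
  have hc0 : ContinuousOn (fun p : M => H (0, p)) univ :=
    hHc.comp (by fun_prop) fun p _ => ⟨h0T, mem_univ _⟩
  obtain ⟨m, hm, _, _, hmb⟩ := exists_pos_bounds_on_compact isCompact_univ hc0
    fun p _ => hmean p
  -- Half the initial lower bound: the level `c` is first reached at a positive time, and `H` is
  -- still positive there.
  set c := m / 2 with hc
  have hcpos : 0 < c := by positivity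
  have hKsub : Icc 0 t ×ˢ (univ : Set M) ⊆ Ico 0 T ×ˢ univ :=
    prod_mono (fun s hs' => ⟨hs'.1, hs'.2.trans_lt ht.2⟩) le_rfl
  have hD := isCompact_setOf_not (K := Icc 0 t ×ˢ (univ : Set M)) (P := fun z => c < H z)
    (isCompact_Icc.prod isCompact_univ) (isClosed_Icc.prod isClosed_univ)
    fun z hz hlt => ((hHc.mono hKsub) z hz).eventually (lt_mem_nhds hlt)
  obtain ⟨⟨t₀, p₀⟩, ⟨hzK, hzn⟩, hmin⟩ := hD.exists_isMinOn
    ⟨(t, p), ⟨⟨ht.1, le_rfl⟩, mem_univ _⟩, fun h => hneg (hcpos.trans h)⟩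
    continuous_fst.continuousOn
  have ht₀ : 0 < t₀ := by
    refine lt_of_le_of_ne hzK.1.1 fun h0 => hzn ?_
    have := (hmb p₀ (mem_univ _)).1
    rw [← h0]
    linarith
  have ht₀T : t₀ < T := hzK.1.2.trans_lt ht.2
  have hp := mem_extChartAt_source (I := 𝓡 n) p₀
  set U := (extChartAt (𝓡 n) p₀).target with hU
  have hUo : IsOpen U := isOpen_extChartAt_target p₀
  set z : ℝ × Coord n := (t₀, extChartAt (𝓡 n) p₀ p₀) with hz
  have hzU : z ∈ Ioo 0 T ×ˢ U := ⟨⟨ht₀, ht₀T⟩, (extChartAt (𝓡 n) p₀).map_source hp⟩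
  have hΩo : IsOpen (Ioo 0 T ×ˢ U) := isOpen_Ioo.prod hUo
  have hsub : Ioo 0 T ×ˢ U ⊆ Ico 0 T ×ˢ U := prod_mono Ioo_subset_Ico_self le_rfl
  have hcurvc : ContinuousOn (curv (chartRep p₀ X) (chartRep p₀ ν)) (Ioo 0 T ×ˢ U) :=
    (hs.continuousOn_curv_chartRep p₀).mono hsub
  have hev : ∀ᶠ w in 𝓝 z, w.1 < z.1 → curv (chartRep p₀ X) (chartRep p₀ ν) w ∈ Ici c := by
    filter_upwards [hΩo.mem_nhds hzU] with w hw hlt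
    have hw' := hsub hw
    have h1 := hs.meanCurvature_eq ((extChartAt (𝓡 n) p₀).map_target hw'.2) hw'.1
    rw [(extChartAt (𝓡 n) p₀).right_inv hw'.2] at h1
    change c ≤ curv (chartRep p₀ X) (chartRep p₀ ν) (w.1, w.2)
    rw [← h1]
    by_contra hlt'
    have h2 := hmin (show (w.1, (extChartAt (𝓡 n) p₀).symm w.2) ∈ _ from
      ⟨⟨⟨hw'.1.1, hlt.le.trans hzK.1.2⟩, mem_univ _⟩, fun h => hlt' (le_of_lt h)⟩)
    exact absurd hlt (not_lt.mpr h2)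
  have hev' := eventually_le_of_eventually_lt isClosed_Ici
    (by filter_upwards [hΩo.mem_nhds hzU] with w hw using hcurvc.continuousAt (hΩo.mem_nhds hw))
    hev
  have hzc : c ≤ curv (chartRep p₀ X) (chartRep p₀ ν) z := hev'.self_of_nhds le_rfl
  have hzle : curv (chartRep p₀ X) (chartRep p₀ ν) z ≤ c := by
    rw [← hs.meanCurvature_eq hp ⟨ht₀.le, ht₀T⟩]
    exact not_lt.mp hzn
  -- Since `H` is not yet known to be positive everywhere, the flow is restricted to the open set
  -- where it is.
  have hflow := hs.localFlow p₀ (hcurvc.isOpen_inter_preimage hΩo (isOpen_Ioi (a := 0)))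
    inter_subset_left fun w hw => hw.2
  refine hflow.not_min_curv hΦ hΦ_pos hΦ_deriv_pos (z := z) ⟨hzU, hcpos.trans_le hzc⟩ ?_
  filter_upwards [hev'] with w hw hle
  exact hzle.trans (hw hle)

variable (hH : ∀ t ∈ Ico 0 T, ∀ p : M, 0 < meanCurvature (X t) (ν t) p)
include hH

omit hΦ hΦ_pos hΦ_deriv_pos [CompactSpace M] in
lemma localFlow_chart (q : M) :
    LocalFlow Φ (Ioo 0 T ×ˢ (extChartAt (𝓡 n) q).target) (chartRep q X) (chartRep q ν) := by
  refine hs.localFlow q (isOpen_Ioo.prod (isOpen_extChartAt_target q)) le_rfl fun z hz => ?_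
  have ht : z.1 ∈ Ico 0 T := Ioo_subset_Ico_self hz.1
  have h := hH z.1 ht ((extChartAt (𝓡 n) q).symm z.2)
  rwa [hs.meanCurvature_eq ((extChartAt (𝓡 n) q).map_target hz.2) ht,
    (extChartAt (𝓡 n) q).right_inv hz.2] at h

variable (hΦ_deriv2_pos : ∀ x, 0 < x → 0 < deriv (deriv Φ) x)
include hΦ_deriv2_pos

/-- Weak convexity is preserved. -/
theorem atLeast_zero (hinit : ∀ p : M, AtLeast (coordDiff (X 0) p) (coordDiff (ν 0) p) 0)
    {t : ℝ} (ht : t ∈ Ico 0 T) (p : M) : AtLeast (coordDiff (X t) p) (coordDiff (ν t) p) 0 := by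
  have hKsub : Icc 0 t ×ˢ (univ : Set M) ⊆ Ico 0 T ×ˢ univ :=
    prod_mono (fun s hs' => ⟨hs'.1, hs'.2.trans_lt ht.2⟩) le_rfl
  have hK : IsCompact (Icc 0 t ×ˢ (univ : Set M)) := isCompact_Icc.prod isCompact_univ
  have hRc : ContinuousOn (fun z : ℝ × M => deriv Φ (meanCurvature (X z.1) (ν z.1) z.2)
      * (|normSqCurv (X z.1) (ν z.1) z.2| + meanCurvature (X z.1) (ν z.1) z.2))
      (Ico 0 T ×ˢ univ) :=
    ((contDiffOn_deriv_pos hΦ).continuousOn.comp hs.continuousOn_meanCurvature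
      fun z hz => hH z.1 hz.1 z.2).mul
      (hs.continuousOn_normSqCurv.abs.add hs.continuousOn_meanCurvature)
  obtain ⟨C, hC, hCb⟩ := exists_norm_bound_on_compact hK (hRc.mono hKsub)
  -- The touching function depends on time only, stays in `[-1, 0)` up to time `t`, and ends at
  -- `-δ`. Its exponential rate `C + 1` exceeds the bound `C` for the reaction coefficient `Φ'(|A|²
  -- + Hμ)` with `μ ≤ 1`.
  have key : ∀ δ ∈ Ioc (0 : ℝ) 1, AtLeast (coordDiff (X t) p) (coordDiff (ν t) p) (-δ) := by
    intro δ hδ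
    set m : ℝ → ℝ := fun s => -δ * Real.exp ((C + 1) * (s - t)) with hm
    have hmc : Continuous m := by fun_prop
    have hmneg : ∀ s, m s < 0 := fun s => by
      have := mul_pos hδ.1 (Real.exp_pos ((C + 1) * (s - t)))
      simp only [hm]; linarith
    have hmge : ∀ s ≤ t, -1 ≤ m s := fun s hst => by
      have h1 : Real.exp ((C + 1) * (s - t)) ≤ 1 :=
        Real.exp_le_one_iff.mpr (mul_nonpos_of_nonneg_of_nonpos (by linarith) (by linarith))
      have h2 := mul_le_mul hδ.2 h1 (Real.exp_pos _).le zero_le_one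
      simp only [hm]; linarith
    have hmt : m t = -δ := by simp [hm]
    suffices hab : Above (coordDiff (X t) p) (coordDiff (ν t) p) (m t) by
      rw [← hmt]; exact hab.atLeast
    by_contra hneg
    have hD := isCompact_setOf_not (K := Icc 0 t ×ˢ (univ : Set M))
      (P := fun z => Above (coordDiff (X z.1) z.2) (coordDiff (ν z.1) z.2) (m z.1))
      hK (isClosed_Icc.prod isClosed_univ)
      fun z hz hlt => (hs.eventually_above hmc (hKsub hz).1 hlt).filter_mono
        (nhdsWithin_mono _ hKsub)
    obtain ⟨⟨t₀, p₀⟩, ⟨hzK, hzn⟩, hmin⟩ := hD.exists_isMinOn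
      ⟨(t, p), ⟨⟨ht.1, le_rfl⟩, mem_univ _⟩, hneg⟩ continuous_fst.continuousOn
    have hT0 : t₀ ∈ Ico 0 T := (hKsub hzK).1
    have ht₀ : 0 < t₀ := by
      refine lt_of_le_of_ne hzK.1.1 fun h0 => hzn ?_
      rw [← h0]
      rw [← h0] at hT0
      exact (hinit p₀).above (hs.injective_coordDiff hT0 p₀) (hmneg 0)
    have hp := mem_extChartAt_source (I := 𝓡 n) p₀
    -- The first contact is examined in the preferred chart around `p₀`.
    set U := (extChartAt (𝓡 n) p₀).target with hU
    have hflow := hs.localFlow_chart hH p₀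
    set F := chartRep p₀ X with hF
    set N := chartRep p₀ ν with hN
    set z : ℝ × Coord n := (t₀, extChartAt (𝓡 n) p₀ p₀) with hz
    have hzU : z ∈ Ioo 0 T ×ˢ U := ⟨⟨ht₀, hT0.2⟩, (extChartAt (𝓡 n) p₀).map_source hp⟩
    have hΩo := hflow.isOpen
    have hGc : ContinuousOn (fun w => (spatial F w, spatial N w, m w.1)) (Ioo 0 T ×ˢ U) :=
      (hflow.contDiffOn_spatial hflow.smooth).continuousOn.prodMk
        ((hflow.contDiffOn_spatial hflow.smooth_normal).continuousOn.prodMk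
          (hmc.comp continuous_fst).continuousOn)
    have hev : ∀ᶠ w in 𝓝 z, w.1 < z.1 →
        (spatial F w, spatial N w, m w.1) ∈ {x : (Coord n →L[ℝ] Ambient n) ×
          (Coord n →L[ℝ] Ambient n) × ℝ | AtLeast x.1 x.2.1 x.2.2} := by
      filter_upwards [hΩo.mem_nhds hzU] with w hw hlt
      have hw1 : w.1 ∈ Ico 0 T := Ioo_subset_Ico_self hw.1
      by_contra hlt'
      have h2 := hmin (show (w.1, (extChartAt (𝓡 n) p₀).symm w.2) ∈ _ from
        ⟨⟨⟨hw1.1, hlt.le.trans hzK.1.2⟩, mem_univ _⟩, fun h => hlt' (by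
          have h3 := (hs.above_iff ((extChartAt (𝓡 n) p₀).map_target hw.2) hw1).mp h
          rw [(extChartAt (𝓡 n) p₀).right_inv hw.2] at h3
          exact h3.atLeast)⟩)
      exact absurd hlt (not_lt.mpr h2)
    have hev' := eventually_le_of_eventually_lt isClosed_atLeast
      (by filter_upwards [hΩo.mem_nhds hzU] with w hw using hGc.continuousAt (hΩo.mem_nhds hw))
      hev
    have hzn' : ¬ Above (spatial F z) (spatial N z) (m t₀) := fun h =>
      hzn ((hs.above_iff hp hT0).mpr h)
    obtain ⟨u, hu, heq⟩ := exists_of_not_above hzn' (hev'.self_of_nhds le_rfl)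
    have hφs : ContDiff ℝ ∞ (fun w : ℝ × Coord n => m w.1) := by fun_prop
    have hpdφ : ∀ a w : ℝ × Coord n, pd a (fun w : ℝ × Coord n => m w.1) w
        = m w.1 * ((C + 1) * a.1) := by
      intro a w
      have h1 : HasFDerivAt (fun w : ℝ × Coord n => (C + 1) * (w.1 - t))
          ((C + 1) • ContinuousLinearMap.fst ℝ ℝ (Coord n)) w :=
        ((ContinuousLinearMap.fst ℝ ℝ (Coord n)).hasFDerivAt.sub_const t).const_mul (C + 1)
      have h2 : fderiv ℝ (fun w : ℝ × Coord n => m w.1) w = _ := (h1.exp.const_mul (-δ)).fderiv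
      rw [pd, h2]
      simp [hm]
      ring
    have hpdsp : ∀ a : Coord n, pd (0, a) (fun w : ℝ × Coord n => m w.1) = fun _ => 0 := by
      intro a; ext w; rw [hpdφ]; simp
    obtain ⟨L, d, -, -, hineq, -⟩ := hflow.touching hΦ hΦ_deriv_pos hΦ_deriv2_pos hzU
      hφs.contDiffOn hev' hu heq
    have hsum : ∑ k, (pd (0, L (basisVec k)) (pd (0, L (basisVec k))
          fun w : ℝ × Coord n => m w.1) z
        + pd (0, d (basisVec k)) (fun w : ℝ × Coord n => m w.1) z) = 0 := by
      refine Finset.sum_eq_zero fun k _ => ?_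
      rw [hpdsp, hpdsp, pd_const, add_zero]
    have hR := hCb (t₀, p₀) hzK
    have hH0 := hH t₀ hT0 p₀
    rw [hsum, hpdφ, ← hs.normSqCurv_eq hp hT0, ← hs.meanCurvature_eq hp hT0] at hineq
    simp only [mul_one, zero_add] at hineq hR
    change _ ≤ m t₀ * (C + 1) at hineq
    change deriv Φ (meanCurvature (X t₀) (ν t₀) p₀) * (normSqCurv (X t₀) (ν t₀) p₀ * m t₀
      - meanCurvature (X t₀) (ν t₀) p₀ * m t₀ ^ 2)
      + Φ (meanCurvature (X t₀) (ν t₀) p₀) * m t₀ ^ 2 ≤ m t₀ * (C + 1) at hineq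
    have hR' := (le_abs_self _).trans hR
    set Hc := meanCurvature (X t₀) (ν t₀) p₀
    set Q := normSqCurv (X t₀) (ν t₀) p₀
    have hP' := hΦ_deriv_pos _ hH0
    have hP := hΦ_pos _ hH0
    have hm1 := hmneg t₀
    have hm2 := hmge t₀ hzK.1.2
    set μ := -m t₀ with hμ
    have hmμ : m t₀ = -μ := by rw [hμ]; ring
    rw [hmμ] at hineq
    have hμ0 : 0 < μ := by linarith
    have hμ1 : μ ≤ 1 := by linarith
    have e1 : deriv Φ Hc * (Q + Hc * μ) ≤ deriv Φ Hc * (|Q| + Hc) := by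
      refine mul_le_mul_of_nonneg_left (add_le_add (le_abs_self Q) ?_) hP'.le
      nlinarith
    have e2 : μ * (deriv Φ Hc * (Q + Hc * μ)) ≤ μ * C :=
      mul_le_mul_of_nonneg_left (e1.trans hR') hμ0.le
    -- The term `Φφ²` helps and is dropped; what is left reads `μ (C + 1) ≤ μ C` with `μ > 0`.
    have e3 : 0 ≤ Φ Hc * (-μ) ^ 2 := mul_nonneg hP.le (sq_nonneg _)
    nlinarith
  have hlim : Tendsto (fun δ : ℝ => (coordDiff (X t) p, coordDiff (ν t) p, -δ)) (𝓝[>] 0)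
      (𝓝 (coordDiff (X t) p, coordDiff (ν t) p, 0)) := by
    have : Continuous fun δ : ℝ => (coordDiff (X t) p, coordDiff (ν t) p, -δ) := by fun_prop
    have h := this.tendsto 0
    rw [neg_zero] at h
    exact h.mono_left nhdsWithin_le_nhds
  refine isClosed_atLeast.mem_of_tendsto hlim ?_
  filter_upwards [Ioc_mem_nhdsGT (zero_lt_one' ℝ)] with δ hδ using key δ hδ

omit [CompactSpace M] in
lemma above_of_above (hconv : ∀ t ∈ Ico 0 T, ∀ p : M,
      AtLeast (coordDiff (X t) p) (coordDiff (ν t) p) 0)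
    {q p p' : M} (hp : p ∈ (extChartAt (𝓡 n) q).source) (hp' : p' ∈ (extChartAt (𝓡 n) q).source)
    {t₀ t₁ R : ℝ} (ht₀ : 0 < t₀) (ht : t₀ < t₁) (ht₁ : t₁ < T) (hR : 0 < R)
    (hball : Metric.closedBall (extChartAt (𝓡 n) q p) R ⊆ (extChartAt (𝓡 n) q).target)
    (hmem : extChartAt (𝓡 n) q p' ∈ Metric.ball (extChartAt (𝓡 n) q p) R)
    (h : Above (coordDiff (X t₀) p) (coordDiff (ν t₀) p) 0) :
    Above (coordDiff (X t₁) p') (coordDiff (ν t₁) p') 0 := by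
  rw [hs.above_iff hp ⟨ht₀.le, ht.trans ht₁⟩] at h
  rw [hs.above_iff hp' ⟨(ht₀.trans ht).le, ht₁⟩]
  refine (hs.localFlow_chart hH q).propagation hΦ hΦ_pos hΦ_deriv_pos hΦ_deriv2_pos ?_ ht hR ?_ h
    hmem
  · intro z hz
    have hz1 : z.1 ∈ Ico 0 T := Ioo_subset_Ico_self hz.1
    have h1 := (hs.atLeast_iff ((extChartAt (𝓡 n) q).map_target hz.2) hz1).mp
      (hconv z.1 hz1 ((extChartAt (𝓡 n) q).symm z.2))
    rwa [(extChartAt (𝓡 n) q).right_inv hz.2] at h1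
  · exact prod_mono (fun s hs' => ⟨ht₀.trans_le hs'.1, hs'.2.trans_lt ht₁⟩) hball

/-- A weakly convex solution is strictly convex at positive times. -/
theorem above_zero (hconv : ∀ t ∈ Ico 0 T, ∀ p : M,
      AtLeast (coordDiff (X t) p) (coordDiff (ν t) p) 0) {t : ℝ} (ht : t ∈ Ioo 0 T) (p : M) :
    Above (coordDiff (X t) p) (coordDiff (ν t) p) 0 := by
  set S : Set M := {p | ∀ t ∈ Ioo 0 T, Above (coordDiff (X t) p) (coordDiff (ν t) p) 0} with hS
  -- Openness and closedness in one statement: a point of `S` close to `q` is strictly convex at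
  -- time `s / 2`, and propagation carries this to all points near `q` by time `s`.
  have hnhds : ∀ q ∈ closure S, S ∈ 𝓝 q := by
    intro q hq
    have hqs := mem_extChartAt_source (I := 𝓡 n) q
    obtain ⟨r, hr, hball⟩ := Metric.isOpen_iff.mp (isOpen_extChartAt_target (I := 𝓡 n) q)
      (extChartAt (𝓡 n) q q) ((extChartAt (𝓡 n) q).map_source hqs)
    have hR : 0 < r / 4 := by positivity
    have hnear : ∀ᶠ y in 𝓝 q, y ∈ (extChartAt (𝓡 n) q).source ∧
        dist (extChartAt (𝓡 n) q y) (extChartAt (𝓡 n) q q) < r / 4 :=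
      Filter.Eventually.and (p := fun y => y ∈ (extChartAt (𝓡 n) q).source)
        ((isOpen_extChartAt_source (I := 𝓡 n) q).mem_nhds hqs)
        ((continuousAt_extChartAt (I := 𝓡 n) q).eventually (Metric.ball_mem_nhds _ hR))
    obtain ⟨p', hp'S, hp'1, hp'2⟩ := ((mem_closure_iff_frequently.mp hq).and_eventually hnear).exists
    filter_upwards [hnear] with y hy s hsT
    refine hs.above_of_above hΦ hΦ_pos hΦ_deriv_pos hH hΦ_deriv2_pos hconv hp'1 hy.1
      (half_pos hsT.1) (half_lt_self hsT.1) hsT.2 (half_pos hr) ?_ ?_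
      (hp'S (s / 2) ⟨half_pos hsT.1, (half_lt_self hsT.1).trans hsT.2⟩)
    -- The centre lies within `r / 4` of the image of `q`, so its ball of radius `r / 2` stays in
    -- the chart and contains the ball of radius `r / 4` around that image.
    · intro x hx
      refine hball (Metric.mem_ball.mpr ?_)
      have := dist_triangle x (extChartAt (𝓡 n) q p') (extChartAt (𝓡 n) q q)
      have h1 := Metric.mem_closedBall.mp hx
      linarith
    · rw [Metric.mem_ball]
      have := dist_triangle_right (extChartAt (𝓡 n) q y) (extChartAt (𝓡 n) q p')
        (extChartAt (𝓡 n) q q)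
      linarith [hy.2]
  have hSopen : IsOpen S := isOpen_iff_mem_nhds.mpr fun q hq => hnhds q (subset_closure hq)
  have hSclosed : IsClosed S :=
    isClosed_of_closure_subset fun q hq => mem_of_mem_nhds (hnhds q hq)
  suffices hempty : Sᶜ = ∅ by
    have : p ∈ S := by rw [compl_empty_iff.mp hempty]; exact mem_univ p
    exact this t ht
  by_contra hne
  have h0T : (0 : ℝ) ∈ Ico 0 T := ⟨le_rfl, ht.1.trans ht.2⟩
  have hXc : Continuous fun p => ‖X 0 p‖ := by
    have h1 : ContinuousOn (fun p : M => uncurry X (0, p)) univ :=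
      hs.smooth.continuousOn.comp (by fun_prop) fun p _ => ⟨h0T, mem_univ _⟩
    exact (continuousOn_univ.mp h1).norm
  -- As the complement is also open, a maximum of `‖X₀‖` on it is a local maximum on `M`.
  obtain ⟨q, hq, hmax⟩ := hSopen.isClosed_compl.isCompact.exists_isMaxOn
    (nonempty_iff_ne_empty.mpr hne) hXc.continuousOn
  have hloc : IsLocalMax (fun y => ‖X 0 y‖) q := by
    filter_upwards [hSclosed.isOpen_compl.mem_nhds hq] with y hy using hmax hy
  have hab := hs.above_of_isLocalMax h0T (hconv 0 h0T q) hloc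
  have hev := hs.eventually_above (m := fun _ => 0) continuous_const h0T hab
  have htend : Tendsto (fun s : ℝ => (s, q)) (𝓝[>] 0) (𝓝[Ico 0 T ×ˢ univ] (0, q)) := by
    refine tendsto_nhdsWithin_iff.mpr ⟨?_, ?_⟩
    · exact (Continuous.tendsto (by fun_prop : Continuous fun s : ℝ => (s, q)) 0).mono_left
        nhdsWithin_le_nhds
    · filter_upwards [Ioo_mem_nhdsGT (ht.1.trans ht.2)] with s hs'
      exact ⟨Ioo_subset_Ico_self hs', mem_univ _⟩
  refine hq fun s hsT => ?_
  -- Continuity gives strict convexity at some positive time `s₀ < s`, and propagation at the fixed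
  -- point `q` takes it to time `s`.
  obtain ⟨s₀, hs₀, hs₀1, hs₀2⟩ := ((htend.eventually hev).and
    (Ioo_mem_nhdsGT hsT.1)).exists
  have hqs := mem_extChartAt_source (I := 𝓡 n) q
  obtain ⟨r, hr, hball⟩ := Metric.isOpen_iff.mp (isOpen_extChartAt_target (I := 𝓡 n) q)
    (extChartAt (𝓡 n) q q) ((extChartAt (𝓡 n) q).map_source hqs)
  exact hs.above_of_above hΦ hΦ_pos hΦ_deriv_pos hH hΦ_deriv2_pos hconv hqs hqs hs₀1 hs₀2 hsT.2
    (half_pos hr) ((Metric.closedBall_subset_ball (half_lt_self hr)).trans hball)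
    (Metric.mem_ball_self (half_pos hr)) hs₀

end IsSolution

end Global

end PhiFlow

end

theorem mainTheorem6 {n : ℕ} (hn : 2 ≤ n)
    {M : Type*} [TopologicalSpace M] [T2Space M] [CompactSpace M]
    [ChartedSpace (EuclideanSpace ℝ (Fin n)) M] [IsManifold (𝓡 n) ∞ M]
    (Φ : ℝ → ℝ) (hΦ : ContDiffOn ℝ ∞ Φ (Ioi 0))
    (hΦ_pos : ∀ x, 0 < x → 0 < Φ x)
    (hΦ_deriv_pos : ∀ x, 0 < x → 0 < deriv Φ x)
    (hΦ_deriv2_pos : ∀ x, 0 < x → 0 < deriv (deriv Φ) x)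
    (hΦ_ratio : ∀ x, 0 < x → Φ x / x ≤ deriv Φ x)
    (T : ℝ) (X ν : ℝ → M → PhiFlow.Ambient n)
    (hflow : PhiFlow.IsSolution Φ T X ν)
    (hconvex : PhiFlow.WeaklyConvex (X 0) (ν 0))
    (hmean : ∀ p : M, 0 < PhiFlow.meanCurvature (X 0) (ν 0) p) :
    ∀ t ∈ Ioo 0 T, PhiFlow.StrictlyConvex (X t) (ν t) := by
  intro t ht p κ hκ
  have h0T : (0 : ℝ) ∈ Ico 0 T := ⟨le_rfl, ht.1.trans ht.2⟩
  have hH : ∀ t ∈ Ico 0 T, ∀ p : M, 0 < PhiFlow.meanCurvature (X t) (ν t) p :=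
    fun t ht p => hflow.meanCurvature_pos hΦ hΦ_pos hΦ_deriv_pos hmean ht p
  have hinit : ∀ p : M,
      PhiFlow.AtLeast (PhiFlow.coordDiff (X 0) p) (PhiFlow.coordDiff (ν 0) p) 0 := by
    intro p v
    rw [zero_mul]
    exact PhiFlow.nonneg_of_eigenvalues (hflow.injective_coordDiff h0T p)
      (hflow.symm_coordDiff h0T p) (fun κ hκ => hconvex p κ hκ) v
  have hconv : ∀ t ∈ Ico 0 T, ∀ p : M,
      PhiFlow.AtLeast (PhiFlow.coordDiff (X t) p) (PhiFlow.coordDiff (ν t) p) 0 :=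
    fun t ht p => hflow.atLeast_zero hΦ hΦ_pos hΦ_deriv_pos hH hΦ_deriv2_pos hinit ht p
  have habove := hflow.above_zero hΦ hΦ_pos hΦ_deriv_pos hH hΦ_deriv2_pos hconv ht p
  refine PhiFlow.eigenvalue_pos (hflow.injective_coordDiff (Ioo_subset_Ico_self ht) p)
    (fun v hv => ?_) hκ
  have := habove v hv
  rwa [zero_mul] at this
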